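/- Let $(M,g)$ be an oriented space-time: a smooth oriented 4-manifold with a smooth metric $g$ of signature $(-,+,+,+)$, volume element $\eta$, Levi-Civita connection $\nabla$, Hodge dual $(*F)_{ab}=\tfrac12\eta_{abcd}F^{cd}$ and codifferential $(\delta F)_b=-\nabla^aF_{ab}$ on 2-forms. Assume that $M$ is non conformally flat, in the sense that the Weyl tensor $W$ does not vanish at any point (it is nowhere of Petrov-Bel type O). Let $U$ be the canonical 2-form of a $2+2$ almost-product structure, i.e. a smooth 2-form that is at every point the volume element $t^\flat\wedge s^\flat$ of a time-like plane $V$, where $g(t,t)=-1$, $g(s,s)=1$, $g(t,s)=0$. Let $v=U^2$ (that is, $v_{ab}=U_a{}^mU_{mb}$) and $h=g-v$ be the projectors on $V$ and on its orthogonal complement $H$. Assume that the structure is umbilical: both planes are umbilical, i.e. the symmetric part of $Q_v(X,Y)=h(\nabla_{v(X)}v(Y))$ equals $\tfrac12\, v\otimes \mathrm{tr}\,Q_v$, and likewise with $v$ and $h$ interchanged. Let $\mathcal U=\tfrac1{\sqrt2}(U-\mathrm i*U)$ be the canonical self-dual bivector, $\xi=\delta\,\mathcal U$, $\chi_b=\xi^a\,\mathcal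 U_{ab}$, $T=\nabla\xi-\chi\otimes\xi$, and let $S=\tfrac12(T+T^t)$ be the symmetric part of $T$. Then the following two statements are equivalent. (i) $\mathcal U$ defines a Maxwellian structure: around every point there are smooth real functions $\phi,\psi$ such that $F=e^{\phi}(\cos\psi\,U+\sin\psi\,*U)$ satisfies the source-free Maxwell equations $\delta F=0$, $\delta *F=0$. (ii) The space-time is of Petrov-Bel type D and $[Ric,\mathcal U]=2S$. Here $Ric_{bd}=R^a{}_{bad}$ is the Ricci tensor, with the sign for which round spheres have positive Ricci curvature, and $[A,B]_{ab}=A_a{}^mB_{mb}-B_a{}^mA_{mb}$. Type D means that at every point the self-dual Weyl tensor $\mathcal W=\tfrac12(W-\mathrm i*W)$, acting on the three-dimensional complex space of self-dual bivectors ($*\mathcal F=\mathrm i\mathcal F$) by $\mathcal F_{ab}\mapsto\tfrac12\mathcal W_{ab}{}^{mn}\mathcal F_{mn}$, is diagonalizable with eigenvalues $\rho,\rho,-2\rho$ for some $\rho\neq0$ (which may depend on the point). -/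

import Mathlib

open scoped Manifold ContDiff

noncomputable section

namespace SpaceTime

/-- The coordinate space of a chart of a four-dimensional manifold. -/
abbrev Coords : Type := EuclideanSpace ℝ (Fin 4)

/-- Components, with both indices down, of a 2-tensor at a point. -/
abbrev Ten (𝕜 : Type*) : Type _ := Matrix (Fin 4) (Fin 4) 𝕜

/-! ### Algebra at a point; `G` is the matrix `g_{ab}` of the metric and `G⁻¹` is `g^{ab}` -/

/-- The Levi-Civita symbol. -/
def levi (a b c d : Fin 4) : ℤ :=
  Int.sign ((b : ℤ) - a) * Int.sign ((c : ℤ) - a) * Int.sign ((d : ℤ) - a) *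
    Int.sign ((c : ℤ) - b) * Int.sign ((d : ℤ) - b) * Int.sign ((d : ℤ) - c)

/-- The metric volume element `η_{abcd}` in a positively oriented chart. -/
def vol (G : Ten ℝ) (a b c d : Fin 4) : ℝ := Real.sqrt |G.det| * (levi a b c d : ℝ)

/-- `(A · B)_{ab} = A_a^m B_{mb}`. -/
def dot {𝕜 : Type*} [RCLike 𝕜] (G : Ten ℝ) (A B : Ten 𝕜) : Ten 𝕜 :=
  Matrix.of fun a b => ∑ m, ∑ n, G⁻¹ m n • (A a m * B n b)

/-- The Hodge dual of a 2-form, `(*F)_{ab} = ½ η_{abcd} F^{cd}`. -/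
def hodge {𝕜 : Type*} [RCLike 𝕜] (G : Ten ℝ) (F : Ten 𝕜) : Ten 𝕜 :=
  Matrix.of fun a b =>
    ∑ c, ∑ d, ∑ m, ∑ n, (1 / 2 * vol G a b c d * G⁻¹ c m * G⁻¹ d n) • F m n

/-- A self-dual bivector: a complex 2-form with `*F = i F`. -/
def IsSelfDual (G : Ten ℝ) (F : Ten ℂ) : Prop :=
  F.transpose = -F ∧ hodge G F = Complex.I • F

/-- The projection `𝒢(F) = ½ (F - i *F)` of the 2-forms onto the self-dual bivectors. -/
def sdProj (G : Ten ℝ) (F : Ten ℂ) : Ten ℂ := (1 / 2 : ℂ) • (F - Complex.I • hodge G F)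

/-! ### Differential calculus in a chart; `g` is the component field of the metric -/

/-- The partial derivative `∂_i f` at `x`. -/
def pd {F : Type*} [NormedAddCommGroup F] [NormedSpace ℝ F]
    (i : Fin 4) (f : Coords → F) (x : Coords) : F :=
  fderiv ℝ f x (EuclideanSpace.single i 1)

/-- The Christoffel symbol `Γ^k_{ij}` of the Levi-Civita connection. -/
def christoffel (g : Coords → Ten ℝ) (k i j : Fin 4) (x : Coords) : ℝ :=
  1 / 2 * ∑ l, (g x)⁻¹ k l *
    (pd i (fun y => g y j l) x + pd j (fun y => g y i l) x - pd l (fun y => g y i j) x)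

/-- `∇_a w_b`. -/
def cov₁ {𝕜 : Type*} [RCLike 𝕜] (g : Coords → Ten ℝ) (w : Coords → Fin 4 → 𝕜)
    (x : Coords) (a b : Fin 4) : 𝕜 :=
  pd a (fun y => w y b) x - ∑ c, christoffel g c a b x • w x c

/-- `∇_a F_{bc}`. -/
def cov₂ {𝕜 : Type*} [RCLike 𝕜] (g : Coords → Ten ℝ) (F : Coords → Ten 𝕜)
    (x : Coords) (a b c : Fin 4) : 𝕜 :=
  pd a (fun y => F y b c) x - ∑ m, christoffel g m a b x • F x m c
    - ∑ m, christoffel g m a c x • F x b m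

/-- The exterior codifferential of a 2-form, `(δF)_b = -∇^a F_{ab}`. -/
def codiff {𝕜 : Type*} [RCLike 𝕜] (g : Coords → Ten ℝ) (F : Coords → Ten 𝕜)
    (x : Coords) (b : Fin 4) : 𝕜 :=
  -∑ a, ∑ c, (g x)⁻¹ a c • cov₂ g F x c a b

/-- The Riemann tensor `R^a_{bcd}`. -/
def riemann (g : Coords → Ten ℝ) (x : Coords) (a b c d : Fin 4) : ℝ :=
  pd c (christoffel g a d b) x - pd d (christoffel g a c b) x
    + ∑ e, christoffel g a c e x * christoffel g e d b x
    - ∑ e, christoffel g a d e x * christoffel g e c b x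

/-- The Ricci tensor `R_{bd} = R^a_{bad}` (positive on round spheres). -/
def ricci (g : Coords → Ten ℝ) (x : Coords) : Ten ℝ :=
  Matrix.of fun b d => ∑ a, riemann g x a b a d

/-- The scalar curvature. -/
def scalar (g : Coords → Ten ℝ) (x : Coords) : ℝ := ∑ a, ∑ b, (g x)⁻¹ a b * ricci g x a b

/-- The Weyl tensor `W_{abcd}`. -/
def weyl (g : Coords → Ten ℝ) (x : Coords) (a b c d : Fin 4) : ℝ :=
  ∑ m, g x a m * riemann g x m b c d
    - 1 / 2 * (g x a c * ricci g x b d + g x b d * ricci g x a c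
      - g x a d * ricci g x b c - g x b c * ricci g x a d)
    + scalar g x / 6 * (g x a c * g x b d - g x a d * g x b c)

/-- The Weyl tensor as an endomorphism of 2-forms, `W(F)_{ab} = ½ W_{ab}^{mn} F_{mn}`. -/
def weylMap (g : Coords → Ten ℝ) (x : Coords) (F : Ten ℂ) : Ten ℂ :=
  Matrix.of fun a b =>
    ∑ c, ∑ d, ∑ m, ∑ n, (1 / 2 * weyl g x a b c d * (g x)⁻¹ c m * (g x)⁻¹ d n) • F m n

/-- The self-dual Weyl tensor `𝒲 = 𝒢 ∘ W ∘ 𝒢`. -/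
def sdWeyl (g : Coords → Ten ℝ) (x : Coords) (F : Ten ℂ) : Ten ℂ :=
  sdProj (g x) (weylMap g x (sdProj (g x) F))

/-- Petrov-Bel type D at a point: on the three-dimensional space of self-dual bivectors the
traceless endomorphism `𝒲` has minimal polynomial `(X - ρ)(X + 2ρ)` for some `ρ ≠ 0`, that is, it
is diagonalizable with a nonzero double eigenvalue `ρ` and the simple eigenvalue `-2ρ`. -/
def TypeDAt (g : Coords → Ten ℝ) (x : Coords) : Prop :=
  ∃ ρ : ℂ, ρ ≠ 0 ∧ ∀ F : Ten ℂ, IsSelfDual (g x) F →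
    sdWeyl g x (sdWeyl g x F) + ρ • sdWeyl g x F - (2 * ρ ^ 2) • F = 0

/-! ### 2+2 structures in a chart; `U` is the component field of the canonical 2-form -/

/-- The projector `v = U²` on the time-like plane, with both indices down. -/
def projV (g U : Coords → Ten ℝ) (x : Coords) : Ten ℝ := dot (g x) (U x) (U x)

/-- The projector `h = g - v` on the space-like plane, with both indices down. -/
def projH (g U : Coords → Ten ℝ) (x : Coords) : Ten ℝ := g x - projV g U x

/-- The mixed components `p^a_b` of a projector. -/
def mixed (g p : Coords → Ten ℝ) (x : Coords) : Ten ℝ := (g x)⁻¹ * p x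

/-- The generalized second fundamental form `Q_p(X, Y) = q(∇_{p(X)} p(Y))` of a plane with projector
`p`, where `q` is the projector on the orthogonal plane: the component `c` of `Q_p(∂_i, ∂_j)`. -/
def secondForm (g p q : Coords → Ten ℝ) (x : Coords) (c i j : Fin 4) : ℝ :=
  ∑ d, mixed g q x c d * ∑ a, mixed g p x a i *
    (pd a (fun y => mixed g p y d j) x + ∑ b, christoffel g d a b x * mixed g p x b j)

/-- The plane with projector `p` is umbilical at `x`: the symmetric part of its second fundamental
form is `½ p ⊗ tr`, i.e. its traceless part vanishes. -/
def UmbilicalPlaneAt (g p q : Coords → Ten ℝ) (x : Coords) : Prop :=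
  ∀ c i j, 1 / 2 * (secondForm g p q x c i j + secondForm g p q x c j i) =
    1 / 2 * p x i j * ∑ a, ∑ b, (g x)⁻¹ a b * secondForm g p q x c a b

/-- The canonical self-dual bivector `𝒰 = (U - i *U) / √2`. -/
def canonicalSD (g U : Coords → Ten ℝ) (x : Coords) : Ten ℂ :=
  Matrix.of fun a b =>
    (1 / (Real.sqrt 2 : ℂ)) * ((U x a b : ℂ) - Complex.I * ((hodge (g x) (U x) a b : ℝ) : ℂ))

/-- `ξ = δ𝒰`. -/
def xi (g U : Coords → Ten ℝ) (x : Coords) : Fin 4 → ℂ := codiff g (canonicalSD g U) x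

/-- `χ = i_ξ 𝒰`, i.e. `χ_b = ξ^a 𝒰_{ab}`. -/
def chi (g U : Coords → Ten ℝ) (x : Coords) (b : Fin 4) : ℂ :=
  ∑ a, ∑ c, (g x)⁻¹ a c • (xi g U x c * canonicalSD g U x a b)

/-- `T = ∇ξ - χ ⊗ ξ`. -/
def tensorT (g U : Coords → Ten ℝ) (x : Coords) : Ten ℂ :=
  Matrix.of fun a b => cov₁ g (xi g U) x a b - chi g U x a * xi g U x b

/-- The symmetric part `S` of `T`. -/
def tensorS (g U : Coords → Ten ℝ) (x : Coords) : Ten ℂ :=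
  (1 / 2 : ℂ) • (tensorT g U x + (tensorT g U x).transpose)

/-- The commutator `[Ric, 𝒰]`. -/
def ricciCommutator (g U : Coords → Ten ℝ) (x : Coords) : Ten ℂ :=
  dot (g x) ((ricci g x).map Complex.ofReal) (canonicalSD g U x)
    - dot (g x) (canonicalSD g U x) ((ricci g x).map Complex.ofReal)

/-- The non-null 2-form with geometry `U`, energetic index `φ` and Rainich index `ψ`. -/
def maxwellField (g U : Coords → Ten ℝ) (φ ψ : Coords → ℝ) (x : Coords) : Ten ℝ :=
  Real.exp (φ x) • (Real.cos (ψ x) • U x + Real.sin (ψ x) • hodge (g x) (U x))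

/-! ### Space-times -/

section Manifold

variable {M : Type*} [TopologicalSpace M] [ChartedSpace Coords M]

/-- A field of bilinear forms on the tangent spaces of `M`. -/
abbrev BilinField (M : Type*) [TopologicalSpace M] [ChartedSpace Coords M] : Type _ :=
  ∀ p : M, LinearMap.BilinForm ℝ (TangentSpace (𝓡 4) p)

/-- The components `B(∂_i, ∂_j)` in the chart `e`, as functions of the coordinates. -/
def comp (B : BilinField M) (e : OpenPartialHomeomorph M Coords) (x : Coords) : Ten ℝ :=
  Matrix.of fun i j =>
    B (e.symm x) (mfderiv (𝓡 4) (𝓡 4) e.symm x (EuclideanSpace.single i 1))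
      (mfderiv (𝓡 4) (𝓡 4) e.symm x (EuclideanSpace.single j 1))

end Manifold

end SpaceTime

open SpaceTime in
/-- An oriented space-time: a smooth 4-manifold with an orientation, given by an oriented atlas of
smooth charts, and a smooth metric of signature `(-, +, +, +)`. -/
structure OrientedSpaceTime (M : Type*) [TopologicalSpace M] [ChartedSpace Coords M]
    [IsManifold (𝓡 4) ∞ M] where
  /-- the positively oriented charts -/
  charts : Set (OpenPartialHomeomorph M Coords)
  charts_smooth : charts ⊆ IsManifold.maximalAtlas (𝓡 4) ∞ M
  charts_cover : ∀ p : M, ∃ e ∈ charts, p ∈ e.source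
  charts_oriented : ∀ e ∈ charts, ∀ e' ∈ charts, ∀ x ∈ e.target, e.symm x ∈ e'.source →
    0 < (fderiv ℝ (fun y => e' (e.symm y)) x).det
  /-- the metric -/
  metric : BilinField M
  metric_smooth : ∀ e ∈ charts, ∀ i j, ContDiffOn ℝ ∞ (fun x => comp metric e x i j) e.target
  metric_lorentz : ∀ p : M, ∃ b : Module.Basis (Fin 4) ℝ (TangentSpace (𝓡 4) p),
    ∀ i j, metric p (b i) (b j) = if i = j then (if i = 0 then -1 else 1) else 0

namespace OrientedSpaceTime

open SpaceTime

variable {M : Type*} [TopologicalSpace M] [ChartedSpace Coords M] [IsManifold (𝓡 4) ∞ M]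

/-- `U` is the canonical 2-form of a 2+2 almost-product structure: a smooth 2-form which is at every
point the volume element `t♭ ∧ s♭` of a time-like plane, `(t, s)` being an orthonormal basis of it
with `t` time-like. -/
structure IsCanonicalForm (𝒮 : OrientedSpaceTime M) (U : BilinField M) : Prop where
  smooth : ∀ e ∈ 𝒮.charts, ∀ i j, ContDiffOn ℝ ∞ (fun x => comp U e x i j) e.target
  volumeElement : ∀ p : M, ∃ t s : TangentSpace (𝓡 4) p,
    𝒮.metric p t t = -1 ∧ 𝒮.metric p s s = 1 ∧ 𝒮.metric p t s = 0 ∧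
    ∀ X Y, U p X Y = 𝒮.metric p t X * 𝒮.metric p s Y - 𝒮.metric p t Y * 𝒮.metric p s X

/-- The 2+2 structure with canonical 2-form `U` is umbilical: both planes are umbilical. -/
def IsUmbilical (𝒮 : OrientedSpaceTime M) (U : BilinField M) : Prop :=
  ∀ e ∈ 𝒮.charts, ∀ x ∈ e.target,
    UmbilicalPlaneAt (comp 𝒮.metric e) (projV (comp 𝒮.metric e) (comp U e))
      (projH (comp 𝒮.metric e) (comp U e)) x ∧
    UmbilicalPlaneAt (comp 𝒮.metric e) (projH (comp 𝒮.metric e) (comp U e))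
      (projV (comp 𝒮.metric e) (comp U e)) x

/-- The space-time is non conformally flat (nowhere of Petrov-Bel type O): the Weyl tensor does not
vanish at any point. -/
def NonConformallyFlat (𝒮 : OrientedSpaceTime M) : Prop :=
  ∀ e ∈ 𝒮.charts, ∀ x ∈ e.target, ∃ a b c d, weyl (comp 𝒮.metric e) x a b c d ≠ 0

/-- The space-time is of Petrov-Bel type D (at every point). -/
def IsTypeD (𝒮 : OrientedSpaceTime M) : Prop :=
  ∀ e ∈ 𝒮.charts, ∀ x ∈ e.target, TypeDAt (comp 𝒮.metric e) x

/-- `U` defines a Maxwellian structure: around every point, `U` is the geometry of a non-null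
solution `F = e^φ (cos ψ U + sin ψ *U)` of the source-free Maxwell equations `δF = 0`, `δ*F = 0`. -/
def IsMaxwellian (𝒮 : OrientedSpaceTime M) (U : BilinField M) : Prop :=
  ∀ e ∈ 𝒮.charts, ∀ x ∈ e.target, ∃ N : Set Coords, IsOpen N ∧ x ∈ N ∧ N ⊆ e.target ∧
    ∃ φ ψ : Coords → ℝ, ContDiffOn ℝ ∞ φ N ∧ ContDiffOn ℝ ∞ ψ N ∧
      ∀ y ∈ N,
        codiff (comp 𝒮.metric e) (maxwellField (comp 𝒮.metric e) (comp U e) φ ψ) y = 0 ∧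
        codiff (comp 𝒮.metric e) (fun z => hodge (comp 𝒮.metric e z)
          (maxwellField (comp 𝒮.metric e) (comp U e) φ ψ z)) y = 0

/-- The equation `[Ric, 𝒰] = 2 S` holds on the whole space-time. -/
def RicciCondition (𝒮 : OrientedSpaceTime M) (U : BilinField M) : Prop :=
  ∀ e ∈ 𝒮.charts, ∀ x ∈ e.target,
    ricciCommutator (comp 𝒮.metric e) (comp U e) x =
      (2 : ℂ) • tensorS (comp 𝒮.metric e) (comp U e) x

end OrientedSpaceTime

end

noncomputable section

namespace SpaceTime

/-! ### Calculus of component fields -/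

section Calculus

variable {F : Type*} [NormedAddCommGroup F] [NormedSpace ℝ F] {x : Coords} {Ω : Set Coords}

/-! Everything is done in one chart, with a complex null frame (l, n, m, m̄) adapted to the planes
at a single point. The frame is never differentiated: tensors are differentiated in coordinates, and
the frame only serves to compare components.

With an index raised, 𝒰 is diagonal with eigenvalues ±1/√2 on the two totally null planes ⟨l, m⟩ and
⟨n, m̄⟩, so 𝒰² = g/2. Differentiating this relation shows that ∇𝒰 anticommutes with 𝒰, so only its
lm and nm̄ components survive: eight numbers. Umbilicity kills four of them, and the other four are
the components of ξ. Hence ∇𝒰 is an explicit algebraic expression in g, 𝒰, ξ and χ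
(`covM_canonicalSD`).

On the Maxwell side, F − i*F is √2 e^θ 𝒰 with θ = φ + iψ, so both Maxwell equations together say
δ(e^θ 𝒰) = 0. Since 𝒰² = g/2, this is dθ = 2χ. By the Poincaré lemma the structure is Maxwellian
exactly when dχ = 0 (`exists_maxwell_iff`).

It remains to read dχ = 0 algebraically. The Leibniz rule for χ = i_ξ 𝒰 gives dχ in terms of T alone
(`ct_covV_chi_sub`): it vanishes when T is symmetric inside each null plane of 𝒰 and antisymmetric
across the two planes. The Ricci identity for 𝒰, with ∇𝒰 known, expresses the curvature components
with a pair lm or nm̄ through T (`ricci_identity_canonicalSD`). Its consequences are the following.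
Inside each null plane, [Ric, 𝒰] = 2S always holds (`hat_ricci_same_sign`). Across the planes the
commutator vanishes, so the equation says that T is antisymmetric there. The Weyl scalars Ψ₀ and Ψ₄
vanish, and Ψ₁, Ψ₃ are multiples of the antisymmetric parts of T inside the null planes
(`weylHat_of_umbilical`). So dχ = 0 amounts to Ψ₁ = Ψ₃ = 0 together with [Ric, 𝒰] = 2S.

Finally, when Ψ₀ = Ψ₄ = 0 and the Weyl tensor is nonzero, type D is the same as Ψ₁ = Ψ₃ = 0
(`typeDAt_iff`). The minimal polynomial forces Ψ₁² = Ψ₃² = 0. Conversely 𝒲 is then diagonal, with an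
eigenvalue ρ that cannot vanish without the whole real Weyl tensor vanishing. -/

theorem pd_add {f h : Coords → F} (i : Fin 4) (hf : DifferentiableAt ℝ f x)
    (hh : DifferentiableAt ℝ h x) : pd i (fun y => f y + h y) x = pd i f x + pd i h x := by
  simp only [pd]
  rw [fderiv_fun_add hf hh]
  rfl

theorem pd_sub {f h : Coords → F} (i : Fin 4) (hf : DifferentiableAt ℝ f x)
    (hh : DifferentiableAt ℝ h x) : pd i (fun y => f y - h y) x = pd i f x - pd i h x := by
  simp only [pd]
  rw [fderiv_fun_sub hf hh]
  rfl

theorem pd_sum {ι : Type*} (s : Finset ι) {f : ι → Coords → F} (i : Fin 4)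
    (hf : ∀ j ∈ s, DifferentiableAt ℝ (f j) x) :
    pd i (fun y => ∑ j ∈ s, f j y) x = ∑ j ∈ s, pd i (f j) x := by
  simp only [pd]
  rw [fderiv_fun_sum hf]
  simp

theorem pd_mul {𝔸 : Type*} [NormedCommRing 𝔸] [NormedAlgebra ℝ 𝔸] {f h : Coords → 𝔸} (i : Fin 4)
    (hf : DifferentiableAt ℝ f x) (hh : DifferentiableAt ℝ h x) :
    pd i (fun y => f y * h y) x = pd i f x * h x + f x * pd i h x := by
  simp only [pd]
  rw [fderiv_fun_mul hf hh]
  simp only [FunLike.coe_add, Pi.add_apply, FunLike.coe_smul, Pi.smul_apply, smul_eq_mul]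
  ring

theorem pd_const (c : F) (i : Fin 4) : pd i (fun _ => c) x = 0 := by
  simp [pd]

theorem pd_const_mul {𝔸 : Type*} [NormedCommRing 𝔸] [NormedAlgebra ℝ 𝔸] {f : Coords → 𝔸} (i : Fin 4)
    (c : 𝔸) (hf : DifferentiableAt ℝ f x) :
    pd i (fun y => c * f y) x = c * pd i f x := by
  rw [pd_mul i (differentiableAt_const c) hf, pd_const]
  ring

theorem pd_ofReal {f : Coords → ℝ} (i : Fin 4) (hf : DifferentiableAt ℝ f x) :
    pd i (fun y => (f y : ℂ)) x = ((pd i f x : ℝ) : ℂ) := by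
  have h : HasFDerivAt (fun y => (f y : ℂ)) (Complex.ofRealCLM.comp (fderiv ℝ f x)) x :=
    Complex.ofRealCLM.hasFDerivAt.comp x hf.hasFDerivAt
  simp only [pd]
  rw [h.fderiv]
  rfl

theorem pd_congr {f h : Coords → F} (i : Fin 4) (hfh : f =ᶠ[nhds x] h) : pd i f x = pd i h x := by
  simp only [pd]
  rw [hfh.fderiv_eq]

theorem pd_congr_on {f h : Coords → F} (i : Fin 4) (hΩ : IsOpen Ω) (hx : x ∈ Ω)
    (hfh : ∀ y ∈ Ω, f y = h y) : pd i f x = pd i h x :=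
  pd_congr i (Filter.eventuallyEq_of_mem (hΩ.mem_nhds hx) hfh)

theorem contDiffOn_pd {f : Coords → F} (i : Fin 4) (hΩ : IsOpen Ω) (hf : ContDiffOn ℝ ∞ f Ω) :
    ContDiffOn ℝ ∞ (pd i f) Ω :=
  ((contDiffOn_infty_iff_fderiv_of_isOpen hΩ).1 hf).2.clm_apply contDiffOn_const

theorem ContDiffOn.diffAt {f : Coords → F} (hf : ContDiffOn ℝ ∞ f Ω) (hΩ : IsOpen Ω)
    (hx : x ∈ Ω) : DifferentiableAt ℝ f x :=
  (hf.contDiffAt (hΩ.mem_nhds hx)).differentiableAt (by simp)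

/-- Second partial derivatives commute. -/
theorem pd_comm {f : Coords → F} (i j : Fin 4) (hΩ : IsOpen Ω) (hf : ContDiffOn ℝ ∞ f Ω)
    (hx : x ∈ Ω) : pd i (pd j f) x = pd j (pd i f) x := by
  have h2 : ContDiffAt ℝ ∞ f x := hf.contDiffAt (hΩ.mem_nhds hx)
  have hs : IsSymmSndFDerivAt ℝ f x := h2.isSymmSndFDerivAt (by
    simp only [minSmoothness_of_isRCLikeNormedField]; exact WithTop.coe_le_coe.2 le_top)
  have hd : DifferentiableAt ℝ (fderiv ℝ f) x :=
    ContDiffOn.diffAt ((contDiffOn_infty_iff_fderiv_of_isOpen hΩ).1 hf).2 hΩ hx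
  have key : ∀ k l : Fin 4, pd k (pd l f) x =
      fderiv ℝ (fderiv ℝ f) x (EuclideanSpace.single k 1) (EuclideanSpace.single l 1) := by
    intro k l
    have h : HasFDerivAt (fun y => fderiv ℝ f y (EuclideanSpace.single l 1))
        ((fderiv ℝ (fderiv ℝ f) x).flip (EuclideanSpace.single l 1)) x := by
      have := hd.hasFDerivAt.clm_apply (hasFDerivAt_const (EuclideanSpace.single l (1 : ℝ)) x)
      simpa using this
    show fderiv ℝ (fun y => fderiv ℝ f y (EuclideanSpace.single l 1)) x _ = _
    rw [h.fderiv]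
    rfl
  rw [key, key]
  exact hs _ _

end Calculus

/-! ### Fields of matrices -/

section MatrixFields

variable {𝕜 : Type*} [RCLike 𝕜] {x : Coords} {Ω : Set Coords}

/-- The partial derivative of a field of matrices. -/
def mpd (i : Fin 4) (A : Coords → Ten 𝕜) (x : Coords) : Ten 𝕜 :=
  Matrix.of fun a b => pd i (fun y => A y a b) x

/-- Smoothness of the entries of a field of matrices. -/
def TenSmooth (A : Coords → Ten 𝕜) (Ω : Set Coords) : Prop :=
  ∀ a b, ContDiffOn ℝ ∞ (fun y => A y a b) Ω

theorem TenSmooth.diffAt {A : Coords → Ten 𝕜} (hA : TenSmooth A Ω) (hΩ : IsOpen Ω) (hx : x ∈ Ω)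
    (a b : Fin 4) : DifferentiableAt ℝ (fun y => A y a b) x :=
  ContDiffOn.diffAt (hA a b) hΩ hx

theorem TenSmooth.sub {A B : Coords → Ten 𝕜} (hA : TenSmooth A Ω) (hB : TenSmooth B Ω) :
    TenSmooth (fun y => A y - B y) Ω := fun a b => (hA a b).sub (hB a b)

theorem TenSmooth.mul {A B : Coords → Ten 𝕜} (hA : TenSmooth A Ω) (hB : TenSmooth B Ω) :
    TenSmooth (fun y => A y * B y) Ω := fun a b => by
  simp only [Matrix.mul_apply]
  exact ContDiffOn.sum fun c _ => (hA a c).mul (hB c b)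

theorem TenSmooth.transpose {A : Coords → Ten 𝕜} (hA : TenSmooth A Ω) :
    TenSmooth (fun y => (A y).transpose) Ω := fun a b => hA b a

theorem TenSmooth.congr {A B : Coords → Ten 𝕜} (hA : TenSmooth A Ω) (h : ∀ y ∈ Ω, B y = A y) :
    TenSmooth B Ω := fun a b => (hA a b).congr fun y hy => by rw [h y hy]

theorem TenSmooth.partial {A : Coords → Ten 𝕜} (hA : TenSmooth A Ω) (hΩ : IsOpen Ω) (i : Fin 4) :
    TenSmooth (mpd i A) Ω := fun a b => contDiffOn_pd i hΩ (hA a b)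

theorem TenSmooth.ofReal {A : Coords → Ten ℝ} (hA : TenSmooth A Ω) :
    TenSmooth (fun y => (A y).map Complex.ofReal) Ω := fun a b =>
  Complex.ofRealCLM.contDiff.comp_contDiffOn (hA a b)

theorem TenSmooth.det {A : Coords → Ten 𝕜} (hA : TenSmooth A Ω) :
    ContDiffOn ℝ ∞ (fun y => (A y).det) Ω := by
  simp only [Matrix.det_apply']
  exact ContDiffOn.sum fun σ _ => contDiffOn_const.mul (contDiffOn_prod fun i _ => hA _ _)

/-- Cramer's rule: each entry is a determinant of smooth entries divided by the nonvanishing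
determinant. -/
theorem TenSmooth.inv {A : Coords → Ten 𝕜} (hA : TenSmooth A Ω) (h : ∀ y ∈ Ω, (A y).det ≠ 0) :
    TenSmooth (fun y => (A y)⁻¹) Ω := fun a b => by
  have hadj : ContDiffOn ℝ ∞ (fun y => (A y).adjugate a b) Ω := by
    simp only [Matrix.adjugate_apply]
    refine TenSmooth.det fun c d => ?_
    simp only [Matrix.updateRow_apply]
    split_ifs
    · exact contDiffOn_const
    · exact hA c d
  have : (fun y => (A y)⁻¹ a b) = fun y => ((A y).det)⁻¹ * (A y).adjugate a b := by
    ext y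
    rw [Matrix.inv_def, Ring.inverse_eq_inv']
    rfl
  rw [this]
  exact (hA.det.inv h).mul hadj

variable {A B : Coords → Ten 𝕜}

theorem mpd_sub (hA : TenSmooth A Ω) (hB : TenSmooth B Ω) (hΩ : IsOpen Ω) (hx : x ∈ Ω)
    (i : Fin 4) : mpd i (fun y => A y - B y) x = mpd i A x - mpd i B x := by
  ext a b
  exact pd_sub i (hA.diffAt hΩ hx a b) (hB.diffAt hΩ hx a b)

theorem mpd_mul (hA : TenSmooth A Ω) (hB : TenSmooth B Ω) (hΩ : IsOpen Ω) (hx : x ∈ Ω)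
    (i : Fin 4) : mpd i (fun y => A y * B y) x = mpd i A x * B x + A x * mpd i B x := by
  ext a b
  simp only [mpd, Matrix.of_apply, Matrix.mul_apply, Matrix.add_apply]
  rw [pd_sum (f := fun c y => A y a c * B y c b) _ _ fun c _ =>
    (hA.diffAt hΩ hx a c).mul (hB.diffAt hΩ hx c b), ← Finset.sum_add_distrib]
  exact Finset.sum_congr rfl fun c _ => pd_mul i (hA.diffAt hΩ hx a c) (hB.diffAt hΩ hx c b)

theorem mpd_transpose (i : Fin 4) :
    mpd i (fun y => (A y).transpose) x = (mpd i A x).transpose := rfl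

theorem mpd_const (C : Ten 𝕜) (i : Fin 4) : mpd i (fun _ => C) x = 0 := by
  ext a b
  exact pd_const _ i

theorem mpd_congr_on (hΩ : IsOpen Ω) (hx : x ∈ Ω) (h : ∀ y ∈ Ω, A y = B y) (i : Fin 4) :
    mpd i A x = mpd i B x := by
  ext a b
  exact pd_congr_on i hΩ hx fun y hy => by rw [h y hy]

theorem mpd_comm (hA : TenSmooth A Ω) (hΩ : IsOpen Ω) (hx : x ∈ Ω) (i j : Fin 4) :
    mpd i (mpd j A) x = mpd j (mpd i A) x := by
  ext a b
  exact pd_comm i j hΩ (hA a b) hx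

theorem mpd_ofReal {A : Coords → Ten ℝ} (hA : TenSmooth A Ω) (hΩ : IsOpen Ω) (hx : x ∈ Ω)
    (i : Fin 4) :
    mpd i (fun y => (A y).map Complex.ofReal) x = (mpd i A x).map Complex.ofReal := by
  ext a b
  exact pd_ofReal i (hA.diffAt hΩ hx a b)

end MatrixFields

/-! ### Null frames and local space-times -/

/-- The complexification of a real tensor. -/
abbrev toC (A : Ten ℝ) : Ten ℂ := A.map Complex.ofReal

/-- The action of the complex conjugation on the vectors of a null frame `(l, n, m, m̄)`. -/
def conjIdx : Fin 4 → Fin 4 := ![0, 1, 3, 2]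

/-- The components of the metric in a null frame `(l, n, m, m̄)`. -/
def nullGram : Ten ℂ := !![0, -2, 0, 0; -2, 0, 0, 0; 0, 0, 0, 2; 0, 0, 2, 0]

/-- The components of the inverse metric in a null frame. -/
def nullInv : Ten ℂ := !![0, -1/2, 0, 0; -1/2, 0, 0, 0; 0, 0, 0, 1/2; 0, 0, 1/2, 0]

/-- The components in an adapted null frame of the volume element of the time-like plane. -/
def nullForm : Ten ℂ := !![0, 2, 0, 0; -2, 0, 0, 0; 0, 0, 0, 0; 0, 0, 0, 0]

/-- The columns of `P` are a positively oriented null frame `(l, n, m, m̄)` of the metric `G`,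
adapted to the time-like plane with volume element `U`. -/
structure IsNullFrame (G U : Ten ℝ) (P : Ten ℂ) : Prop where
  gram : P.transpose * toC G * P = nullGram
  form : P.transpose * toC U * P = nullForm
  -- The orientation condition. The product is 1 for a positive orthonormal frame, and 4i is the
  -- determinant of the passage to (t + s, t - s, u + iv, u - iv).
  vol : (Real.sqrt |G.det| : ℂ) * P.det = 4 * Complex.I
  conj : ∀ a i, star (P a i) = P a (conjIdx i)

/-- An open set of coordinates with a smooth metric and a smooth 2+2 structure, in components. -/
structure IsLocalSpaceTime (g U : Coords → Ten ℝ) (Ω : Set Coords) : Prop where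
  isOpen : IsOpen Ω
  smooth_metric : TenSmooth g Ω
  smooth_form : TenSmooth U Ω
  exists_frame : ∀ x ∈ Ω, ∃ P, IsNullFrame (g x) (U x) P

theorem toC_mul (A B : Ten ℝ) : toC (A * B) = toC A * toC B := by
  ext i j
  simp [Matrix.mul_apply]

theorem toC_one : toC 1 = 1 := by
  ext i j
  simp only [Matrix.map_apply, Matrix.one_apply]
  split_ifs <;> simp

theorem nullGram_mul_nullInv : nullGram * nullInv = 1 := by
  ext i j
  fin_cases i <;> fin_cases j <;>
    simp [nullGram, nullInv, Matrix.mul_apply, Fin.sum_univ_four] <;> norm_num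

theorem nullInv_mul_nullGram : nullInv * nullGram = 1 :=
  mul_eq_one_comm.1 nullGram_mul_nullInv

namespace IsNullFrame

variable {G U : Ten ℝ} {P : Ten ℂ} (h : IsNullFrame G U P)
include h

theorem nullInv_mul_transpose : nullInv * P.transpose * toC G * P = 1 := by
  rw [Matrix.mul_assoc, Matrix.mul_assoc, ← Matrix.mul_assoc P.transpose, h.gram,
    nullInv_mul_nullGram]

theorem mul_nullInv_mul : P * (nullInv * P.transpose * toC G) = 1 :=
  mul_eq_one_comm.1 h.nullInv_mul_transpose

theorem complex_mul_inv : P * nullInv * P.transpose * toC G = 1 := by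
  simpa only [Matrix.mul_assoc] using h.mul_nullInv_mul

theorem det_frame_ne_zero : P.det ≠ 0 := by
  intro h0
  have := h.vol
  rw [h0, mul_zero] at this
  simp at this

theorem det_ne_zero : G.det ≠ 0 := by
  intro h0
  have := h.vol
  rw [h0] at this
  simp at this

/-- Completeness relation of the frame, obtained by inverting the Gram relation. It turns every
contraction with g^{ab} into four frame terms. -/
theorem toC_inv : toC G⁻¹ = P * nullInv * P.transpose := by
  have h1 : toC G⁻¹ * toC G = 1 := by
    rw [← toC_mul, Matrix.nonsing_inv_mul _ h.det_ne_zero.isUnit, toC_one]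
  have h2 : toC G * (P * nullInv * P.transpose) = 1 := mul_eq_one_comm.1 h.complex_mul_inv
  calc toC G⁻¹ = toC G⁻¹ * (toC G * (P * nullInv * P.transpose)) := by rw [h2, mul_one]
    _ = _ := by rw [← mul_assoc, h1, one_mul]

/-- A tensor is determined by its frame components. -/
theorem hat_inj {A B : Ten ℂ} (hAB : P.transpose * A * P = P.transpose * B * P) : A = B := by
  have hP : IsUnit P.det := h.det_frame_ne_zero.isUnit
  have hPt : IsUnit P.transpose.det := by rwa [Matrix.det_transpose]
  have := congrArg (fun X => (P.transpose)⁻¹ * X * P⁻¹) hAB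
  simpa only [← Matrix.mul_assoc, Matrix.nonsing_inv_mul _ hPt, Matrix.one_mul,
    Matrix.mul_nonsing_inv_cancel_right _ _ hP] using this

/-- Symmetry of the component matrix is not a separate assumption: it is inherited from `nullGram`,
as the antisymmetry of the form is from `nullForm`. -/
theorem metric_symm : G.transpose = G := by
  have h1 : toC G.transpose = toC G := by
    apply h.hat_inj
    have := congrArg Matrix.transpose h.gram
    rw [h.gram]
    simp only [Matrix.transpose_mul, Matrix.transpose_transpose, ← Matrix.mul_assoc] at this
    have h3 : nullGram.transpose = nullGram := by
      ext i j
      fin_cases i <;> fin_cases j <;> rfl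
    rw [h3] at this
    exact this
  ext i j
  exact Complex.ofReal_injective (congrFun (congrFun h1 i) j)

theorem form_antisymm : U.transpose = -U := by
  have h1 : toC U.transpose = -toC U := by
    apply h.hat_inj
    have := congrArg Matrix.transpose h.form
    rw [Matrix.mul_neg, Matrix.neg_mul, h.form]
    simp only [Matrix.transpose_mul, Matrix.transpose_transpose, ← Matrix.mul_assoc] at this
    have h3 : nullForm.transpose = -nullForm := by
      ext i j
      fin_cases i <;> fin_cases j <;> simp [nullForm]
    rw [h3] at this
    exact this
  ext i j
  have := congrFun (congrFun h1 i) j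
  apply Complex.ofReal_injective
  simpa using this

end IsNullFrame

/-! ### The Levi-Civita connection in matrix notation -/

/-- The matrix `(Γ_a)^m_b` of the connection. -/
def gamma (g : Coords → Ten ℝ) (a : Fin 4) (x : Coords) : Ten ℂ :=
  Matrix.of fun m b => (christoffel g m a b x : ℂ)

/-- The covariant derivative `∇_a F` of a field of covariant 2-tensors. -/
def covM (g : Coords → Ten ℝ) (F : Coords → Ten ℂ) (a : Fin 4) (x : Coords) : Ten ℂ :=
  mpd a F x - (gamma g a x).transpose * F x - F x * gamma g a x

/-- The matrix `(R_{ea})^m_b` of the curvature. -/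
def riemM (g : Coords → Ten ℝ) (e a : Fin 4) (x : Coords) : Ten ℂ :=
  Matrix.of fun m b => (riemann g x m b e a : ℂ)

theorem cov₂_eq_covM (g : Coords → Ten ℝ) (F : Coords → Ten ℂ) (x : Coords) (a b c : Fin 4) :
    cov₂ g F x a b c = covM g F a x b c := by
  simp only [cov₂, covM, mpd, gamma, Matrix.sub_apply, Matrix.mul_apply, Matrix.transpose_apply,
    Matrix.of_apply, Complex.real_smul]
  congr 1
  exact Finset.sum_congr rfl fun m _ => mul_comm _ _

/-! ### Metric compatibility, smoothness and the Ricci identity in a chart -/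

section Local

variable {g U : Coords → Ten ℝ} {Ω : Set Coords} {x : Coords} (h : IsLocalSpaceTime g U Ω)
include h

theorem IsLocalSpaceTime.det_ne_zero (y : Coords) (hy : y ∈ Ω) : (g y).det ≠ 0 := by
  obtain ⟨P, hP⟩ := h.exists_frame y hy
  exact hP.det_ne_zero

theorem IsLocalSpaceTime.symm (y : Coords) (hy : y ∈ Ω) (a b : Fin 4) : g y a b = g y b a := by
  obtain ⟨P, hP⟩ := h.exists_frame y hy
  exact congrFun (congrFun hP.metric_symm b) a

theorem IsLocalSpaceTime.smooth_inv : TenSmooth (fun y => (g y)⁻¹) Ω :=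
  h.smooth_metric.inv h.det_ne_zero

theorem IsLocalSpaceTime.pd_symm (hx : x ∈ Ω) (i a b : Fin 4) :
    pd i (fun y => g y a b) x = pd i (fun y => g y b a) x :=
  pd_congr_on i h.isOpen hx fun y hy => h.symm y hy a b

theorem christoffel_symm (hx : x ∈ Ω) (k i j : Fin 4) :
    christoffel g k i j x = christoffel g k j i x := by
  simp only [christoffel]
  congr 1
  refine Finset.sum_congr rfl fun l _ => ?_
  rw [h.pd_symm hx l i j]
  ring

theorem smooth_christoffel (k i j : Fin 4) : ContDiffOn ℝ ∞ (christoffel g k i j) Ω := by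
  refine contDiffOn_const.mul (ContDiffOn.sum fun l _ => (h.smooth_inv k l).mul ?_)
  exact ((contDiffOn_pd _ h.isOpen (h.smooth_metric _ _)).add
    (contDiffOn_pd _ h.isOpen (h.smooth_metric _ _))).sub
    (contDiffOn_pd _ h.isOpen (h.smooth_metric _ _))

theorem smooth_gamma (a : Fin 4) : TenSmooth (gamma g a) Ω := fun m b =>
  Complex.ofRealCLM.contDiff.comp_contDiffOn (smooth_christoffel h m a b)

theorem TenSmooth.covM {F : Coords → Ten ℂ} (hF : TenSmooth F Ω) (a : Fin 4) :
    TenSmooth (covM g F a) Ω :=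
  ((hF.partial h.isOpen a).sub ((smooth_gamma h a).transpose.mul hF)).sub
    (hF.mul (smooth_gamma h a))

/-- The Levi-Civita connection is metric. -/
theorem covM_metric (hx : x ∈ Ω) (a : Fin 4) : covM g (fun y => toC (g y)) a x = 0 := by
  -- Christoffel symbols of the first kind. Adding the two with b and c exchanged leaves only ∂_a
  -- g_{bc}.
  have low : ∀ b c, ∑ k, g x b k * christoffel g k a c x = 1 / 2 *
      (pd a (fun y => g y c b) x + pd c (fun y => g y a b) x - pd b (fun y => g y a c) x) := by
    intro b c
    have hinv : ∀ l, ∑ k, g x b k * (g x)⁻¹ k l = (1 : Ten ℝ) b l := fun l => by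
      rw [← Matrix.mul_apply, Matrix.mul_nonsing_inv _ (h.det_ne_zero x hx).isUnit]
    calc _ = 1 / 2 * ∑ l, (∑ k, g x b k * (g x)⁻¹ k l) *
        (pd a (fun y => g y c l) x + pd c (fun y => g y a l) x - pd l (fun y => g y a c) x) := by
          simp only [christoffel, Finset.mul_sum, Finset.sum_mul]
          rw [Finset.sum_comm]
          refine Finset.sum_congr rfl fun l _ => Finset.sum_congr rfl fun k _ => ?_
          ring
      _ = _ := by
          simp only [hinv, Matrix.one_apply, ite_mul, one_mul, zero_mul, Finset.sum_ite_eq,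
            Finset.mem_univ, if_true]
  ext b c
  have e1 : mpd a (fun y => toC (g y)) x b c = ((pd a (fun y => g y b c) x : ℝ) : ℂ) :=
    pd_ofReal a (h.smooth_metric.diffAt h.isOpen hx b c)
  have e2 : ((gamma g a x).transpose * toC (g x)) b c =
      ((∑ k, g x c k * christoffel g k a b x : ℝ) : ℂ) := by
    rw [Matrix.mul_apply]
    push_cast
    refine Finset.sum_congr rfl fun k _ => ?_
    simp only [gamma, Matrix.transpose_apply, Matrix.of_apply, Matrix.map_apply]
    rw [h.symm x hx k c]
    ring
  have e3 : (toC (g x) * gamma g a x) b c =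
      ((∑ k, g x b k * christoffel g k a c x : ℝ) : ℂ) := by
    rw [Matrix.mul_apply]
    push_cast
    rfl
  simp only [covM, Matrix.sub_apply, Matrix.zero_apply]
  rw [e1, e2, e3, low, low, h.pd_symm hx a c b]
  push_cast
  ring

theorem riemM_eq (hx : x ∈ Ω) (e a : Fin 4) : riemM g e a x =
    mpd e (gamma g a) x - mpd a (gamma g e) x + gamma g e x * gamma g a x
      - gamma g a x * gamma g e x := by
  ext m b
  have hd : ∀ i j : Fin 4, mpd i (gamma g j) x m b = ((pd i (christoffel g m j b) x : ℝ) : ℂ) :=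
    fun i j => pd_ofReal i (ContDiffOn.diffAt (smooth_christoffel h m j b) h.isOpen hx)
  simp only [Matrix.sub_apply, Matrix.add_apply, hd, Matrix.mul_apply]
  simp only [riemM, riemann, gamma, Matrix.of_apply]
  push_cast
  rfl

/-- The Ricci identity. -/
theorem ricci_identity {F : Coords → Ten ℂ} (hF : TenSmooth F Ω) (hx : x ∈ Ω) (e a : Fin 4) :
    (mpd e (covM g F a) x - (gamma g e x).transpose * covM g F a x - covM g F a x * gamma g e x)
      - (mpd a (covM g F e) x - (gamma g a x).transpose * covM g F e x
        - covM g F e x * gamma g a x) =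
    -((riemM g e a x).transpose * F x) - F x * riemM g e a x := by
  -- The terms Γ^m_{ea} ∇_m F of the full second covariant derivative are symmetric in e, a and
  -- would cancel, so they are left out on both sides.
  have key : ∀ i j : Fin 4, mpd i (covM g F j) x = mpd i (mpd j F) x
      - ((mpd i (gamma g j) x).transpose * F x + (gamma g j x).transpose * mpd i F x)
      - (mpd i F x * gamma g j x + F x * mpd i (gamma g j) x) := fun i j => by
    have s1 := hF.partial h.isOpen j
    have s2 := (smooth_gamma h j).transpose.mul hF
    have s3 := hF.mul (smooth_gamma h j)
    rw [← mpd_transpose, ← mpd_mul (smooth_gamma h j).transpose hF h.isOpen hx,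
      ← mpd_mul hF (smooth_gamma h j) h.isOpen hx,
      ← mpd_sub s1 s2 h.isOpen hx, ← mpd_sub (s1.sub s2) s3 h.isOpen hx]
    rfl
  rw [key, key, riemM_eq h hx, mpd_comm hF h.isOpen hx a e]
  simp only [covM, Matrix.transpose_sub, Matrix.transpose_add, Matrix.transpose_mul]
  noncomm_ring

end Local

/-! ### Contraction with the vectors of a frame -/

/-- Contraction of an index with the `i`-th vector of the frame `P`. -/
def ct (P : Ten ℂ) (i : Fin 4) (f : Fin 4 → ℂ) : ℂ := ∑ a, P a i * f a

section Contraction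

variable (P : Ten ℂ) (i j : Fin 4)

theorem ct_add (f h : Fin 4 → ℂ) : ct P i (fun a => f a + h a) = ct P i f + ct P i h := by
  simp only [ct, mul_add, Finset.sum_add_distrib]

theorem ct_sub (f h : Fin 4 → ℂ) : ct P i (fun a => f a - h a) = ct P i f - ct P i h := by
  simp only [ct, mul_sub, Finset.sum_sub_distrib]

theorem ct_neg (f : Fin 4 → ℂ) : ct P i (fun a => -f a) = -ct P i f := by
  simp only [ct, mul_neg, Finset.sum_neg_distrib]

theorem ct_mul_left (c : ℂ) (f : Fin 4 → ℂ) : ct P i (fun a => c * f a) = c * ct P i f := by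
  simp only [ct, Finset.mul_sum]
  exact Finset.sum_congr rfl fun _ _ => by ring

theorem ct_mul_right (c : ℂ) (f : Fin 4 → ℂ) : ct P i (fun a => f a * c) = ct P i f * c := by
  simp only [ct, Finset.sum_mul, mul_assoc]

theorem ct_sum (f : Fin 4 → Fin 4 → ℂ) :
    ct P i (fun a => ∑ k, f k a) = ∑ k, ct P i (f k) := by
  simp only [ct, Finset.mul_sum]
  exact Finset.sum_comm

theorem ct_comm (f : Fin 4 → Fin 4 → ℂ) :
    ct P i (fun a => ct P j fun b => f a b) = ct P j (fun b => ct P i fun a => f a b) := by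
  simp only [ct, Finset.mul_sum]
  rw [Finset.sum_comm]
  exact Finset.sum_congr rfl fun _ _ => Finset.sum_congr rfl fun _ _ => by ring

theorem ct_ct_eq (A : Ten ℂ) :
    ct P i (fun a => ct P j fun b => A a b) = (P.transpose * A * P) i j := by
  simp only [ct, Matrix.mul_apply, Matrix.transpose_apply, Finset.mul_sum, Finset.sum_mul]
  rw [Finset.sum_comm]
  exact Finset.sum_congr rfl fun _ _ => Finset.sum_congr rfl fun _ _ => by ring

theorem ct_zero : ct P i (fun _ => 0) = 0 := by simp [ct]

end Contraction

/-- The frame components of a 2-tensor. -/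
def hat (P A : Ten ℂ) : Ten ℂ := P.transpose * A * P

theorem ct_ct (P A : Ten ℂ) (i j : Fin 4) :
    ct P i (fun a => ct P j fun b => A a b) = hat P A i j := ct_ct_eq P i j A

theorem hat_add (P A B : Ten ℂ) : hat P (A + B) = hat P A + hat P B := by
  simp only [hat, Matrix.mul_add, Matrix.add_mul]

theorem hat_sub (P A B : Ten ℂ) : hat P (A - B) = hat P A - hat P B := by
  simp only [hat, Matrix.mul_sub, Matrix.sub_mul]

theorem hat_smul (P A : Ten ℂ) (c : ℂ) : hat P (c • A) = c • hat P A := by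
  simp only [hat, Matrix.mul_smul, Matrix.smul_mul]

theorem hat_neg (P A : Ten ℂ) : hat P (-A) = -hat P A := by
  simp only [hat, Matrix.mul_neg, Matrix.neg_mul]

theorem hat_transpose (P A : Ten ℂ) : hat P A.transpose = (hat P A).transpose := by
  simp only [hat, Matrix.transpose_mul, Matrix.transpose_transpose, Matrix.mul_assoc]

/-! ### The Levi-Civita symbol -/

/-- The Leibniz expansion. It links the symbol, defined by a product of signs, to determinants. -/
theorem sum_levi (w : Fin 4 → Fin 4 → ℂ) :
    ∑ a, ∑ b, ∑ c, ∑ d, (levi a b c d : ℂ) * (w 0 a * w 1 b * w 2 c * w 3 d) =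
      Matrix.det (Matrix.of w) := by
  rw [Matrix.det_succ_row_zero]
  simp only [Matrix.det_fin_three, Fin.sum_univ_four]
  have s2 : Int.sign 2 = 1 := rfl
  have s3 : Int.sign 3 = 1 := rfl
  simp [levi, Fin.succAbove, Fin.lt_def, s2, s3]
  ring

/-- Selecting four frame vectors is multiplication of Pᵀ by a 0-1 matrix, whose determinant is again
the symbol by `sum_levi`. -/
theorem ct_levi (P : Ten ℂ) (i j k l : Fin 4) :
    ct P i (fun a => ct P j fun b => ct P k fun c => ct P l fun d => (levi a b c d : ℂ)) =
      P.det * levi i j k l := by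
  have h1 : ct P i (fun a => ct P j fun b => ct P k fun c => ct P l fun d => (levi a b c d : ℂ)) =
      Matrix.det (Matrix.of fun r a => P a (![i, j, k, l] r)) := by
    rw [← sum_levi]
    simp only [ct, Finset.mul_sum]
    refine Finset.sum_congr rfl fun a _ => Finset.sum_congr rfl fun b _ =>
      Finset.sum_congr rfl fun c _ => Finset.sum_congr rfl fun d _ => ?_
    simp
    ring
  have h2 : (Matrix.of fun r a => P a (![i, j, k, l] r) : Ten ℂ) =
      (Matrix.of fun r s => if ![i, j, k, l] r = s then (1 : ℂ) else 0) * P.transpose := by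
    ext r a
    simp [Matrix.mul_apply]
  have h3 : Matrix.det (Matrix.of fun r s => if ![i, j, k, l] r = s then (1 : ℂ) else 0 : Ten ℂ) =
      levi i j k l := by
    have h4 : ∑ a, ∑ b, ∑ c, ∑ d, (levi a b c d : ℂ) * ((if i = a then 1 else 0) *
        (if j = b then 1 else 0) * (if k = c then 1 else 0) * (if l = d then 1 else 0)) =
        levi i j k l := by
      simp only [mul_ite, mul_one, mul_zero, Finset.sum_ite_eq,
        Finset.mem_univ, if_true]
    exact (sum_levi fun r s => if ![i, j, k, l] r = s then (1 : ℂ) else 0).symm.trans h4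
  rw [h1, h2, Matrix.det_mul, h3, Matrix.det_transpose, mul_comm]

/-! ### Frame components of contractions -/

/-- The frame components of `F^{ab}`. -/
def raised (P F : Ten ℂ) : Ten ℂ := nullInv * hat P F * nullInv

namespace IsNullFrame

variable {G U : Ten ℝ} {P : Ten ℂ} (h : IsNullFrame G U P)
include h

theorem hat_metric : hat P (toC G) = nullGram := h.gram

theorem hat_form : hat P (toC U) = nullForm := h.form

theorem hat_mul (A B : Ten ℂ) : hat P (A * toC G⁻¹ * B) = hat P A * nullInv * hat P B := by
  simp only [hat, h.toC_inv, Matrix.mul_assoc]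

/-- The completeness relation `toC_inv` inserted into a trace. Every passage from coordinate
contractions to frame components rests on it. -/
theorem sum_inv (B : Fin 4 → Fin 4 → ℂ) :
    ∑ c, ∑ m, ((G⁻¹ c m : ℝ) : ℂ) * B c m =
      ∑ k, ∑ l, nullInv k l * ct P k (fun c => ct P l fun m => B c m) := by
  have h1 : ∀ c m, ((G⁻¹ c m : ℝ) : ℂ) = ∑ k, ∑ l, nullInv k l * (P c k * P m l) := by
    intro c m
    have := congrFun (congrFun h.toC_inv c) m
    simp only [Matrix.map_apply] at this
    rw [this]
    simp only [Matrix.mul_apply, Matrix.transpose_apply, Finset.sum_mul]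
    rw [Finset.sum_comm]
    exact Finset.sum_congr rfl fun _ _ => Finset.sum_congr rfl fun _ _ => by ring
  calc _ = ∑ c, ∑ k, ∑ m, ∑ l, nullInv k l * (P c k * P m l) * B c m := by
        refine Finset.sum_congr rfl fun c _ => ?_
        rw [Finset.sum_comm]
        refine Finset.sum_congr rfl fun m _ => ?_
        simp only [h1, Finset.sum_mul]
    _ = _ := by
        rw [Finset.sum_comm]
        refine Finset.sum_congr rfl fun k _ => ?_
        simp only [ct, Finset.mul_sum]
        have : ∀ f : Fin 4 → Fin 4 → Fin 4 → ℂ,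
            ∑ c, ∑ m, ∑ l, f c m l = ∑ l, ∑ c, ∑ m, f c m l := fun f =>
          (Finset.sum_congr rfl fun c _ => Finset.sum_comm).trans Finset.sum_comm
        rw [this]
        exact Finset.sum_congr rfl fun _ _ => Finset.sum_congr rfl fun _ _ =>
          Finset.sum_congr rfl fun _ _ => by ring

end IsNullFrame

/-! ### Hodge duality in a null frame -/

theorem nullInv_entries :
    (nullInv 0 0 = 0 ∧ nullInv 0 1 = -1/2 ∧ nullInv 0 2 = 0 ∧ nullInv 0 3 = 0) ∧
    (nullInv 1 0 = -1/2 ∧ nullInv 1 1 = 0 ∧ nullInv 1 2 = 0 ∧ nullInv 1 3 = 0) ∧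
    (nullInv 2 0 = 0 ∧ nullInv 2 1 = 0 ∧ nullInv 2 2 = 0 ∧ nullInv 2 3 = 1/2) ∧
    (nullInv 3 0 = 0 ∧ nullInv 3 1 = 0 ∧ nullInv 3 2 = 1/2 ∧ nullInv 3 3 = 0) :=
  ⟨⟨rfl, rfl, rfl, rfl⟩, ⟨rfl, rfl, rfl, rfl⟩, ⟨rfl, rfl, rfl, rfl⟩, ⟨rfl, rfl, rfl, rfl⟩⟩

theorem nullGram_entries :
    (nullGram 0 0 = 0 ∧ nullGram 0 1 = -2 ∧ nullGram 0 2 = 0 ∧ nullGram 0 3 = 0) ∧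
    (nullGram 1 0 = -2 ∧ nullGram 1 1 = 0 ∧ nullGram 1 2 = 0 ∧ nullGram 1 3 = 0) ∧
    (nullGram 2 0 = 0 ∧ nullGram 2 1 = 0 ∧ nullGram 2 2 = 0 ∧ nullGram 2 3 = 2) ∧
    (nullGram 3 0 = 0 ∧ nullGram 3 1 = 0 ∧ nullGram 3 2 = 2 ∧ nullGram 3 3 = 0) :=
  ⟨⟨rfl, rfl, rfl, rfl⟩, ⟨rfl, rfl, rfl, rfl⟩, ⟨rfl, rfl, rfl, rfl⟩, ⟨rfl, rfl, rfl, rfl⟩⟩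

theorem raised_entries (P F : Ten ℂ) :
    (raised P F 0 0 = 1/4 * hat P F 1 1 ∧ raised P F 0 1 = 1/4 * hat P F 1 0 ∧
      raised P F 0 2 = -1/4 * hat P F 1 3 ∧ raised P F 0 3 = -1/4 * hat P F 1 2) ∧
    (raised P F 1 0 = 1/4 * hat P F 0 1 ∧ raised P F 1 1 = 1/4 * hat P F 0 0 ∧
      raised P F 1 2 = -1/4 * hat P F 0 3 ∧ raised P F 1 3 = -1/4 * hat P F 0 2) ∧
    (raised P F 2 0 = -1/4 * hat P F 3 1 ∧ raised P F 2 1 = -1/4 * hat P F 3 0 ∧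
      raised P F 2 2 = 1/4 * hat P F 3 3 ∧ raised P F 2 3 = 1/4 * hat P F 3 2) ∧
    (raised P F 3 0 = -1/4 * hat P F 2 1 ∧ raised P F 3 1 = -1/4 * hat P F 2 0 ∧
      raised P F 3 2 = 1/4 * hat P F 2 3 ∧ raised P F 3 3 = 1/4 * hat P F 2 2) := by
  simp only [raised, Matrix.mul_apply, Fin.sum_univ_four, nullInv_entries]
  refine ⟨⟨?_, ?_, ?_, ?_⟩, ⟨?_, ?_, ?_, ?_⟩, ⟨?_, ?_, ?_, ?_⟩, ⟨?_, ?_, ?_, ?_⟩⟩ <;> ring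

theorem sum_nullInv₂ (P F : Ten ℂ) (K : Fin 4 → Fin 4 → ℂ) :
    ∑ k, ∑ k', nullInv k k' * ∑ l, ∑ l', nullInv l l' * (K k l * hat P F k' l') =
      ∑ k, ∑ l, K k l * raised P F k l := by
  simp only [Fin.sum_univ_four, raised_entries, nullInv_entries]
  ring

/-- The 2-form with frame components given by the six components of `F`, dualized. -/
def hodgeHat (f : Ten ℂ) : Ten ℂ :=
  !![0, -(Complex.I * f 2 3), Complex.I * f 0 2, -(Complex.I * f 0 3);
    Complex.I * f 2 3, 0, -(Complex.I * f 1 2), Complex.I * f 1 3;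
    -(Complex.I * f 0 2), Complex.I * f 1 2, 0, -(Complex.I * f 0 1);
    Complex.I * f 0 3, -(Complex.I * f 1 3), Complex.I * f 0 1, 0]

theorem toC_hodge (G F : Ten ℝ) : toC (hodge G F) = hodge G (toC F) := by
  ext a b
  simp [hodge]

theorem antisymm_entries {F : Ten ℂ} (hF : F.transpose = -F) (i j : Fin 4) : F i j = -F j i :=
  congrFun (congrFun hF j) i

theorem hat_antisymm (P : Ten ℂ) {F : Ten ℂ} (hF : F.transpose = -F) :
    (hat P F).transpose = -hat P F := by
  rw [← hat_transpose, hF, hat_neg]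

/-- A complex 2-form is determined by its six components. -/
theorem antisymm_ext {F H : Ten ℂ} (hF : F.transpose = -F) (hH : H.transpose = -H)
    (h01 : F 0 1 = H 0 1) (h02 : F 0 2 = H 0 2) (h03 : F 0 3 = H 0 3) (h12 : F 1 2 = H 1 2)
    (h13 : F 1 3 = H 1 3) (h23 : F 2 3 = H 2 3) : F = H := by
  have d : ∀ {K : Ten ℂ}, K.transpose = -K → ∀ i, K i i = 0 := fun hK i =>
    self_eq_neg.1 (antisymm_entries hK i i)
  ext i j
  fin_cases i <;> fin_cases j <;> simp only [Fin.zero_eta, Fin.mk_one, Fin.reduceFinMk] <;>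
    first
    | assumption
    | rw [d hF, d hH]
    | (rw [antisymm_entries hF, antisymm_entries hH]; congr 1)

theorem hodge_transpose (G : Ten ℝ) (F : Ten ℂ) : (hodge G F).transpose = -hodge G F := by
  ext a b
  have hl : ∀ c d, vol G b a c d = -vol G a b c d := by
    intro c d
    have : levi b a c d = -levi a b c d := by
      revert a b c d
      decide
    rw [vol, vol, this]
    push_cast
    ring
  simp only [Matrix.transpose_apply, Matrix.neg_apply, hodge, Matrix.of_apply, hl,
    ← Finset.sum_neg_distrib, ← neg_smul]
  refine Finset.sum_congr rfl fun _ _ => Finset.sum_congr rfl fun _ _ =>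
    Finset.sum_congr rfl fun _ _ => Finset.sum_congr rfl fun _ _ => ?_
  congr 1
  ring

namespace IsNullFrame

variable {G U : Ten ℝ} {P : Ten ℂ} (h : IsNullFrame G U P)
include h

theorem sum_inv₂ (K : Fin 4 → Fin 4 → ℂ) (F : Ten ℂ) :
    ∑ c, ∑ d, ∑ m, ∑ n, ((G⁻¹ c m : ℝ) : ℂ) * ((G⁻¹ d n : ℝ) : ℂ) * (K c d * F m n) =
      ∑ k, ∑ l, ct P k (fun c => ct P l fun d => K c d) * raised P F k l := by
  have h1 : ∑ c, ∑ d, ∑ m, ∑ n, ((G⁻¹ c m : ℝ) : ℂ) * ((G⁻¹ d n : ℝ) : ℂ) * (K c d * F m n) =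
      ∑ c, ∑ m, ((G⁻¹ c m : ℝ) : ℂ) * ∑ d, ∑ n, ((G⁻¹ d n : ℝ) : ℂ) * (K c d * F m n) := by
    refine Finset.sum_congr rfl fun c _ => ?_
    rw [Finset.sum_comm]
    simp only [Finset.mul_sum, mul_assoc]
  rw [h1]
  simp only [h.sum_inv, ct_sum, ct_mul_left, ct_mul_right]
  rw [← sum_nullInv₂]
  simp only [ct_ct]

/-- The factor 2i is the ½ of the Hodge dual times the 4i of the frame volume. -/
theorem hat_hodge (F : Ten ℂ) (i j : Fin 4) : hat P (hodge G F) i j =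
    2 * Complex.I * ∑ k, ∑ l, (levi i j k l : ℂ) * raised P F k l := by
  have h1 : ∀ a b, hodge G F a b = 1 / 2 * (Real.sqrt |G.det| : ℂ) *
      ∑ k, ∑ l, ct P k (fun c => ct P l fun d => (levi a b c d : ℂ)) * raised P F k l := by
    intro a b
    rw [← h.sum_inv₂]
    simp only [hodge, Matrix.of_apply, Complex.real_smul, SpaceTime.vol, Finset.mul_sum]
    refine Finset.sum_congr rfl fun _ _ => Finset.sum_congr rfl fun _ _ =>
      Finset.sum_congr rfl fun _ _ => Finset.sum_congr rfl fun _ _ => ?_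
    push_cast
    ring
  rw [← ct_ct]
  simp only [h1, ct_mul_left, ct_sum, ct_mul_right, ct_levi, Finset.mul_sum]
  refine Finset.sum_congr rfl fun _ _ => Finset.sum_congr rfl fun _ _ => ?_
  linear_combination (1 / 2 * (levi i j _ _ : ℂ) * raised P F _ _) * h.vol

/-- Duality is almost diagonal in a null frame: eigenvalue i on the components 02 and 13, -i on 03
and 12, while 01 and 23 are exchanged up to the factor -i. -/
theorem hat_hodge_eq {F : Ten ℂ} (hF : F.transpose = -F) :
    hat P (hodge G F) = hodgeHat (hat P F) := by
  have hf := antisymm_entries (hat_antisymm P hF)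
  have e : ∀ i j, hat P (hodge G F) i j = 2 * Complex.I *
      ∑ k, ∑ l, (levi i j k l : ℂ) * raised P F k l := h.hat_hodge F
  have s2 : Int.sign 2 = 1 := rfl
  have s3 : Int.sign 3 = 1 := rfl
  refine antisymm_ext (hat_antisymm P (hodge_transpose G F)) ?_ ?_ ?_ ?_ ?_ ?_ ?_
  · ext i j
    fin_cases i <;> fin_cases j <;> simp [hodgeHat]
  all_goals
    rw [e]
    simp only [Fin.sum_univ_four, raised_entries]
    simp [levi, hodgeHat, s2, s3]
  · linear_combination (1/2 * Complex.I) * hf 2 3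
  · linear_combination (-1/2 * Complex.I) * hf 0 2
  · linear_combination (1/2 * Complex.I) * hf 0 3
  · linear_combination (1/2 * Complex.I) * hf 1 2
  · linear_combination (-1/2 * Complex.I) * hf 1 3
  · linear_combination (1/2 * Complex.I) * hf 0 1

theorem hodge_hodge {F : Ten ℂ} (hF : F.transpose = -F) : hodge G (hodge G F) = -F := by
  refine h.hat_inj (show hat P _ = hat P _ from ?_)
  have hf := hat_antisymm P hF
  rw [h.hat_hodge_eq (hodge_transpose G F), h.hat_hodge_eq hF, hat_neg]
  refine antisymm_ext ?_ (by rw [Matrix.transpose_neg, hf]) ?_ ?_ ?_ ?_ ?_ ?_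
  · ext i j
    fin_cases i <;> fin_cases j <;> simp [hodgeHat]
  all_goals
    simp [hodgeHat, ← mul_assoc]

/-- The self-dual bivectors in terms of their frame components. -/
theorem isSelfDual_iff (F : Ten ℂ) : IsSelfDual G F ↔ F.transpose = -F ∧
    hat P F 0 3 = 0 ∧ hat P F 1 2 = 0 ∧ hat P F 2 3 = -hat P F 0 1 := by
  refine and_congr_right fun hF => ?_
  have hf := hat_antisymm P hF
  have e := h.hat_hodge_eq hF
  constructor
  · intro hd
    rw [hd, hat_smul] at e
    have e01 := congrFun (congrFun e 0) 1
    have e03 := congrFun (congrFun e 0) 3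
    have e12 := congrFun (congrFun e 1) 2
    simp only [Matrix.smul_apply, smul_eq_mul, hodgeHat, Matrix.of_apply, Matrix.cons_val]
      at e01 e03 e12
    have hI := Complex.I_mul_I
    refine ⟨?_, ?_, ?_⟩
    · linear_combination (-Complex.I / 2) * e03 + hat P F 0 3 * hI
    · linear_combination (-Complex.I / 2) * e12 + hat P F 1 2 * hI
    · linear_combination (-Complex.I) * e01 + (hat P F 0 1 + hat P F 2 3) * hI
  · rintro ⟨h03, h12, h23⟩
    refine h.hat_inj (show hat P _ = hat P _ from ?_)
    rw [e, hat_smul]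
    refine antisymm_ext ?_ (by rw [Matrix.transpose_smul, hf, smul_neg]) ?_ ?_ ?_ ?_ ?_ ?_
    · ext i j
      fin_cases i <;> fin_cases j <;> simp [hodgeHat]
    all_goals
      simp [hodgeHat, h03, h12, h23]

theorem hat_sdProj {F : Ten ℂ} (hF : F.transpose = -F) (i j : Fin 4) :
    hat P (sdProj G F) i j = 1 / 2 * (hat P F i j - Complex.I * hodgeHat (hat P F) i j) := by
  rw [sdProj, hat_smul, hat_sub, hat_smul, h.hat_hodge_eq hF]
  rfl

end IsNullFrame

theorem sdProj_of_isSelfDual {G : Ten ℝ} {F : Ten ℂ} (hF : IsSelfDual G F) : sdProj G F = F := by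
  rw [sdProj, hF.2, smul_smul, Complex.I_mul_I, neg_one_smul, sub_neg_eq_add, ← two_smul ℂ,
    smul_smul]
  norm_num

/-- The eigenvalues, up to the factor `1 / √2`, of the canonical self-dual bivector. -/
def sgn : Fin 4 → ℂ := ![1, -1, 1, -1]

theorem sgn_entries : sgn 0 = 1 ∧ sgn 1 = -1 ∧ sgn 2 = 1 ∧ sgn 3 = -1 := ⟨rfl, rfl, rfl, rfl⟩

/-- The number `1 / √2`. -/
def kap : ℂ := 1 / (Real.sqrt 2 : ℂ)

theorem kap_mul_kap : kap * kap = 1 / 2 := by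
  rw [kap, div_mul_div_comm, ← Complex.ofReal_mul, Real.mul_self_sqrt zero_le_two]
  norm_num

theorem kap_ne_zero : kap ≠ 0 := fun h => by
  have := kap_mul_kap
  rw [h] at this
  norm_num at this

theorem canonicalSD_eq (g U : Coords → Ten ℝ) (x : Coords) : canonicalSD g U x =
    kap • (toC (U x) - Complex.I • hodge (g x) (toC (U x))) := by
  rw [← toC_hodge]
  rfl

/-! ### The canonical bivector in an adapted null frame -/

section CanonicalForm

variable {g U : Coords → Ten ℝ} {x : Coords} {P : Ten ℂ} (h : IsNullFrame (g x) (U x) P)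
include h

theorem toC_form_antisymm : (toC (U x)).transpose = -toC (U x) := by
  ext i j
  have := congrFun (congrFun h.form_antisymm i) j
  simp only [Matrix.transpose_apply, Matrix.neg_apply, Matrix.map_apply] at this ⊢
  rw [this]
  push_cast
  rfl

theorem canonicalSD_antisymm : (canonicalSD g U x).transpose = -canonicalSD g U x := by
  rw [canonicalSD_eq, Matrix.transpose_smul, Matrix.transpose_sub, Matrix.transpose_smul,
    hodge_transpose, toC_form_antisymm h, ← smul_neg]
  congr 1
  rw [smul_neg]
  abel

/-- With one index raised this is the diagonal matrix `kap • sgn`, whose eigenspaces are the totally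
null planes ⟨l, m⟩ and ⟨n, m̄⟩. The sign bookkeeping by `sgn` below always refers to these two
planes. -/
theorem hat_canonicalSD (i j : Fin 4) :
    hat P (canonicalSD g U x) i j = kap * nullGram i j * sgn j := by
  have key : hat P (canonicalSD g U x) = kap • (nullForm - Complex.I • hodgeHat nullForm) := by
    rw [canonicalSD_eq, hat_smul, hat_sub, hat_smul, h.hat_hodge_eq (toC_form_antisymm h),
      h.hat_form]
  rw [key]
  fin_cases i <;> fin_cases j <;>
    simp [nullForm, hodgeHat, nullGram, sgn, ← mul_assoc]

/-- The eigenvalues ±1/√2 square to ½. This makes ∇𝒰 anticommute with 𝒰 and makes i_w 𝒰 invertible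
in w. -/
theorem canonicalSD_sq : canonicalSD g U x * toC (g x)⁻¹ * canonicalSD g U x =
    (1 / 2 : ℂ) • toC (g x) := by
  refine h.hat_inj (show hat P _ = hat P _ from ?_)
  rw [h.hat_mul, hat_smul, h.hat_metric]
  ext i j
  simp only [Matrix.mul_apply, Fin.sum_univ_four, hat_canonicalSD h, Matrix.smul_apply,
    smul_eq_mul]
  have hk := kap_mul_kap
  fin_cases i <;> fin_cases j <;> simp [nullGram_entries, nullInv_entries, sgn] <;>
    first
    | linear_combination 2 * hk
    | linear_combination -2 * hk

end CanonicalForm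

/-! ### Covariant differentiation of 2-tensors -/

theorem ct_inj {P : Ten ℂ} (hP : P.det ≠ 0) {f h : Fin 4 → ℂ}
    (hfh : ∀ i, ct P i f = ct P i h) : f = h := by
  have e : P.transpose.mulVec f = P.transpose.mulVec h := funext hfh
  have hu : IsUnit P.transpose.det := by
    rw [Matrix.det_transpose]
    exact hP.isUnit
  have := congrArg (P.transpose)⁻¹.mulVec e
  simpa only [Matrix.mulVec_mulVec, Matrix.nonsing_inv_mul _ hu, Matrix.one_mulVec] using this

theorem TenSmooth.const_smul {Ω : Set Coords} {F : Coords → Ten ℂ} (hF : TenSmooth F Ω) (c : ℂ) :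
    TenSmooth (fun y => c • F y) Ω := fun a b => contDiffOn_const.mul (hF a b)

section Local

variable {g U : Coords → Ten ℝ} {Ω : Set Coords} {x : Coords} (h : IsLocalSpaceTime g U Ω)
include h

theorem smooth_hodge {F : Coords → Ten ℝ} (hF : TenSmooth F Ω) :
    TenSmooth (fun y => hodge (g y) (F y)) Ω := by
  have hvol : ∀ a b c d, ContDiffOn ℝ ∞ (fun y => vol (g y) a b c d) Ω := by
    intro a b c d
    refine ContDiffOn.mul ?_ contDiffOn_const
    -- Writing |det g| as √(det g)² leaves only square roots of nonvanishing smooth functions.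
    simp only [← Real.sqrt_sq_eq_abs]
    have hd := h.smooth_metric.det
    refine ((hd.pow 2).sqrt fun y hy => ?_).sqrt fun y hy => ?_
    · exact pow_ne_zero 2 (h.det_ne_zero y hy)
    · exact (Real.sqrt_pos.2 (by have := h.det_ne_zero y hy; positivity)).ne'
  intro a b
  simp only [hodge, Matrix.of_apply]
  refine ContDiffOn.sum fun c _ => ContDiffOn.sum fun d _ => ContDiffOn.sum fun m _ =>
    ContDiffOn.sum fun n _ => ?_
  exact (((contDiffOn_const.mul (hvol a b c d)).mul (h.smooth_inv c m)).mul
    (h.smooth_inv d n)).mul (hF m n)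

theorem smooth_hodge_form : TenSmooth (fun y => toC (hodge (g y) (U y))) Ω :=
  (smooth_hodge h h.smooth_form).ofReal

theorem smooth_canonicalSD : TenSmooth (canonicalSD g U) Ω := by
  refine TenSmooth.congr (A := fun y => kap • (toC (U y) - Complex.I • toC (hodge (g y) (U y))))
    ?_ fun y _ => ?_
  · exact TenSmooth.const_smul (h.smooth_form.ofReal.sub
      (TenSmooth.const_smul (smooth_hodge_form h) _)) _
  · rw [canonicalSD_eq, toC_hodge]

theorem mpd_const_smul {F : Coords → Ten ℂ} (hF : TenSmooth F Ω) (hx : x ∈ Ω) (c : ℂ) (a : Fin 4) :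
    mpd a (fun y => c • F y) x = c • mpd a F x := by
  ext b d
  exact pd_const_mul a c (hF.diffAt h.isOpen hx b d)

theorem covM_sub {A B : Coords → Ten ℂ} (hA : TenSmooth A Ω) (hB : TenSmooth B Ω) (hx : x ∈ Ω)
    (a : Fin 4) : covM g (fun y => A y - B y) a x = covM g A a x - covM g B a x := by
  rw [covM, mpd_sub hA hB h.isOpen hx]
  simp only [covM]
  noncomm_ring

theorem covM_const_smul {A : Coords → Ten ℂ} (hA : TenSmooth A Ω) (hx : x ∈ Ω) (c : ℂ)
    (a : Fin 4) : covM g (fun y => c • A y) a x = c • covM g A a x := by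
  rw [covM, mpd_const_smul h hA hx]
  simp only [covM, smul_sub, Matrix.mul_smul, Matrix.smul_mul]

theorem covM_congr {A B : Coords → Ten ℂ} (hx : x ∈ Ω) (hAB : ∀ y ∈ Ω, A y = B y) (a : Fin 4) :
    covM g A a x = covM g B a x := by
  rw [covM, covM, mpd_congr_on h.isOpen hx hAB, hAB x hx]

theorem toC_inv_mul (hx : x ∈ Ω) : toC (g x)⁻¹ * toC (g x) = 1 := by
  rw [← toC_mul, Matrix.nonsing_inv_mul _ (h.det_ne_zero x hx).isUnit, toC_one]

theorem mul_toC_inv (hx : x ∈ Ω) : toC (g x) * toC (g x)⁻¹ = 1 :=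
  mul_eq_one_comm.1 (toC_inv_mul h hx)

theorem mpd_metric (hx : x ∈ Ω) (a : Fin 4) : mpd a (fun y => toC (g y)) x =
    (gamma g a x).transpose * toC (g x) + toC (g x) * gamma g a x := by
  have := covM_metric h hx a
  rw [covM, sub_sub, sub_eq_zero] at this
  exact this

/-- Parallelism of g⁻¹, from differentiating g⁻¹ g = 1. -/
theorem mpd_inv (hx : x ∈ Ω) (a : Fin 4) : mpd a (fun y => toC (g y)⁻¹) x =
    -(toC (g x)⁻¹ * (gamma g a x).transpose) - gamma g a x * toC (g x)⁻¹ := by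
  have h1 : mpd a (fun y => toC (g y)⁻¹ * toC (g y)) x = 0 := by
    rw [mpd_congr_on h.isOpen hx (fun y hy => toC_inv_mul h hy), mpd_const]
  rw [mpd_mul h.smooth_inv.ofReal h.smooth_metric.ofReal h.isOpen hx, mpd_metric h hx] at h1
  have h2 := congrArg (· * toC (g x)⁻¹) h1
  have e1 := toC_inv_mul h hx
  have e2 := mul_toC_inv h hx
  simp only [Matrix.add_mul, Matrix.zero_mul, Matrix.mul_add] at h2
  have h3 : toC (g x)⁻¹ * ((gamma g a x).transpose * toC (g x)) * toC (g x)⁻¹ =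
      toC (g x)⁻¹ * (gamma g a x).transpose := by
    rw [← Matrix.mul_assoc, Matrix.mul_assoc _ (toC (g x)), e2, Matrix.mul_one]
  rw [h3, Matrix.mul_assoc _ (toC (g x)), e2, Matrix.mul_one, ← Matrix.mul_assoc (toC (g x)⁻¹),
    e1, Matrix.one_mul] at h2
  rw [eq_sub_iff_add_eq, eq_neg_iff_add_eq_zero, ← h2]
  abel

/-- The Leibniz rule for the product of 2-tensors. -/
theorem covM_mul {A B : Coords → Ten ℂ} (hA : TenSmooth A Ω) (hB : TenSmooth B Ω) (hx : x ∈ Ω)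
    (a : Fin 4) : covM g (fun y => A y * toC (g y)⁻¹ * B y) a x =
      covM g A a x * toC (g x)⁻¹ * B x + A x * toC (g x)⁻¹ * covM g B a x := by
  have hI := h.smooth_inv.ofReal
  rw [covM, mpd_mul (hA.mul hI) hB h.isOpen hx, mpd_mul hA hI h.isOpen hx, mpd_inv h hx]
  simp only [covM]
  noncomm_ring

theorem covM_antisymm {A : Coords → Ten ℂ} (hx : x ∈ Ω)
    (hA : ∀ y ∈ Ω, (A y).transpose = -A y) (a : Fin 4) :
    (covM g A a x).transpose = -covM g A a x := by
  have h1 : (mpd a A x).transpose = -mpd a A x := by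
    rw [← mpd_transpose, mpd_congr_on h.isOpen hx hA]
    ext b c
    simp [mpd, pd, fderiv_fun_neg]
  simp only [covM, Matrix.transpose_sub, Matrix.transpose_mul, Matrix.transpose_transpose, h1,
    hA x hx]
  noncomm_ring

theorem covM_canonicalSD_antisymm (hx : x ∈ Ω) (a : Fin 4) :
    (covM g (canonicalSD g U) a x).transpose = -covM g (canonicalSD g U) a x :=
  covM_antisymm h hx (fun y hy => by
    obtain ⟨P, hP⟩ := h.exists_frame y hy
    exact canonicalSD_antisymm hP) a

/-- The Leibniz rule applied to 𝒰² = g/2, the right-hand side being parallel. -/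
theorem covM_canonicalSD_anticomm (hx : x ∈ Ω) (a : Fin 4) :
    covM g (canonicalSD g U) a x * toC (g x)⁻¹ * canonicalSD g U x +
      canonicalSD g U x * toC (g x)⁻¹ * covM g (canonicalSD g U) a x = 0 := by
  have hU := smooth_canonicalSD h
  rw [← covM_mul h hU hU hx, covM_congr h (B := fun y => (1 / 2 : ℂ) • toC (g y)) hx,
    covM_const_smul h h.smooth_metric.ofReal hx, covM_metric h hx, smul_zero]
  intro y hy
  obtain ⟨P, hP⟩ := h.exists_frame y hy
  exact canonicalSD_sq hP

/-- `∇𝒰` is self-dual and orthogonal to `𝒰`. -/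
theorem hat_covM_canonicalSD_eq_zero (hx : x ∈ Ω) {P : Ten ℂ} (hP : IsNullFrame (g x) (U x) P)
    (a i j : Fin 4) (hij : sgn i ≠ sgn j) : hat P (covM g (canonicalSD g U) a x) i j = 0 := by
  have key := congrArg (hat P) (covM_canonicalSD_anticomm h hx a)
  rw [hat_add, hP.hat_mul, hP.hat_mul] at key
  have k1 := congrFun (congrFun key i) j
  set D := hat P (covM g (canonicalSD g U) a x)
  have hN : ∀ k l, ∑ m, nullInv k m * nullGram m l = if k = l then 1 else 0 := fun k l => by
    rw [← Matrix.mul_apply, nullInv_mul_nullGram, Matrix.one_apply]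
  have hN' : ∀ k l, ∑ m, nullGram k m * nullInv m l = if k = l then 1 else 0 := fun k l => by
    rw [← Matrix.mul_apply, nullGram_mul_nullInv, Matrix.one_apply]
  -- As 𝒰 is diagonal, the anticommutator multiplies the ij component by kap (sgn j - sgn i), which
  -- is nonzero when i and j lie in different null planes.
  have e1 : (D * nullInv * hat P (canonicalSD g U x)) i j = kap * sgn j * D i j := by
    rw [Matrix.mul_assoc, Matrix.mul_apply]
    simp only [Matrix.mul_apply, hat_canonicalSD hP]
    have : ∀ k, ∑ m, nullInv k m * (kap * nullGram m j * sgn j) =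
        kap * sgn j * if k = j then 1 else 0 := fun k => by
      rw [← hN, Finset.mul_sum]
      exact Finset.sum_congr rfl fun _ _ => by ring
    simp only [this]
    simp
    ring
  have e2 : (hat P (canonicalSD g U x) * nullInv * D) i j = -(kap * sgn i * D i j) := by
    rw [Matrix.mul_apply]
    simp only [Matrix.mul_apply]
    have : ∀ k, ∑ m, hat P (canonicalSD g U x) i m * nullInv m k =
        -(kap * sgn i) * if i = k then 1 else 0 := fun k => by
      rw [← hN', Finset.mul_sum]
      refine Finset.sum_congr rfl fun m _ => ?_
      rw [antisymm_entries (hat_antisymm P (canonicalSD_antisymm hP)), hat_canonicalSD hP]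
      have : nullGram m i = nullGram i m := by
        fin_cases m <;> fin_cases i <;> rfl
      rw [this]
      ring
    simp only [this]
    simp
  rw [Matrix.add_apply, e1, e2] at k1
  simp only [hat, Matrix.mul_zero, Matrix.zero_mul, Matrix.zero_apply] at k1
  have k2 : kap * (sgn j - sgn i) * D i j = 0 := by linear_combination k1
  have k3 : kap * (sgn j - sgn i) ≠ 0 :=
    mul_ne_zero kap_ne_zero (sub_ne_zero.2 (Ne.symm hij))
  exact (mul_eq_zero.1 k2).resolve_left k3

end Local

/-! ### Umbilical planes -/

theorem dot_eq (G : Ten ℝ) (A B : Ten ℂ) : dot G A B = A * toC G⁻¹ * B := by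
  ext a b
  simp only [dot, Matrix.of_apply, Matrix.mul_apply, Finset.sum_mul, Complex.real_smul,
    Matrix.map_apply]
  rw [Finset.sum_comm]
  exact Finset.sum_congr rfl fun _ _ => Finset.sum_congr rfl fun _ _ => by ring

theorem dot_eq_real (G : Ten ℝ) (A B : Ten ℝ) : dot G A B = A * G⁻¹ * B := by
  ext a b
  simp only [dot, Matrix.of_apply, Matrix.mul_apply, Finset.sum_mul, smul_eq_mul]
  rw [Finset.sum_comm]
  exact Finset.sum_congr rfl fun _ _ => Finset.sum_congr rfl fun _ _ => by ring

theorem toC_projV (g U : Coords → Ten ℝ) (x : Coords) :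
    toC (projV g U x) = toC (U x) * toC (g x)⁻¹ * toC (U x) := by
  rw [projV, dot_eq_real, toC_mul, toC_mul]

theorem toC_projH (g U : Coords → Ten ℝ) (x : Coords) :
    toC (projH g U x) = toC (g x) - toC (projV g U x) := by
  ext a b
  simp [projH]

/-- The frame components of `∇_a F_{bc}`. -/
def covHat (g : Coords → Ten ℝ) (F : Coords → Ten ℂ) (x : Coords) (P : Ten ℂ) (i j k : Fin 4) : ℂ :=
  ct P i fun a => hat P (covM g F a x) j k

section Local

variable {g U : Coords → Ten ℝ} {Ω : Set Coords} {x : Coords} (h : IsLocalSpaceTime g U Ω)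
include h

/-- Differentiating the mixed projector gives g⁻¹(∇p + pΓ), and q annihilates the term pΓ. The
second fundamental form thus reduces to the tensor q(∇p). -/
theorem secondForm_eq {p q : Coords → Ten ℝ} (hp : TenSmooth p Ω) (hx : x ∈ Ω)
    (hqp : toC (q x) * toC (g x)⁻¹ * toC (p x) = 0) (c i j : Fin 4) :
    ((secondForm g p q x c i j : ℝ) : ℂ) = ∑ a, (toC (g x)⁻¹ * toC (p x)) a i *
      (toC (g x)⁻¹ * toC (q x) * toC (g x)⁻¹ * covM g (fun y => toC (p y)) a x) c j := by
  have hm : TenSmooth (mixed g p) Ω := h.smooth_inv.mul hp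
  have e1 : ∀ a, mpd a (fun y => toC (mixed g p y)) x +
      gamma g a x * toC (mixed g p x) =
      toC (g x)⁻¹ * (covM g (fun y => toC (p y)) a x + toC (p x) * gamma g a x) := by
    intro a
    have : (fun y => toC (mixed g p y)) = fun y => toC (g y)⁻¹ * toC (p y) := by
      ext y : 1
      exact toC_mul _ _
    rw [this, mpd_mul h.smooth_inv.ofReal hp.ofReal h.isOpen hx, mpd_inv h hx, covM]
    simp only [mixed, toC_mul]
    noncomm_ring
  have e2 : ∀ a d, ((pd a (fun y => mixed g p y d j) x +
      ∑ b, christoffel g d a b x * mixed g p x b j : ℝ) : ℂ) =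
      (toC (g x)⁻¹ * (covM g (fun y => toC (p y)) a x + toC (p x) * gamma g a x)) d j := by
    intro a d
    rw [← e1, Matrix.add_apply, Matrix.mul_apply]
    push_cast
    congr 1
    exact (pd_ofReal a (hm.diffAt h.isOpen hx d j)).symm
  have e3 : ∀ a, toC (g x)⁻¹ * toC (q x) *
      (toC (g x)⁻¹ * (covM g (fun y => toC (p y)) a x + toC (p x) * gamma g a x)) =
      toC (g x)⁻¹ * toC (q x) * toC (g x)⁻¹ * covM g (fun y => toC (p y)) a x := by
    intro a
    have : toC (g x)⁻¹ * toC (q x) * (toC (g x)⁻¹ * (toC (p x) * gamma g a x)) =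
        toC (g x)⁻¹ * (toC (q x) * toC (g x)⁻¹ * toC (p x)) * gamma g a x := by noncomm_ring
    rw [Matrix.mul_add, Matrix.mul_add, this, hqp]
    simp only [Matrix.mul_zero, Matrix.zero_mul, add_zero, Matrix.mul_assoc]
  simp only [secondForm, Complex.ofReal_sum, Complex.ofReal_mul, e2]
  simp only [← e3]
  have hv : ∀ (r : Coords → Ten ℝ) a b, ((mixed g r x a b : ℝ) : ℂ) =
      (toC (g x)⁻¹ * toC (r x)) a b := fun r a b => by
    rw [← toC_mul]
    rfl
  simp only [hv]
  simp only [Matrix.mul_apply (M := toC (g x)⁻¹ * toC (q x)), Finset.mul_sum]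
  rw [Finset.sum_comm]
  exact Finset.sum_congr rfl fun _ _ => Finset.sum_congr rfl fun _ _ => by ring

/-- Evaluated twice on a null direction e_I of the plane, the umbilicity condition loses its trace
term because p(e_I, e_I) = 0. The hypotheses `hI`, `hpI` and `hqk` say that e_I is null, that p
fixes e_I and that q fixes e_k. -/
theorem covHat_eq_zero_of_umbilical {p q : Coords → Ten ℝ} (hp : TenSmooth p Ω) (hx : x ∈ Ω)
    (hqp : toC (q x) * toC (g x)⁻¹ * toC (p x) = 0) (humb : UmbilicalPlaneAt g p q x)
    {P : Ten ℂ} (hP : IsNullFrame (g x) (U x) P) {I k : Fin 4}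
    (hI : hat P (toC (p x)) I I = 0)
    (hpI : ∀ i, (nullInv * hat P (toC (p x))) i I = if i = I then 1 else 0)
    (hqk : ∀ i, (hat P (toC (q x)) * nullInv) k i = if i = k then 1 else 0) :
    covHat g (fun y => toC (p y)) x P I k I = 0 := by
  have z1 : ∀ c, ct P I (fun i => ct P I fun j => ((secondForm g p q x c i j : ℝ) : ℂ)) = 0 := by
    intro c
    have hu : ∀ i j, ((secondForm g p q x c i j : ℝ) : ℂ) + ((secondForm g p q x c j i : ℝ) : ℂ) =
        toC (p x) i j * ((∑ a, ∑ b, (g x)⁻¹ a b * secondForm g p q x c a b : ℝ) : ℂ) := by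
      intro i j
      have := congrArg (fun r : ℝ => (2 * r : ℂ)) (humb c i j)
      push_cast at this ⊢
      simp only [Matrix.map_apply]
      linear_combination this
    have h1 : ct P I (fun i => ct P I fun j => ((secondForm g p q x c i j : ℝ) : ℂ) +
        ((secondForm g p q x c j i : ℝ) : ℂ)) = 0 := by
      simp only [hu, ct_mul_right]
      rw [ct_ct, hI, zero_mul]
    simp only [ct_add] at h1
    rw [ct_comm P I I fun i j => ((secondForm g p q x c j i : ℝ) : ℂ)] at h1
    linear_combination h1 / 2
  have hcol : ∀ a, ∑ i, P i I * (toC (g x)⁻¹ * toC (p x)) a i = P a I := by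
    intro a
    have h1 : toC (g x)⁻¹ * toC (p x) * P = P * (nullInv * hat P (toC (p x))) := by
      rw [hP.toC_inv, hat]
      noncomm_ring
    have h2 := congrFun (congrFun h1 a) I
    rw [Matrix.mul_apply, Matrix.mul_apply] at h2
    simp only [hpI, mul_ite, mul_one, mul_zero, Finset.sum_ite_eq', Finset.mem_univ,
      if_true] at h2
    rw [← h2]
    exact Finset.sum_congr rfl fun _ _ => mul_comm _ _
  have z2 : ∀ c, ct P I (fun a => ct P I fun j =>
      (toC (g x)⁻¹ * toC (q x) * toC (g x)⁻¹ * covM g (fun y => toC (p y)) a x) c j) = 0 := by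
    intro c
    rw [← z1 c]
    simp only [secondForm_eq h hp hx hqp, ct_sum, ct_mul_left, ct_mul_right]
    conv_rhs => simp only [ct, hcol]
    rfl
  have z3 : ∀ c, ct P I (fun a => ct P I fun j =>
      (toC (q x) * toC (g x)⁻¹ * covM g (fun y => toC (p y)) a x) c j) = 0 := by
    intro c
    have e : ∀ a, toC (q x) * toC (g x)⁻¹ * covM g (fun y => toC (p y)) a x = toC (g x) *
        (toC (g x)⁻¹ * toC (q x) * toC (g x)⁻¹ * covM g (fun y => toC (p y)) a x) := by
      intro a
      rw [← Matrix.mul_assoc, ← Matrix.mul_assoc, ← Matrix.mul_assoc, mul_toC_inv h hx,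
        Matrix.one_mul]
    simp only [e]
    simp only [Matrix.mul_apply (M := toC (g x)), ct_sum, ct_mul_left, z2, mul_zero,
      Finset.sum_const_zero]
  have z4 : ct P I (fun a => ct P k fun c => ct P I fun j =>
      (toC (q x) * toC (g x)⁻¹ * covM g (fun y => toC (p y)) a x) c j) = 0 := by
    rw [ct_comm]
    simp only [z3, ct_zero]
  rw [← z4, covHat]
  congr 1
  ext a
  rw [ct_ct, hP.hat_mul, Matrix.mul_apply]
  simp only [hqk, ite_mul, one_mul, zero_mul, Finset.sum_ite_eq', Finset.mem_univ, if_true]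

end Local

/-! ### The covariant derivative of the canonical bivector of an umbilical structure -/

/-- The components of the projector on the time-like plane in an adapted null frame. -/
def nullV : Ten ℂ := !![0, -2, 0, 0; -2, 0, 0, 0; 0, 0, 0, 0; 0, 0, 0, 0]

/-- The components of the projector on the space-like plane in an adapted null frame. -/
def nullH : Ten ℂ := !![0, 0, 0, 0; 0, 0, 0, 0; 0, 0, 0, 2; 0, 0, 2, 0]

theorem nullForm_sq : nullForm * nullInv * nullForm = nullV := by
  ext i j
  simp only [Matrix.mul_apply, Fin.sum_univ_four, nullInv_entries]
  fin_cases i <;> fin_cases j <;> simp [nullForm, nullV] <;> norm_num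

theorem nullGram_sub_nullV : nullGram - nullV = nullH := by
  ext i j
  fin_cases i <;> fin_cases j <;> simp [nullGram, nullV, nullH]

theorem nullH_mul_nullV : nullH * nullInv * nullV = 0 := by
  ext i j
  simp only [Matrix.mul_apply, Fin.sum_univ_four, nullInv_entries]
  fin_cases i <;> fin_cases j <;> simp [nullH, nullV]

theorem nullV_mul_nullH : nullV * nullInv * nullH = 0 := by
  ext i j
  simp only [Matrix.mul_apply, Fin.sum_univ_four, nullInv_entries]
  fin_cases i <;> fin_cases j <;> simp [nullH, nullV]

theorem nullInv_mul_nullForm : nullInv * nullForm = Matrix.diagonal ![1, -1, 0, 0] := by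
  ext i j
  simp only [Matrix.mul_apply, Fin.sum_univ_four]
  fin_cases i <;> fin_cases j <;> simp [nullForm, nullInv]

theorem nullForm_mul_nullInv : nullForm * nullInv = -Matrix.diagonal ![1, -1, 0, 0] := by
  ext i j
  simp only [Matrix.mul_apply, Fin.sum_univ_four]
  fin_cases i <;> fin_cases j <;> simp [nullForm, nullInv] <;> norm_num

theorem nullInv_mul_nullV : nullInv * nullV = Matrix.diagonal ![1, 1, 0, 0] := by
  ext i j
  simp only [Matrix.mul_apply, Fin.sum_univ_four]
  fin_cases i <;> fin_cases j <;> simp [nullV, nullInv]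

theorem nullV_mul_nullInv : nullV * nullInv = Matrix.diagonal ![1, 1, 0, 0] := by
  ext i j
  simp only [Matrix.mul_apply, Fin.sum_univ_four]
  fin_cases i <;> fin_cases j <;> simp [nullV, nullInv] <;> norm_num

theorem nullInv_mul_nullH : nullInv * nullH = Matrix.diagonal ![0, 0, 1, 1] := by
  ext i j
  simp only [Matrix.mul_apply, Fin.sum_univ_four]
  fin_cases i <;> fin_cases j <;> simp [nullH, nullInv]

theorem nullH_mul_nullInv : nullH * nullInv = Matrix.diagonal ![0, 0, 1, 1] := by
  ext i j
  simp only [Matrix.mul_apply, Fin.sum_univ_four]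
  fin_cases i <;> fin_cases j <;> simp [nullH, nullInv]

theorem hat_projV {g U : Coords → Ten ℝ} {x : Coords} {P : Ten ℂ} (hP : IsNullFrame (g x) (U x) P) :
    hat P (toC (projV g U x)) = nullV := by
  rw [toC_projV, hP.hat_mul, hP.hat_form, nullForm_sq]

theorem hat_projH {g U : Coords → Ten ℝ} {x : Coords} {P : Ten ℂ} (hP : IsNullFrame (g x) (U x) P) :
    hat P (toC (projH g U x)) = nullH := by
  rw [toC_projH, hat_sub, hP.hat_metric, hat_projV hP, nullGram_sub_nullV]

theorem star_ct {P : Ten ℂ} (hP : ∀ a i, star (P a i) = P a (conjIdx i)) (i : Fin 4)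
    (f : Fin 4 → ℂ) : star (ct P i f) = ct P (conjIdx i) (fun a => star (f a)) := by
  simp only [ct, star_sum, star_mul', hP]

/-- A real tensor with a real connection: conjugation acts on the frame alone and exchanges m and
m̄. -/
theorem star_covHat {g : Coords → Ten ℝ} {Ω : Set Coords} (hΩ : IsOpen Ω)
    {F : Coords → Ten ℝ} (hF : TenSmooth F Ω)
    {x : Coords} (hx : x ∈ Ω) {P : Ten ℂ} (hP : ∀ a i, star (P a i) = P a (conjIdx i))
    (i j k : Fin 4) : star (covHat g (fun y => toC (F y)) x P i j k) =
      covHat g (fun y => toC (F y)) x P (conjIdx i) (conjIdx j) (conjIdx k) := by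
  have hreal : ∀ a b c, star (covM g (fun y => toC (F y)) a x b c) =
      covM g (fun y => toC (F y)) a x b c := by
    intro a b c
    simp only [covM, mpd_ofReal hF hΩ hx, Matrix.sub_apply, Matrix.mul_apply,
      Matrix.transpose_apply, gamma, Matrix.of_apply, Matrix.map_apply, star_sub, star_sum,
      star_mul', Complex.star_def, Complex.conj_ofReal]
  simp only [covHat, ← ct_ct, star_ct hP, hreal]

section Local

variable {g U : Coords → Ten ℝ} {Ω : Set Coords} {x : Coords} (h : IsLocalSpaceTime g U Ω)
include h

theorem smooth_projV : TenSmooth (projV g U) Ω :=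
  ((h.smooth_form.mul h.smooth_inv).mul h.smooth_form).congr fun _ _ => dot_eq_real _ _ _

theorem smooth_projH : TenSmooth (projH g U) Ω := h.smooth_metric.sub (smooth_projV h)

/-- The Leibniz rule for v = U², with U diagonal of eigenvalues 1, -1, 0, 0. The factor is ±1 when j
and k belong to different planes, so vanishing of ∇v there passes to ∇U. -/
theorem covHat_projV (hx : x ∈ Ω) {P : Ten ℂ} (hP : IsNullFrame (g x) (U x) P) (i j k : Fin 4) :
    covHat g (fun y => toC (projV g U y)) x P i j k =
      (![1, -1, 0, 0] k - ![1, -1, 0, 0] j) * covHat g (fun y => toC (U y)) x P i j k := by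
  have hU := h.smooth_form.ofReal
  have e : ∀ a, hat P (covM g (fun y => toC (projV g U y)) a x) j k =
      (![1, -1, 0, 0] k - ![1, -1, 0, 0] j) * hat P (covM g (fun y => toC (U y)) a x) j k := by
    intro a
    simp only [toC_projV]
    rw [covM_mul h hU hU hx, hat_add, hP.hat_mul, hP.hat_mul, hP.hat_form, Matrix.mul_assoc,
      nullInv_mul_nullForm, nullForm_mul_nullInv, Matrix.add_apply, Matrix.mul_diagonal,
      Matrix.neg_mul, Matrix.neg_apply, Matrix.diagonal_mul]
    ring
  simp only [covHat, e, ct_mul_left]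

theorem covHat_projH (hx : x ∈ Ω) (P : Ten ℂ) (i j k : Fin 4) :
    covHat g (fun y => toC (projH g U y)) x P i j k =
      -covHat g (fun y => toC (projV g U y)) x P i j k := by
  simp only [covHat, toC_projH, covM_sub h h.smooth_metric.ofReal (smooth_projV h).ofReal hx,
    covM_metric h hx, zero_sub, hat_neg, Matrix.neg_apply, ct_neg]

/-- The components of `∇U` that vanish when the time-like plane is umbilical. -/
theorem covHat_form_eq_zero_of_projV (hx : x ∈ Ω) {P : Ten ℂ} (hP : IsNullFrame (g x) (U x) P)
    (hv : UmbilicalPlaneAt g (projV g U) (projH g U) x) {I k : Fin 4} (hI : I = 0 ∨ I = 1)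
    (hk : k = 2 ∨ k = 3) : covHat g (fun y => toC (U y)) x P I k I = 0 := by
  have hhv : toC (projH g U x) * toC (g x)⁻¹ * toC (projV g U x) = 0 := by
    refine hP.hat_inj (show hat P _ = hat P _ from ?_)
    rw [hP.hat_mul, hat_projV hP, hat_projH hP, nullH_mul_nullV]
    simp [hat]
  have v := covHat_eq_zero_of_umbilical h (I := I) (k := k) (smooth_projV h) hx hhv hv hP
  rw [hat_projV hP, hat_projH hP, nullInv_mul_nullV, nullH_mul_nullInv, covHat_projV h hx hP] at v
  simp only [Matrix.diagonal_apply] at v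
  rcases hI with rfl | rfl <;> rcases hk with rfl | rfl <;>
    simpa [nullV, Fin.forall_fin_succ] using v

/-- The components of `∇U` that vanish when the space-like plane is umbilical. -/
theorem covHat_form_eq_zero_of_projH (hx : x ∈ Ω) {P : Ten ℂ} (hP : IsNullFrame (g x) (U x) P)
    (hh : UmbilicalPlaneAt g (projH g U) (projV g U) x) {I k : Fin 4} (hI : I = 2 ∨ I = 3)
    (hk : k = 0 ∨ k = 1) : covHat g (fun y => toC (U y)) x P I k I = 0 := by
  have hvh : toC (projV g U x) * toC (g x)⁻¹ * toC (projH g U x) = 0 := by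
    refine hP.hat_inj (show hat P _ = hat P _ from ?_)
    rw [hP.hat_mul, hat_projV hP, hat_projH hP, nullV_mul_nullH]
    simp [hat]
  have v := covHat_eq_zero_of_umbilical h (I := I) (k := k) (smooth_projH h) hx hvh hh hP
  rw [hat_projV hP, hat_projH hP, nullInv_mul_nullH, nullV_mul_nullInv, covHat_projH h hx,
    covHat_projV h hx hP] at v
  simp only [Matrix.diagonal_apply] at v
  rcases hI with rfl | rfl <;> rcases hk with rfl | rfl <;>
    simpa [nullH, Fin.forall_fin_succ] using v

/-- `∇𝒰` vanishes on the components where the conjugate component of `∇U` does. -/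
theorem covHat_canonicalSD_eq_zero (hx : x ∈ Ω) {P : Ten ℂ} (hP : IsNullFrame (g x) (U x) P)
    {i j k : Fin 4} (hjk : sgn (conjIdx j) ≠ sgn (conjIdx k))
    (h0 : covHat g (fun y => toC (U y)) x P i j k = 0) :
    covHat g (canonicalSD g U) x P i j k = 0 := by
  set W : Coords → Ten ℝ := fun y => hodge (g y) (U y) with hW
  have hWs : TenSmooth W Ω := smooth_hodge h h.smooth_form
  have e : ∀ i j k, covHat g (canonicalSD g U) x P i j k =
      kap * (covHat g (fun y => toC (U y)) x P i j k -
        Complex.I * covHat g (fun y => toC (W y)) x P i j k) := by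
    intro i j k
    have e1 : ∀ a, covM g (canonicalSD g U) a x = kap • (covM g (fun y => toC (U y)) a x -
        Complex.I • covM g (fun y => toC (W y)) a x) := by
      intro a
      rw [covM_congr h hx (B := fun y => kap • (toC (U y) - Complex.I • toC (W y)))
        (fun y _ => by rw [canonicalSD_eq, toC_hodge]),
        covM_const_smul h (h.smooth_form.ofReal.sub (hWs.ofReal.const_smul _)) hx,
        covM_sub h h.smooth_form.ofReal (hWs.ofReal.const_smul _) hx,
        covM_const_smul h hWs.ofReal hx]
    simp only [covHat, e1, hat_smul, hat_sub, Matrix.smul_apply, Matrix.sub_apply, smul_eq_mul,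
      ct_mul_left, ct_sub]
  -- At the conjugate position ∇𝒰 vanishes by the sign rule and ∇U by reality, hence so does ∇*U.
  -- Conjugating back kills ∇*U, and with it ∇𝒰, at the original position.
  have c1 : covHat g (fun y => toC (U y)) x P (conjIdx i) (conjIdx j) (conjIdx k) = 0 := by
    rw [← star_covHat h.isOpen h.smooth_form hx hP.conj, h0, star_zero]
  have c2 : covHat g (canonicalSD g U) x P (conjIdx i) (conjIdx j) (conjIdx k) = 0 := by
    simp only [covHat, hat_covM_canonicalSD_eq_zero h hx hP _ _ _ hjk, ct_zero]
  rw [e, c1, zero_sub, mul_neg, neg_eq_zero, ← mul_assoc] at c2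
  have c3 := (mul_eq_zero.1 c2).resolve_left (mul_ne_zero kap_ne_zero Complex.I_ne_zero)
  rw [← star_covHat h.isOpen hWs hx hP.conj, star_eq_zero] at c3
  rw [e, h0, c3]
  ring

end Local

/-! ### The covectors `ξ` and `χ` -/

theorem xi_eq (g U : Coords → Ten ℝ) (x : Coords) (b : Fin 4) : xi g U x b =
    -∑ a, ∑ c, (((g x)⁻¹ a c : ℝ) : ℂ) * covM g (canonicalSD g U) c x a b := by
  simp only [xi, codiff, Complex.real_smul, cov₂_eq_covM]

/-- The interior product `w^a 𝒰_{ab}`. -/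
def contractSD (g U : Coords → Ten ℝ) (x : Coords) (w : Fin 4 → ℂ) (b : Fin 4) : ℂ :=
  ∑ a, ∑ c, (((g x)⁻¹ a c : ℝ) : ℂ) * (w c * canonicalSD g U x a b)

theorem chi_eq (g U : Coords → Ten ℝ) (x : Coords) (b : Fin 4) :
    chi g U x b = contractSD g U x (xi g U x) b := by
  simp only [chi, contractSD, Complex.real_smul]

theorem ct_inj₃ {P : Ten ℂ} (hP : P.det ≠ 0) {K L : Fin 4 → Fin 4 → Fin 4 → ℂ}
    (H : ∀ i j k, ct P i (fun a => ct P j fun b => ct P k fun c => K a b c) =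
      ct P i (fun a => ct P j fun b => ct P k fun c => L a b c)) : K = L := by
  funext a b
  refine ct_inj hP fun k => ?_
  refine congrFun (ct_inj hP (f := fun b => ct P k (K a b)) (h := fun b => ct P k (L a b))
    fun j => ?_) b
  exact congrFun (ct_inj hP (f := fun a => ct P j fun b => ct P k (K a b))
    (h := fun a => ct P j fun b => ct P k (L a b)) fun i => H i j k) a

theorem nullGram_symm (i j : Fin 4) : nullGram i j = nullGram j i := by
  fin_cases i <;> fin_cases j <;> rfl

/-! ### Frame components of ξ and χ -/

section Frame

variable {g U : Coords → Ten ℝ} {x : Coords} {P : Ten ℂ} (hP : IsNullFrame (g x) (U x) P)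
include hP

theorem ct_xi (j : Fin 4) : ct P j (xi g U x) = 1 / 2 *
    (covHat g (canonicalSD g U) x P 1 0 j + covHat g (canonicalSD g U) x P 0 1 j
      - covHat g (canonicalSD g U) x P 3 2 j - covHat g (canonicalSD g U) x P 2 3 j) := by
  have e : ∀ k l, ct P k (fun a => ct P l fun c => ct P j fun b =>
      covM g (canonicalSD g U) c x a b) = covHat g (canonicalSD g U) x P l k j := by
    intro k l
    rw [ct_comm, covHat]
    simp only [ct_ct]
  have e2 : ct P j (xi g U x) = -∑ k, ∑ l, nullInv k l *
      covHat g (canonicalSD g U) x P l k j := by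
    have : ct P j (xi g U x) = ct P j fun b => xi g U x b := rfl
    rw [this]
    simp only [xi_eq, ct_neg, ct_sum, ct_mul_left]
    rw [hP.sum_inv]
    simp only [e]
  rw [e2]
  simp only [Fin.sum_univ_four, nullInv_entries]
  ring

/-- Interior product with 𝒰 is diagonal in the frame, with the same eigenvalues as 𝒰. -/
theorem ct_contractSD (w : Fin 4 → ℂ) (j : Fin 4) :
    ct P j (contractSD g U x w) = kap * sgn j * ct P j w := by
  have e2 : ct P j (contractSD g U x w) = ∑ k, ∑ l, nullInv k l *
      (ct P l w * hat P (canonicalSD g U x) k j) := by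
    have : ct P j (contractSD g U x w) = ct P j fun b => contractSD g U x w b := rfl
    rw [this]
    simp only [contractSD, ct_sum, ct_mul_left]
    rw [hP.sum_inv]
    simp only [ct_mul_left, ct_mul_right, ct_ct]
  rw [e2]
  simp only [hat_canonicalSD hP, Fin.sum_univ_four, nullInv_entries]
  fin_cases j <;> simp [nullGram_entries] <;> ring

theorem ct_chi (j : Fin 4) : ct P j (chi g U x) = kap * sgn j * ct P j (xi g U x) :=
  (congrArg (ct P j) (funext (chi_eq g U x))).trans (ct_contractSD hP _ j)

end Frame

section Local

variable {g U : Coords → Ten ℝ} {Ω : Set Coords} {x : Coords} (h : IsLocalSpaceTime g U Ω)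
include h

/-- The covariant derivative of the canonical bivector of an umbilical structure is determined by
its codifferential. -/
theorem covM_canonicalSD (hx : x ∈ Ω) (hv : UmbilicalPlaneAt g (projV g U) (projH g U) x)
    (hh : UmbilicalPlaneAt g (projH g U) (projV g U) x) (a b c : Fin 4) :
    covM g (canonicalSD g U) a x b c = -1 / 2 *
      (toC (g x) a b * xi g U x c - toC (g x) a c * xi g U x b +
        2 * (canonicalSD g U x a b * chi g U x c) - 2 * (canonicalSD g U x a c * chi g U x b)) := by
  obtain ⟨P, hP⟩ := h.exists_frame x hx
  have hd := hP.det_frame_ne_zero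
  suffices key : (fun a b c => covM g (canonicalSD g U) a x b c) = fun a b c => -1 / 2 *
      (toC (g x) a b * xi g U x c - toC (g x) a c * xi g U x b +
        2 * (canonicalSD g U x a b * chi g U x c) -
        2 * (canonicalSD g U x a c * chi g U x b)) from
    congrFun (congrFun (congrFun key a) b) c
  refine ct_inj₃ hd fun i j k => ?_
  have hD : ct P i (fun a => ct P j fun b => ct P k fun c =>
      covM g (canonicalSD g U) a x b c) = covHat g (canonicalSD g U) x P i j k := by
    rw [covHat]
    simp only [ct_ct]
  rw [hD]
  simp only [ct_mul_left, ct_mul_right, ct_sub, ct_add, ct_ct, hP.hat_metric,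
    hat_canonicalSD hP]
  simp only [ct_chi hP]
  have hk := kap_mul_kap
  set D := covHat g (canonicalSD g U) x P with hDdef
  have hX := ct_xi hP
  rw [← hDdef] at hX
  have h0 : ∀ i j k, sgn j ≠ sgn k → D i j k = 0 := fun i j k hjk => by
    simp only [hDdef, covHat, hat_covM_canonicalSD_eq_zero h hx hP _ _ _ hjk, ct_zero]
  have hA : ∀ i j k, D i j k = -D i k j := fun i j k => by
    simp only [hDdef, covHat, ← ct_neg]
    congr 1
    ext a
    exact antisymm_entries (hat_antisymm P (covM_canonicalSD_antisymm h hx a)) j k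
  have hdiag : ∀ i j, D i j j = 0 := fun i j => self_eq_neg.1 (hA i j j)
  have s1 : (1 : ℂ) ≠ -1 := by norm_num
  -- Anticommutation leaves the eight components D i 0 2 and D i 1 3. The four relations d1 to d4
  -- from umbilicity leave one component for each frame component of ξ.
  have d1 : D 0 2 0 = 0 := covHat_canonicalSD_eq_zero h hx hP (by simp [conjIdx, sgn, s1.symm])
    (covHat_form_eq_zero_of_projV h hx hP hv (by simp) (by simp))
  have d2 : D 1 3 1 = 0 := covHat_canonicalSD_eq_zero h hx hP (by simp [conjIdx, sgn, s1])
    (covHat_form_eq_zero_of_projV h hx hP hv (by simp) (by simp))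
  have d3 : D 2 0 2 = 0 := covHat_canonicalSD_eq_zero h hx hP (by simp [conjIdx, sgn, s1])
    (covHat_form_eq_zero_of_projH h hx hP hh (by simp) (by simp))
  have d4 : D 3 1 3 = 0 := covHat_canonicalSD_eq_zero h hx hP (by simp [conjIdx, sgn, s1.symm])
    (covHat_form_eq_zero_of_projH h hx hP hh (by simp) (by simp))
  have z01 : ∀ i, D i 0 1 = 0 := fun i => h0 i 0 1 (by simp [sgn, s1])
  have z03 : ∀ i, D i 0 3 = 0 := fun i => h0 i 0 3 (by simp [sgn, s1])
  have z12 : ∀ i, D i 1 2 = 0 := fun i => h0 i 1 2 (by simp [sgn, s1.symm])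
  have z23 : ∀ i, D i 2 3 = 0 := fun i => h0 i 2 3 (by simp [sgn, s1])
  have z10 : ∀ i, D i 1 0 = 0 := fun i => h0 i 1 0 (by simp [sgn, s1.symm])
  have z30 : ∀ i, D i 3 0 = 0 := fun i => h0 i 3 0 (by simp [sgn, s1.symm])
  have z21 : ∀ i, D i 2 1 = 0 := fun i => h0 i 2 1 (by simp [sgn, s1])
  have z32 : ∀ i, D i 3 2 = 0 := fun i => h0 i 3 2 (by simp [sgn, s1.symm])
  have m20 : ∀ i, D i 2 0 = -D i 0 2 := fun i => hA i 2 0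
  have m31 : ∀ i, D i 3 1 = -D i 1 3 := fun i => hA i 3 1
  rw [m20, neg_eq_zero] at d1
  rw [m31, neg_eq_zero] at d2
  -- Because kap² = ½, the 𝒰 ⊗ χ terms are the g ⊗ ξ terms multiplied by sgn j sgn k. The factor 1 +
  -- sgn j sgn k is the sign rule for ∇𝒰.
  have goal' : D i j k = -1 / 2 * ((1 + sgn j * sgn k) *
      (nullGram i j * ct P k (xi g U x) - nullGram i k * ct P j (xi g U x))) := by
    fin_cases i <;> fin_cases j <;> fin_cases k <;>
      simp only [Fin.zero_eta, Fin.mk_one, Fin.reduceFinMk, hX, nullGram_entries, sgn_entries,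
        hdiag, z01, z03, z12, z23, z10, z30, z21, z32, m20, m31, d1, d2, d3, d4] <;> ring
  rw [goal']
  linear_combination (sgn j * sgn k * (nullGram i j * ct P k (xi g U x)
    - nullGram i k * ct P j (xi g U x))) * hk

end Local

/-! ### Second covariant derivatives -/

/-- The covariant derivative `∇_a w_b` of a field of covectors. -/
def covV (g : Coords → Ten ℝ) (w : Coords → Fin 4 → ℂ) (x : Coords) (a b : Fin 4) : ℂ :=
  pd a (fun y => w y b) x - ∑ c, gamma g a x c b * w x c

theorem cov₁_eq_covV (g : Coords → Ten ℝ) (w : Coords → Fin 4 → ℂ) (x : Coords) (a b : Fin 4) :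
    cov₁ g w x a b = covV g w x a b := by
  simp only [cov₁, covV, gamma, Complex.real_smul, Matrix.of_apply]

/-- Smoothness of the components of a field of covectors. -/
def VecSmooth (w : Coords → Fin 4 → ℂ) (Ω : Set Coords) : Prop :=
  ∀ b, ContDiffOn ℝ ∞ (fun y => w y b) Ω

theorem VecSmooth.diffAt {w : Coords → Fin 4 → ℂ} {Ω : Set Coords} {x : Coords}
    (hw : VecSmooth w Ω) (hΩ : IsOpen Ω) (hx : x ∈ Ω) (b : Fin 4) :
    DifferentiableAt ℝ (fun y => w y b) x := ContDiffOn.diffAt (hw b) hΩ hx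

/-- The curvature with all the indices down, `R_{bcea}`, as a matrix in `b`, `c`. -/
def riemLow (g : Coords → Ten ℝ) (e a : Fin 4) (x : Coords) : Ten ℂ := toC (g x) * riemM g e a x

/-- The product rule in the exact shape of the right-hand side of `covM_canonicalSD`. -/
theorem pd_combination {x : Coords} (i : Fin 4) {f₁ w₁ f₂ w₂ f₃ w₃ f₄ w₄ : Coords → ℂ}
    (hf₁ : DifferentiableAt ℝ f₁ x) (hw₁ : DifferentiableAt ℝ w₁ x)
    (hf₂ : DifferentiableAt ℝ f₂ x) (hw₂ : DifferentiableAt ℝ w₂ x)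
    (hf₃ : DifferentiableAt ℝ f₃ x) (hw₃ : DifferentiableAt ℝ w₃ x)
    (hf₄ : DifferentiableAt ℝ f₄ x) (hw₄ : DifferentiableAt ℝ w₄ x) :
    pd i (fun y => -1 / 2 * (f₁ y * w₁ y - f₂ y * w₂ y + 2 * (f₃ y * w₃ y)
      - 2 * (f₄ y * w₄ y))) x = -1 / 2 * ((pd i f₁ x * w₁ x + f₁ x * pd i w₁ x)
      - (pd i f₂ x * w₂ x + f₂ x * pd i w₂ x) + 2 * (pd i f₃ x * w₃ x + f₃ x * pd i w₃ x)
      - 2 * (pd i f₄ x * w₄ x + f₄ x * pd i w₄ x)) := by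
  have p₁ := hf₁.fun_mul hw₁
  have p₂ := hf₂.fun_mul hw₂
  have p₃ := hf₃.fun_mul hw₃
  have p₄ := hf₄.fun_mul hw₄
  rw [pd_const_mul i _ (((p₁.fun_sub p₂).fun_add (p₃.const_mul 2)).fun_sub (p₄.const_mul 2)),
    pd_sub i ((p₁.fun_sub p₂).fun_add (p₃.const_mul 2)) (p₄.const_mul 2),
    pd_add i (p₁.fun_sub p₂) (p₃.const_mul 2), pd_sub i p₁ p₂, pd_const_mul i _ p₃,
    pd_const_mul i _ p₄, pd_mul i hf₁ hw₁, pd_mul i hf₂ hw₂, pd_mul i hf₃ hw₃, pd_mul i hf₄ hw₄]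

section Local

variable {g U : Coords → Ten ℝ} {Ω : Set Coords} {x : Coords} (h : IsLocalSpaceTime g U Ω)
include h

theorem smooth_xi : VecSmooth (xi g U) Ω := fun b => by
  simp only [xi_eq]
  refine (ContDiffOn.sum fun a _ => ContDiffOn.sum fun c _ => ?_).neg
  exact ContDiffOn.mul (h.smooth_inv.ofReal a c)
    (TenSmooth.covM h (smooth_canonicalSD h) c a b)

theorem smooth_chi : VecSmooth (chi g U) Ω := fun b => by
  simp only [chi_eq, contractSD]
  refine ContDiffOn.sum fun a _ => ContDiffOn.sum fun c _ => ?_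
  exact ContDiffOn.mul (h.smooth_inv.ofReal a c)
    (ContDiffOn.mul (smooth_xi h c) (smooth_canonicalSD h a b))

theorem gamma_symm (hx : x ∈ Ω) (a b m : Fin 4) : gamma g a x m b = gamma g b x m a := by
  simp only [gamma, Matrix.of_apply, christoffel_symm h hx m a b]

/-- The Ricci identity applied to the metric, whose covariant derivative vanishes identically. -/
theorem riemLow_antisymm (hx : x ∈ Ω) (e a : Fin 4) :
    (riemLow g e a x).transpose = -riemLow g e a x := by
  have hz : ∀ i, mpd i (fun y => (0 : Ten ℂ)) x = 0 := mpd_const 0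
  have h1 := ricci_identity h h.smooth_metric.ofReal hx e a
  rw [mpd_congr_on h.isOpen hx (B := fun _ => 0) (fun y hy => covM_metric h hy a),
    mpd_congr_on h.isOpen hx (B := fun _ => 0) (fun y hy => covM_metric h hy e),
    covM_metric h hx, covM_metric h hx, hz, hz] at h1
  simp only [Matrix.mul_zero, Matrix.zero_mul, sub_zero] at h1
  have hs : (toC (g x)).transpose = toC (g x) := by
    ext b c
    simp only [Matrix.transpose_apply, Matrix.map_apply, h.symm x hx b c]
  rw [riemLow, Matrix.transpose_mul, hs]
  rw [eq_comm, sub_eq_zero, neg_eq_iff_eq_neg] at h1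
  exact h1

/-- The second covariant derivative of the canonical bivector of an umbilical structure. -/
theorem second_covM_canonicalSD (hx : x ∈ Ω)
    (hv : ∀ y ∈ Ω, UmbilicalPlaneAt g (projV g U) (projH g U) y)
    (hh : ∀ y ∈ Ω, UmbilicalPlaneAt g (projH g U) (projV g U) y) (e a b c : Fin 4) :
    (mpd e (covM g (canonicalSD g U) a) x
      - (gamma g e x).transpose * covM g (canonicalSD g U) a x
      - covM g (canonicalSD g U) a x * gamma g e x) b c
      - ∑ m, gamma g e x m a * covM g (canonicalSD g U) m x b c = -1 / 2 *
      (toC (g x) a b * covV g (xi g U) x e c - toC (g x) a c * covV g (xi g U) x e b +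
        2 * (covM g (canonicalSD g U) e x a b * chi g U x c
          + canonicalSD g U x a b * covV g (chi g U) x e c) -
        2 * (covM g (canonicalSD g U) e x a c * chi g U x b
          + canonicalSD g U x a c * covV g (chi g U) x e b)) := by
  have hf := fun y hy => covM_canonicalSD (x := y) h hy (hv y hy) (hh y hy)
  have dg := h.smooth_metric.ofReal.diffAt h.isOpen hx
  have dU := (smooth_canonicalSD h).diffAt h.isOpen hx
  have dξ := (smooth_xi h).diffAt h.isOpen hx
  have dχ := (smooth_chi h).diffAt h.isOpen hx
  have hp : mpd e (covM g (canonicalSD g U) a) x b c = -1 / 2 *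
      ((mpd e (fun y => toC (g y)) x a b * xi g U x c +
          toC (g x) a b * pd e (fun y => xi g U y c) x) -
        (mpd e (fun y => toC (g y)) x a c * xi g U x b +
          toC (g x) a c * pd e (fun y => xi g U y b) x) +
        2 * (mpd e (canonicalSD g U) x a b * chi g U x c +
          canonicalSD g U x a b * pd e (fun y => chi g U y c) x) -
        2 * (mpd e (canonicalSD g U) x a c * chi g U x b +
          canonicalSD g U x a c * pd e (fun y => chi g U y b) x)) := by
    have e1 : mpd e (covM g (canonicalSD g U) a) x b c = pd e (fun y => -1 / 2 *
      (toC (g y) a b * xi g U y c - toC (g y) a c * xi g U y b +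
        2 * (canonicalSD g U y a b * chi g U y c) -
        2 * (canonicalSD g U y a c * chi g U y b))) x :=
      pd_congr_on e h.isOpen hx fun y hy => hf y hy a b c
    exact e1.trans (pd_combination e (dg a b) (dξ c) (dg a c) (dξ b) (dU a b) (dχ c) (dU a c)
      (dχ b))
  -- Partial derivatives of g and 𝒰 are traded for covariant ones plus Γ terms; all the Γ terms
  -- cancel in the end.
  have hg : ∀ i j, mpd e (fun y => toC (g y)) x i j =
      ((gamma g e x).transpose * toC (g x)) i j + (toC (g x) * gamma g e x) i j := fun i j => by
    rw [mpd_metric h hx e, Matrix.add_apply]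
  have hU : ∀ i j, mpd e (canonicalSD g U) x i j = covM g (canonicalSD g U) e x i j +
      ((gamma g e x).transpose * canonicalSD g U x) i j +
      (canonicalSD g U x * gamma g e x) i j := fun i j => by
    simp only [covM, Matrix.sub_apply]
    ring
  simp only [Matrix.sub_apply, hp, hg, hU, covV]
  simp only [Matrix.mul_apply, Matrix.transpose_apply, hf x hx a, hf x hx _ b c]
  simp only [Fin.sum_univ_four]
  ring

end Local

/-! ### The Ricci identity in a null frame -/

/-- The frame components of the curvature: `curvHat i j k l = R_{klij}`. -/
def curvHat (g : Coords → Ten ℝ) (x : Coords) (P : Ten ℂ) (i j k l : Fin 4) : ℂ :=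
  ct P i fun e => ct P j fun a => hat P (riemLow g e a x) k l

theorem nullInv_mul_hat_canonicalSD {g U : Coords → Ten ℝ} {x : Coords} {P : Ten ℂ}
    (hP : IsNullFrame (g x) (U x) P) :
    nullInv * hat P (canonicalSD g U x) = kap • Matrix.diagonal sgn := by
  ext i j
  simp only [Matrix.mul_apply, Fin.sum_univ_four, hat_canonicalSD hP]
  fin_cases i <;> fin_cases j <;> simp [nullGram_entries, nullInv_entries, sgn] <;> ring

theorem hat_canonicalSD_mul_nullInv {g U : Coords → Ten ℝ} {x : Coords} {P : Ten ℂ}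
    (hP : IsNullFrame (g x) (U x) P) :
    hat P (canonicalSD g U x) * nullInv = -(kap • Matrix.diagonal sgn) := by
  ext i j
  simp only [Matrix.mul_apply, Fin.sum_univ_four, hat_canonicalSD hP]
  fin_cases i <;> fin_cases j <;> simp [nullGram_entries, nullInv_entries, sgn] <;> ring

theorem ct_covV_xi (g U : Coords → Ten ℝ) (x : Coords) (P : Ten ℂ) (i j : Fin 4) :
    ct P i (fun a => ct P j fun b => covV g (xi g U) x a b) =
      hat P (tensorT g U x) i j + ct P i (chi g U x) * ct P j (xi g U x) := by
  have : ∀ a b, covV g (xi g U) x a b = tensorT g U x a b + chi g U x a * xi g U x b := by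
    intro a b
    rw [← cov₁_eq_covV, tensorT, Matrix.of_apply, sub_add_cancel]
  simp only [this, ct_add, ct_mul_left, ct_mul_right, ct_ct]

/-! ### The covariant derivative of χ -/

section Local

variable {g U : Coords → Ten ℝ} {Ω : Set Coords} {x : Coords} (h : IsLocalSpaceTime g U Ω)
include h

theorem covHat_canonicalSD (hx : x ∈ Ω) {P : Ten ℂ} (hP : IsNullFrame (g x) (U x) P)
    (hv : UmbilicalPlaneAt g (projV g U) (projH g U) x)
    (hh : UmbilicalPlaneAt g (projH g U) (projV g U) x) (i j k : Fin 4) :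
    covHat g (canonicalSD g U) x P i j k = -1 / 2 * ((1 + sgn j * sgn k) *
      (nullGram i j * ct P k (xi g U x) - nullGram i k * ct P j (xi g U x))) := by
  have e : covHat g (canonicalSD g U) x P i j k = ct P i (fun a => ct P j fun b => ct P k fun c =>
      covM g (canonicalSD g U) a x b c) := by
    rw [covHat]
    simp only [ct_ct]
  rw [e]
  simp only [covM_canonicalSD h hx hv hh, ct_mul_left, ct_mul_right, ct_sub, ct_add, ct_ct,
    hP.hat_metric, hat_canonicalSD hP, ct_chi hP]
  linear_combination -(sgn j * sgn k * (nullGram i j * ct P k (xi g U x)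
    - nullGram i k * ct P j (xi g U x))) * kap_mul_kap

theorem covV_chi (hx : x ∈ Ω) (e b : Fin 4) : covV g (chi g U) x e b =
    ∑ a, ∑ c, (((g x)⁻¹ a c : ℝ) : ℂ) * (covV g (xi g U) x e a * canonicalSD g U x c b
      + xi g U x a * covM g (canonicalSD g U) e x c b) := by
  have dU := (smooth_canonicalSD h).diffAt h.isOpen hx
  have dξ := (smooth_xi h).diffAt h.isOpen hx
  have dI := h.smooth_inv.ofReal.diffAt h.isOpen hx
  have hI := mpd_inv h hx e
  have hIs : ∀ a c, toC (g x)⁻¹ a c = toC (g x)⁻¹ c a := by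
    intro a c
    obtain ⟨P, hP⟩ := h.exists_frame x hx
    have : ((g x)⁻¹).transpose = (g x)⁻¹ := by rw [Matrix.transpose_nonsing_inv, hP.metric_symm]
    exact congrArg Complex.ofReal (congrFun (congrFun this c) a)
  have hχ : ∀ y, chi g U y b = ∑ a, ∑ c, toC (g y)⁻¹ a c * (xi g U y c * canonicalSD g U y a b) :=
    fun y => chi_eq g U y b
  have d1 : ∀ a c, DifferentiableAt ℝ (fun y => xi g U y c * canonicalSD g U y a b) x :=
    fun a c => (dξ c).fun_mul (dU a b)
  have d2 : ∀ a c, DifferentiableAt ℝ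
      (fun y => toC (g y)⁻¹ a c * (xi g U y c * canonicalSD g U y a b)) x :=
    fun a c => (dI a c).fun_mul (d1 a c)
  have hpd : pd e (fun y => chi g U y b) x = ∑ a, ∑ c,
      (mpd e (fun y => toC (g y)⁻¹) x a c * (xi g U x c * canonicalSD g U x a b)
        + toC (g x)⁻¹ a c * (pd e (fun y => xi g U y c) x * canonicalSD g U x a b +
          xi g U x c * mpd e (canonicalSD g U) x a b)) := by
    simp only [hχ]
    rw [pd_sum _ _ fun a _ => DifferentiableAt.fun_sum fun c _ => d2 a c]
    refine Finset.sum_congr rfl fun a _ => ?_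
    rw [pd_sum _ _ fun c _ => d2 a c]
    refine Finset.sum_congr rfl fun c _ => ?_
    rw [pd_mul e (dI a c) (d1 a c), pd_mul e (dξ c) (dU a b)]
    rfl
  have hU : ∀ i j, mpd e (canonicalSD g U) x i j = covM g (canonicalSD g U) e x i j +
      ((gamma g e x).transpose * canonicalSD g U x) i j +
      (canonicalSD g U x * gamma g e x) i j := fun i j => by
    simp only [covM, Matrix.sub_apply]
    ring
  have hg : ∀ a c, (((g x)⁻¹ a c : ℝ) : ℂ) = toC (g x)⁻¹ a c := fun _ _ => rfl
  have hχx : ∀ d, chi g U x d =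
      ∑ a, ∑ c, toC (g x)⁻¹ a c * (xi g U x c * canonicalSD g U x a d) := chi_eq g U x
  rw [covV, hpd]
  simp only [hI, hU, hχx, hg, covV]
  simp only [Matrix.sub_apply, Matrix.neg_apply, Matrix.mul_apply, Matrix.transpose_apply]
  have hs := hIs
  simp only [Fin.sum_univ_four]
  rw [hs 1 0, hs 2 0, hs 3 0, hs 2 1, hs 3 1, hs 3 2]
  ring

end Local

theorem ct_ct' (P A : Ten ℂ) (i j : Fin 4) :
    ct P j (fun b => ct P i fun a => A a b) = hat P A i j := by
  rw [ct_comm P j i fun b a => A a b, ct_ct]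

section Local

variable {g U : Coords → Ten ℝ} {Ω : Set Coords} {x : Coords} (h : IsLocalSpaceTime g U Ω)
include h

/-- Leibniz rule for χ = i_ξ 𝒰 with the known ∇𝒰. All terms quadratic in ξ are symmetric in i, j
once ∇ξ is written as T + χ ⊗ ξ; this is what the correction χ ⊗ ξ in T is for. -/
theorem ct_covV_chi (hx : x ∈ Ω) {P : Ten ℂ} (hP : IsNullFrame (g x) (U x) P)
    (hv : UmbilicalPlaneAt g (projV g U) (projH g U) x)
    (hh : UmbilicalPlaneAt g (projH g U) (projV g U) x) (i j : Fin 4) :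
    ct P i (fun e => ct P j fun b => covV g (chi g U) x e b) = kap * sgn j *
      (hat P (tensorT g U x) i j + kap * sgn i * ct P i (xi g U x) * ct P j (xi g U x)) +
      -1 / 2 * ((1 - sgn i * sgn j) * ct P i (xi g U x) * ct P j (xi g U x) - nullGram i j *
        (-(ct P 0 (xi g U x) * ct P 1 (xi g U x)) + ct P 2 (xi g U x) * ct P 3 (xi g U x))) := by
  have e1 : ct P i (fun e => ct P j fun b => covV g (chi g U) x e b) = ∑ k, ∑ l, nullInv k l *
      ((hat P (tensorT g U x) i k + ct P i (chi g U x) * ct P k (xi g U x)) *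
        hat P (canonicalSD g U x) l j +
        ct P k (xi g U x) * covHat g (canonicalSD g U) x P i l j) := by
    simp only [covV_chi h hx, hP.sum_inv, ct_sum, ct_add, ct_mul_left, ct_mul_right, ct_ct',
      ct_covV_xi, covHat]
  rw [e1]
  simp only [ct_chi hP, hat_canonicalSD hP, covHat_canonicalSD h hx hP hv hh]
  generalize hat P (tensorT g U x) = t
  generalize hX : (fun k => ct P k (xi g U x)) = X
  have hX' : ∀ k, ct P k (xi g U x) = X k := fun k => congrFun hX k
  simp only [hX', Fin.sum_univ_four, nullInv_entries, sgn_entries]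
  fin_cases i <;> fin_cases j <;>
    simp only [Fin.zero_eta, Fin.mk_one, Fin.reduceFinMk, nullGram_entries, sgn_entries] <;> ring

/-- The exterior derivative of `χ` in terms of the tensor `T`. -/
theorem ct_covV_chi_sub (hx : x ∈ Ω) {P : Ten ℂ} (hP : IsNullFrame (g x) (U x) P)
    (hv : UmbilicalPlaneAt g (projV g U) (projH g U) x)
    (hh : UmbilicalPlaneAt g (projH g U) (projV g U) x) (i j : Fin 4) :
    ct P i (fun e => ct P j fun b => covV g (chi g U) x e b) -
      ct P j (fun e => ct P i fun b => covV g (chi g U) x e b) =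
    kap * (sgn j * hat P (tensorT g U x) i j - sgn i * hat P (tensorT g U x) j i) := by
  rw [ct_covV_chi h hx hP hv hh, ct_covV_chi h hx hP hv hh, nullGram_symm i j]
  ring

/-- The connection is torsion free, so dχ is the antisymmetrized ∇χ. In the frame it vanishes when T
is symmetric inside each null plane and antisymmetric across them. -/
theorem chi_closed_iff (hx : x ∈ Ω) {P : Ten ℂ} (hP : IsNullFrame (g x) (U x) P)
    (hv : UmbilicalPlaneAt g (projV g U) (projH g U) x)
    (hh : UmbilicalPlaneAt g (projH g U) (projV g U) x) :
    (∀ a b, pd a (fun y => chi g U y b) x = pd b (fun y => chi g U y a) x) ↔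
    ∀ i j, sgn j * hat P (tensorT g U x) i j = sgn i * hat P (tensorT g U x) j i := by
  have e : ∀ a b, pd a (fun y => chi g U y b) x - pd b (fun y => chi g U y a) x =
      covV g (chi g U) x a b - covV g (chi g U) x b a := by
    intro a b
    simp only [covV, gamma_symm h hx a b]
    ring
  have e' : ∀ i j, ct P i (fun a => ct P j fun b => covV g (chi g U) x a b
      - covV g (chi g U) x b a) =
      kap * (sgn j * hat P (tensorT g U x) i j - sgn i * hat P (tensorT g U x) j i) := by
    intro i j
    rw [← ct_covV_chi_sub h hx hP hv hh]
    simp only [ct_sub]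
    congr 1
    exact ct_comm P i j fun a b => covV g (chi g U) x b a
  constructor
  · intro hc i j
    have h1 := e' i j
    have : ∀ a b, covV g (chi g U) x a b - covV g (chi g U) x b a = 0 := fun a b => by
      rw [← e, hc a b, sub_self]
    simp only [this, ct_zero] at h1
    exact sub_eq_zero.1 ((mul_eq_zero.1 h1.symm).resolve_left kap_ne_zero)
  · intro hc a b
    have h1 : ∀ i j, ct P i (fun a => ct P j fun b => covV g (chi g U) x a b
        - covV g (chi g U) x b a) = 0 := fun i j => by
      rw [e', hc i j, sub_self, mul_zero]
    rw [← sub_eq_zero, e]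
    have h2 : (fun b => covV g (chi g U) x a b - covV g (chi g U) x b a) = fun _ => 0 := by
      refine ct_inj hP.det_frame_ne_zero fun j => ?_
      rw [ct_zero]
      have : (fun a => ct P j fun b => covV g (chi g U) x a b - covV g (chi g U) x b a) =
          fun _ => 0 := ct_inj hP.det_frame_ne_zero fun i => by rw [h1, ct_zero]
      exact congrFun this a
    exact congrFun h2 b

/-- The Ricci identity for the canonical bivector of an umbilical structure. -/
theorem ricci_identity_canonicalSD (hx : x ∈ Ω) {P : Ten ℂ} (hP : IsNullFrame (g x) (U x) P)
    (hv : ∀ y ∈ Ω, UmbilicalPlaneAt g (projV g U) (projH g U) y)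
    (hh : ∀ y ∈ Ω, UmbilicalPlaneAt g (projH g U) (projV g U) y) (i j k l : Fin 4)
    (hkl : k = 0 ∧ l = 2 ∨ k = 1 ∧ l = 3) :
    kap * (2 * sgn k) * curvHat g x P i j k l =
      -(nullGram j k * hat P (tensorT g U x) i l - nullGram j l * hat P (tensorT g U x) i k
        - nullGram i k * hat P (tensorT g U x) j l
        + nullGram i l * hat P (tensorT g U x) j k) := by
  have hs : sgn k = sgn l := by
    rcases hkl with ⟨rfl, rfl⟩ | ⟨rfl, rfl⟩ <;> rfl
  set Z : Fin 4 → Fin 4 → Fin 4 → Fin 4 → ℂ := fun e a b c => -1 / 2 *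
      (toC (g x) a b * covV g (xi g U) x e c - toC (g x) a c * covV g (xi g U) x e b +
        2 * (covM g (canonicalSD g U) e x a b * chi g U x c
          + canonicalSD g U x a b * covV g (chi g U) x e c) -
        2 * (covM g (canonicalSD g U) e x a c * chi g U x b
          + canonicalSD g U x a c * covV g (chi g U) x e b)) with hZ
  -- `Z` is the second covariant derivative of 𝒰. The Γ^m_{ea} terms of its two orderings agree and
  -- drop out.
  have hR : ∀ e a b c, (riemLow g e a x * toC (g x)⁻¹ * canonicalSD g U x) b c -
      (canonicalSD g U x * toC (g x)⁻¹ * riemLow g e a x) b c = Z e a b c - Z a e b c := by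
    intro e a b c
    have h1 := congrFun (congrFun (ricci_identity h (smooth_canonicalSD h) hx e a) b) c
    have h2 := second_covM_canonicalSD h hx hv hh e a b c
    have h3 := second_covM_canonicalSD h hx hv hh a e b c
    simp only [gamma_symm h hx a e] at h3
    have r1 : riemM g e a x = toC (g x)⁻¹ * riemLow g e a x := by
      rw [riemLow, ← Matrix.mul_assoc, toC_inv_mul h hx, Matrix.one_mul]
    have r2 : (riemM g e a x).transpose = -(riemLow g e a x * toC (g x)⁻¹) := by
      have hs : (toC (g x)⁻¹).transpose = toC (g x)⁻¹ := by
        ext b c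
        have : ((g x)⁻¹).transpose = (g x)⁻¹ := by rw [Matrix.transpose_nonsing_inv, hP.metric_symm]
        exact congrArg Complex.ofReal (congrFun (congrFun this b) c)
      rw [r1, Matrix.transpose_mul, hs, riemLow_antisymm h hx, Matrix.neg_mul]
    rw [r2, r1, Matrix.neg_mul, neg_neg, ← Matrix.mul_assoc] at h1
    rw [← Matrix.sub_apply, ← h1, Matrix.sub_apply]
    simp only [hZ]
    linear_combination h2 - h3
  -- The curvature acts on 𝒰 as a commutator. For k and l in the same null plane the two diagonal
  -- factors add up to 2 kap sgn k.
  have hL : ∀ e a, hat P (riemLow g e a x * toC (g x)⁻¹ * canonicalSD g U x) k l -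
      hat P (canonicalSD g U x * toC (g x)⁻¹ * riemLow g e a x) k l =
      kap * (2 * sgn k) * hat P (riemLow g e a x) k l := by
    intro e a
    rw [hP.hat_mul, hP.hat_mul, Matrix.mul_assoc, nullInv_mul_hat_canonicalSD hP,
      hat_canonicalSD_mul_nullInv hP, Matrix.mul_smul, Matrix.smul_apply, Matrix.mul_diagonal,
      Matrix.neg_mul, Matrix.neg_apply, Matrix.smul_mul, Matrix.smul_apply, Matrix.diagonal_mul,
      hs]
    simp only [smul_eq_mul]
    ring
  have hC : kap * (2 * sgn k) * curvHat g x P i j k l = ct P i (fun e => ct P j fun a =>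
      ct P k fun b => ct P l fun c => Z e a b c - Z a e b c) := by
    simp only [← hR, ct_sub, ct_ct]
    simp only [← ct_sub, hL, ct_mul_left]
    rfl
  have hX : ∀ i j, ct P i (fun e => ct P j fun b => covV g (chi g U) x e b) = _ :=
    ct_covV_chi h hx hP (hv x hx) (hh x hx)
  have hD : ∀ i j k, ct P i (fun e => hat P (covM g (canonicalSD g U) e x) j k) = _ :=
    covHat_canonicalSD h hx hP (hv x hx) (hh x hx)
  have hD' : ∀ i j k, ct P j (fun e => ct P i fun a => ct P k fun b =>
      covM g (canonicalSD g U) a x e b) =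
      ct P i (fun e => hat P (covM g (canonicalSD g U) e x) j k) :=
    fun i j k => by
      rw [ct_comm P j i fun e a => ct P k fun b => covM g (canonicalSD g U) a x e b]
      simp only [ct_ct]
  rw [hC]
  simp only [hZ, ct_sub, ct_add, ct_mul_left, ct_mul_right, ct_ct, hD', hP.hat_metric,
    hat_canonicalSD hP, hX, ct_covV_xi, hD, ct_chi hP]
  generalize hat P (tensorT g U x) = t
  generalize hX : (fun k => ct P k (xi g U x)) = X
  have hX' : ∀ k, ct P k (xi g U x) = X k := fun k => congrFun hX k
  simp only [hX']
  -- The two sides differ by this multiple of kap² - ½.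
  have hc : (-(nullGram j k * (t i l + kap * sgn i * X i * X l))
      + nullGram j l * (t i k + kap * sgn i * X i * X k)
      + nullGram i k * (t j l + kap * sgn j * X j * X l)
      - nullGram i l * (t j k + kap * sgn j * X j * X k)) * (kap * kap) =
      (-(nullGram j k * (t i l + kap * sgn i * X i * X l))
      + nullGram j l * (t i k + kap * sgn i * X i * X k)
      + nullGram i k * (t j l + kap * sgn j * X j * X l)
      - nullGram i l * (t j k + kap * sgn j * X j * X k)) * (1 / 2) := by
    rw [kap_mul_kap]
  clear_value Z
  clear hX hX' hR hL hC hD hD' hZ hv hh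
  rcases hkl with ⟨rfl, rfl⟩ | ⟨rfl, rfl⟩ <;> fin_cases i <;> fin_cases j <;>
    simp only [Fin.zero_eta, Fin.mk_one, Fin.reduceFinMk, nullGram_entries, sgn_entries]
      at hc ⊢ <;>
    linear_combination hc

end Local

/-! ### Curvature-like tensors in a frame -/

/-- The symmetries of the curvature tensor. -/
structure IsCurvatureLike (K : Fin 4 → Fin 4 → Fin 4 → Fin 4 → ℂ) : Prop where
  antisymm_left : ∀ i j k l, K i j k l = -K j i k l
  antisymm_right : ∀ i j k l, K i j k l = -K i j l k
  cyclic : ∀ i j k l, K i j k l + K i k l j + K i l j k = 0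

/-- The usual combination of four cyclic identities, reduced by the antisymmetries. -/
theorem IsCurvatureLike.pair_symm {K : Fin 4 → Fin 4 → Fin 4 → Fin 4 → ℂ}
    (hK : IsCurvatureLike K) (i j k l : Fin 4) : K i j k l = K k l i j := by
  have a := hK.antisymm_left
  have b := hK.antisymm_right
  have c := hK.cyclic
  linear_combination 1 / 2 * (c i j k l - c j k l i - c k l i j + c l i j k)
    + 1 / 2 * (-b i k l j + b j k l i + a j i k l + a k i j l + a k j l i - b j k l i
      - a l i j k - a l j k i + b j l k i - a l k i j)

theorem ct_rotate (P : Ten ℂ) (i j k : Fin 4) (f : Fin 4 → Fin 4 → Fin 4 → ℂ) :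
    ct P i (fun a => ct P j fun b => ct P k fun c => f a b c) =
      ct P k (fun c => ct P i fun a => ct P j fun b => f a b c) :=
  (congrArg (ct P i) (funext fun a => ct_comm P j k (f a))).trans
    (ct_comm P i k fun a c => ct P j fun b => f a b c)

theorem riemLow_swap (g : Coords → Ten ℝ) (x : Coords) (e a : Fin 4) :
    riemLow g e a x = -riemLow g a e x := by
  have : riemM g e a x = -riemM g a e x := by
    ext m b
    simp only [riemM, riemann, Matrix.of_apply, Matrix.neg_apply]
    push_cast
    ring
  rw [riemLow, riemLow, this, Matrix.mul_neg]

/-! ### Symmetries of the Riemann tensor and its contraction -/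

section Local

variable {g U : Coords → Ten ℝ} {Ω : Set Coords} {x : Coords} (h : IsLocalSpaceTime g U Ω)
include h

/-- First Bianchi identity, from the symmetry of Γ in its lower indices. -/
theorem riemLow_cyclic (hx : x ∈ Ω) (b c e a : Fin 4) :
    riemLow g e a x b c + riemLow g a c x b e + riemLow g c e x b a = 0 := by
  have hp : ∀ i j k m, pd i (christoffel g m j k) x = pd i (christoffel g m k j) x :=
    fun i j k m => pd_congr_on i h.isOpen hx fun y hy => christoffel_symm h hy m j k
  have hR : ∀ m, riemM g e a x m c + riemM g a c x m e + riemM g c e x m a = 0 := by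
    intro m
    simp only [riemM, riemann, Matrix.of_apply]
    norm_cast
    simp only [hp e c a, hp a e c, hp c a e, christoffel_symm h hx _ c a,
      christoffel_symm h hx _ e c, christoffel_symm h hx _ a e]
    ring
  simp only [riemLow, Matrix.mul_apply, ← Finset.sum_add_distrib, ← mul_add, hR, mul_zero,
    Finset.sum_const_zero]

/-- `curvHat` lists the form indices first, hence the exchanged pairs. -/
theorem curvHat_isCurvatureLike (hx : x ∈ Ω) (P : Ten ℂ) :
    IsCurvatureLike fun i j k l => curvHat g x P k l i j where
  antisymm_left i j k l := by
    simp only [curvHat, ← ct_neg]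
    congr 1
    ext e
    congr 1
    ext a
    exact antisymm_entries (hat_antisymm P (riemLow_antisymm h hx e a)) i j
  antisymm_right i j k l := by
    simp only [curvHat]
    rw [ct_comm P l k fun e a => hat P (riemLow g e a x) i j]
    simp only [← ct_neg]
    congr 1
    ext e
    congr 1
    ext a
    rw [riemLow_swap, hat_neg, Matrix.neg_apply]
  cyclic i j k l := by
    have e1 : ∀ k l j, curvHat g x P k l i j = ct P i fun b => ct P k fun e => ct P l fun a =>
        ct P j fun c => riemLow g e a x b c := by
      intro k l j
      rw [← ct_rotate]
      simp only [curvHat, ct_ct]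
    rw [e1, e1, e1]
    simp only [← ct_add]
    rw [show (0 : ℂ) = ct P i fun _ => 0 from (ct_zero P i).symm]
    congr 1
    ext b
    rw [ct_rotate P l j k fun e a c => riemLow g e a x b c,
      ← ct_rotate P k l j fun a c e => riemLow g e a x b c]
    simp only [← ct_add, riemLow_cyclic h hx, ct_zero]

/-- The frame components of the Ricci tensor. -/
theorem hat_ricci (hx : x ∈ Ω) {P : Ten ℂ} (hP : IsNullFrame (g x) (U x) P) (i j : Fin 4) :
    hat P (toC (ricci g x)) i j = 1 / 2 * (curvHat g x P 2 j 3 i + curvHat g x P 3 j 2 i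
      - curvHat g x P 0 j 1 i - curvHat g x P 1 j 0 i) := by
  have e1 : ∀ b d, toC (ricci g x) b d =
      ∑ a, ∑ m, (((g x)⁻¹ a m : ℝ) : ℂ) * riemLow g a d x m b := by
    intro b d
    have : ∀ a, riemM g a d x = toC (g x)⁻¹ * riemLow g a d x := fun a => by
      rw [riemLow, ← Matrix.mul_assoc, toC_inv_mul h hx, Matrix.one_mul]
    have e2 : toC (ricci g x) b d = ∑ a, riemM g a d x a b := by
      simp only [ricci, Matrix.map_apply, Matrix.of_apply, riemM]
      push_cast
      rfl
    rw [e2]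
    simp only [this]
    rfl
  have e3 : ∀ k l, ct P i (fun b => ct P j fun d => ct P k fun a => ct P l fun m =>
      riemLow g a d x m b) = curvHat g x P k j l i := by
    intro k l
    rw [ct_comm P i j fun b d => ct P k fun a => ct P l fun m => riemLow g a d x m b]
    simp only [← fun d => ct_rotate P k l i fun a m b => riemLow g a d x m b, ct_ct]
    rw [ct_comm P j k fun d a => hat P (riemLow g a d x) l i, curvHat]
  rw [← ct_ct]
  simp only [e1, hP.sum_inv, ct_sum, ct_mul_left, e3]
  simp only [Fin.sum_univ_four, nullInv_entries]
  ring

end Local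

/-- The frame components of the scalar curvature. -/
theorem scalar_eq {g U : Coords → Ten ℝ} {x : Coords} {P : Ten ℂ}
    (hP : IsNullFrame (g x) (U x) P) : ((scalar g x : ℝ) : ℂ) =
    1 / 2 * (hat P (toC (ricci g x)) 2 3 + hat P (toC (ricci g x)) 3 2
      - hat P (toC (ricci g x)) 0 1 - hat P (toC (ricci g x)) 1 0) := by
  have e1 : ((scalar g x : ℝ) : ℂ) =
      ∑ a, ∑ b, (((g x)⁻¹ a b : ℝ) : ℂ) * toC (ricci g x) a b := by
    rw [scalar]
    push_cast
    rfl
  refine e1.trans ((hP.sum_inv fun a b => toC (ricci g x) a b).trans ?_)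
  simp only [ct_ct, Fin.sum_univ_four, nullInv_entries]
  ring

/-- The frame components of the Weyl tensor. -/
def weylHat (g : Coords → Ten ℝ) (x : Coords) (P : Ten ℂ) (i j k l : Fin 4) : ℂ :=
  ct P i fun a => ct P j fun b => ct P k fun c => ct P l fun d => (weyl g x a b c d : ℂ)

theorem weylHat_eq {g U : Coords → Ten ℝ} {x : Coords} {P : Ten ℂ} (hP : IsNullFrame (g x) (U x) P)
    (i j k l : Fin 4) :
    weylHat g x P i j k l = curvHat g x P k l i j
      - 1 / 2 * (nullGram i k * hat P (toC (ricci g x)) j l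
        + nullGram j l * hat P (toC (ricci g x)) i k - nullGram i l * hat P (toC (ricci g x)) j k
        - nullGram j k * hat P (toC (ricci g x)) i l)
      + (scalar g x : ℂ) / 6 * (nullGram i k * nullGram j l - nullGram i l * nullGram j k) := by
  have e1 : ∀ a b c d, ((weyl g x a b c d : ℝ) : ℂ) = riemLow g c d x a b
      - 1 / 2 * (toC (g x) a c * toC (ricci g x) b d + toC (g x) b d * toC (ricci g x) a c
        - toC (g x) a d * toC (ricci g x) b c - toC (g x) b c * toC (ricci g x) a d)
      + (scalar g x : ℂ) / 6 * (toC (g x) a c * toC (g x) b d - toC (g x) a d * toC (g x) b c) := by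
    intro a b c d
    simp only [weyl, riemLow, Matrix.mul_apply, riemM, Matrix.of_apply, Matrix.map_apply]
    push_cast
    rfl
  have e2 : ct P i (fun a => ct P j fun b => ct P k fun c => ct P l fun d =>
      riemLow g c d x a b) = curvHat g x P k l i j := by
    simp only [← fun a => ct_rotate P k l j fun c d b => riemLow g c d x a b]
    rw [← fun f => ct_rotate P k l i f]
    simp only [curvHat, ct_ct]
  simp only [weylHat, e1, ct_add, ct_sub, ct_mul_left, ct_mul_right, ct_ct, hP.hat_metric, e2]

/-! ### Symmetries and trace of the Weyl tensor -/

section Local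

variable {g U : Coords → Ten ℝ} {Ω : Set Coords} {x : Coords} (h : IsLocalSpaceTime g U Ω)
include h

theorem hat_ricci_symm (hx : x ∈ Ω) {P : Ten ℂ} (hP : IsNullFrame (g x) (U x) P) (i j : Fin 4) :
    hat P (toC (ricci g x)) i j = hat P (toC (ricci g x)) j i := by
  have hp := (curvHat_isCurvatureLike h hx P).pair_symm
  simp only [hat_ricci h hx hP]
  linear_combination 1 / 2 * (hp 3 i 2 j + hp 2 i 3 j - hp 1 i 0 j - hp 0 i 1 j)

theorem weylHat_isCurvatureLike (hx : x ∈ Ω) {P : Ten ℂ} (hP : IsNullFrame (g x) (U x) P) :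
    IsCurvatureLike (weylHat g x P) := by
  have hR := curvHat_isCurvatureLike h hx P
  have hr := hat_ricci_symm h hx hP
  have hN := nullGram_symm
  constructor
  · intro i j k l
    rw [weylHat_eq hP, weylHat_eq hP]
    linear_combination hR.antisymm_left i j k l
  · intro i j k l
    rw [weylHat_eq hP, weylHat_eq hP]
    linear_combination hR.antisymm_right i j k l
  · intro i j k l
    rw [weylHat_eq hP, weylHat_eq hP, weylHat_eq hP, hr l j, hr k j, hr l k, hN l j, hN k j,
      hN l k]
    linear_combination hR.cyclic i j k l

theorem weylHat_trace (hx : x ∈ Ω) {P : Ten ℂ} (hP : IsNullFrame (g x) (U x) P) (i j : Fin 4) :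
    weylHat g x P 3 i 2 j + weylHat g x P 2 i 3 j - weylHat g x P 1 i 0 j
      - weylHat g x P 0 i 1 j = 0 := by
  have hr := hat_ricci h hx hP i j
  have hs := hat_ricci_symm h hx hP
  simp only [weylHat_eq hP, scalar_eq hP]
  generalize hat P (toC (ricci g x)) = r at *
  rw [hs 1 0, hs 3 2]
  fin_cases i <;> fin_cases j <;>
    simp only [Fin.zero_eta, Fin.mk_one, Fin.reduceFinMk, nullGram_entries] at hr ⊢ <;>
    linear_combination -2 * hr

end Local

/-! ### The Ricci equation and the closedness of `χ` in a frame -/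

section

variable {g U : Coords → Ten ℝ} {x : Coords} {P : Ten ℂ}

/-- With lowered indices, 𝒰 acts from the left and from the right with opposite signs, so the
commutator produces a sum of eigenvalues. It vanishes across the two null planes. -/
theorem hat_ricciCommutator (hP : IsNullFrame (g x) (U x) P) (i j : Fin 4) :
    hat P (ricciCommutator g U x) i j =
      kap * (sgn i + sgn j) * hat P (toC (ricci g x)) i j := by
  have e : hat P (ricciCommutator g U x) = hat P (toC (ricci g x)) * (kap • Matrix.diagonal sgn)
      + (kap • Matrix.diagonal sgn) * hat P (toC (ricci g x)) := by
    rw [ricciCommutator, dot_eq, dot_eq, hat_sub, hP.hat_mul, hP.hat_mul, Matrix.mul_assoc,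
      nullInv_mul_hat_canonicalSD hP, hat_canonicalSD_mul_nullInv hP, Matrix.neg_mul,
      sub_neg_eq_add]
  rw [e]
  simp only [Matrix.add_apply, Matrix.mul_smul, Matrix.smul_mul, Matrix.smul_apply,
    Matrix.mul_diagonal, Matrix.diagonal_mul, smul_eq_mul]
  ring

theorem ricciCommutator_eq_iff (hP : IsNullFrame (g x) (U x) P) :
    ricciCommutator g U x = (2 : ℂ) • tensorS g U x ↔ ∀ i j,
      kap * (sgn i + sgn j) * hat P (toC (ricci g x)) i j =
        hat P (tensorT g U x) i j + hat P (tensorT g U x) j i := by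
  have e : ∀ i j, hat P ((2 : ℂ) • tensorS g U x) i j =
      hat P (tensorT g U x) i j + hat P (tensorT g U x) j i := by
    intro i j
    rw [tensorS, smul_smul, hat_smul, hat_add, hat_transpose]
    simp only [Matrix.smul_apply, Matrix.add_apply, Matrix.transpose_apply, smul_eq_mul]
    ring
  constructor
  · intro hc i j
    rw [← hat_ricciCommutator hP, hc, e]
  · intro hc
    have : hat P (ricciCommutator g U x) = hat P ((2 : ℂ) • tensorS g U x) := by
      ext i j
      rw [e, hat_ricciCommutator hP, hc]
    exact hP.hat_inj this

end

section Local

variable {g U : Coords → Ten ℝ} {Ω : Set Coords} {x : Coords} (h : IsLocalSpaceTime g U Ω)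
include h

/-- The components of `[Ric, 𝒰] = 2S` in the two isotropic planes of `𝒰` are identities. -/
theorem hat_ricci_same_sign (hx : x ∈ Ω) {P : Ten ℂ} (hP : IsNullFrame (g x) (U x) P)
    (hv : ∀ y ∈ Ω, UmbilicalPlaneAt g (projV g U) (projH g U) y)
    (hh : ∀ y ∈ Ω, UmbilicalPlaneAt g (projH g U) (projV g U) y) (i j : Fin 4)
    (hij : sgn i = sgn j) :
    kap * (sgn i + sgn j) * hat P (toC (ricci g x)) i j =
      hat P (tensorT g U x) i j + hat P (tensorT g U x) j i := by
  have hK := curvHat_isCurvatureLike h hx P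
  have hI := ricci_identity_canonicalSD h hx hP hv hh
  have hr := hat_ricci h hx hP
  have a := hK.antisymm_left
  have b := hK.antisymm_right
  have p := hK.pair_symm
  clear hK
  generalize hat P (tensorT g U x) = t at *
  generalize curvHat g x P = C at *
  have z : ∀ i k l, C k l i i = 0 := fun i k l => by linear_combination 1 / 2 * a i i k l
  have z' : ∀ i k l, C i i k l = 0 := fun i k l => by linear_combination 1 / 2 * b k l i i
  -- Up to curvature symmetries, the Ricci components inside a null plane only involve curvature
  -- with a pair 02 or 13, which the Ricci identity for 𝒰 provides: two instances off the diagonal,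
  -- one on it.
  have h02 : kap * (sgn 0 + sgn 2) * hat P (toC (ricci g x)) 0 2 = t 0 2 + t 2 0 := by
    have i1 := hI 3 2 0 2 (by simp)
    have i2 := hI 1 0 0 2 (by simp)
    simp only [nullGram_entries, sgn_entries] at i1 i2
    simp only [hr, sgn_entries, z, z']
    linear_combination -1 / 2 * i1 - 1 / 2 * i2 + kap * a 2 0 3 2 - kap * p 1 0 0 2
  have h13 : kap * (sgn 1 + sgn 3) * hat P (toC (ricci g x)) 1 3 = t 1 3 + t 3 1 := by
    have i1 := hI 2 3 1 3 (by simp)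
    have i2 := hI 0 1 1 3 (by simp)
    simp only [nullGram_entries, sgn_entries] at i1 i2
    simp only [hr, sgn_entries, z, z']
    linear_combination -1 / 2 * i1 - 1 / 2 * i2 - kap * a 3 1 2 3 + kap * p 0 1 1 3
  have h00 : kap * (sgn 0 + sgn 0) * hat P (toC (ricci g x)) 0 0 = t 0 0 + t 0 0 := by
    have i1 := hI 3 0 0 2 (by simp)
    simp only [nullGram_entries, sgn_entries] at i1
    simp only [hr, sgn_entries, z, z']
    linear_combination -i1 + kap * (a 3 0 2 0 + p 2 0 3 0 + p 0 2 3 0 + b 3 0 2 0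
      - p 0 3 2 0 - b 2 0 0 3 + a 2 0 3 0)
  have h22 : kap * (sgn 2 + sgn 2) * hat P (toC (ricci g x)) 2 2 = t 2 2 + t 2 2 := by
    have i1 := hI 1 2 0 2 (by simp)
    simp only [nullGram_entries, sgn_entries] at i1
    simp only [hr, sgn_entries, z, z']
    linear_combination -i1 + kap * p 0 2 1 2
  have h11 : kap * (sgn 1 + sgn 1) * hat P (toC (ricci g x)) 1 1 = t 1 1 + t 1 1 := by
    have i1 := hI 2 1 1 3 (by simp)
    simp only [nullGram_entries, sgn_entries] at i1
    simp only [hr, sgn_entries, z, z']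
    linear_combination -i1 - kap * (2 * a 3 1 2 1 + p 2 1 3 1)
  have h33 : kap * (sgn 3 + sgn 3) * hat P (toC (ricci g x)) 3 3 = t 3 3 + t 3 3 := by
    have i1 := hI 0 3 1 3 (by simp)
    simp only [nullGram_entries, sgn_entries] at i1
    simp only [hr, sgn_entries, z, z']
    linear_combination -i1 + kap * p 0 3 1 3
  have hs := hat_ricci_symm h hx hP
  clear hI hr p a b z z'
  simp only [sgn_entries] at h00 h11 h22 h33 h02 h13
  fin_cases i <;> fin_cases j <;>
    simp only [Fin.zero_eta, Fin.mk_one, Fin.reduceFinMk, sgn_entries] at hij ⊢ <;>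
    first
    | (norm_num at hij; done)
    | assumption
    | linear_combination h02 + kap * 2 * hs 2 0
    | linear_combination h13 - kap * 2 * hs 3 1

/-- The components of the self-dual Weyl tensor off the plane of `𝒰`. -/
theorem weylHat_of_umbilical (hx : x ∈ Ω) {P : Ten ℂ} (hP : IsNullFrame (g x) (U x) P)
    (hv : ∀ y ∈ Ω, UmbilicalPlaneAt g (projV g U) (projH g U) y)
    (hh : ∀ y ∈ Ω, UmbilicalPlaneAt g (projH g U) (projV g U) y) :
    weylHat g x P 0 2 0 2 = 0 ∧ weylHat g x P 1 3 1 3 = 0 ∧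
    2 * kap * weylHat g x P 0 2 0 1 = hat P (tensorT g U x) 0 2 - hat P (tensorT g U x) 2 0 ∧
    2 * kap * weylHat g x P 1 3 0 1 = hat P (tensorT g U x) 1 3 - hat P (tensorT g U x) 3 1 := by
  have hI := ricci_identity_canonicalSD h hx hP hv hh
  have r02 := hat_ricci_same_sign h hx hP hv hh 0 2 (by simp only [sgn_entries])
  have r13 := hat_ricci_same_sign h hx hP hv hh 1 3 (by simp only [sgn_entries])
  have hs := hat_ricci_symm h hx hP
  simp only [weylHat_eq hP]
  have i1 := hI 0 2 0 2 (by simp)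
  have i2 := hI 1 3 1 3 (by simp)
  have i3 := hI 0 1 0 2 (by simp)
  have i4 := hI 0 1 1 3 (by simp)
  clear hI hv hh
  simp only [nullGram_entries, sgn_entries] at *
  refine ⟨?_, ?_, ?_, ?_⟩
  · refine (mul_eq_zero.1 ?_).resolve_left kap_ne_zero
    linear_combination 1 / 2 * i1
  · refine (mul_eq_zero.1 ?_).resolve_left kap_ne_zero
    linear_combination -1 / 2 * i2
  -- The Weyl tensor differs from the curvature here by a Ricci component inside a null plane, which
  -- `hat_ricci_same_sign` replaces by the symmetric part of T. The antisymmetric part remains.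
  · linear_combination i3 - r02 - 2 * kap * hs 2 0
  · linear_combination -i4 - r13 + 2 * kap * hs 3 1

/-- Closedness of `χ` is the equation `[Ric, 𝒰] = 2S` together with the alignment of `𝒰` with the
Weyl tensor. -/
theorem chi_closed_iff_ricciCommutator (hx : x ∈ Ω) {P : Ten ℂ}
    (hP : IsNullFrame (g x) (U x) P)
    (hv : ∀ y ∈ Ω, UmbilicalPlaneAt g (projV g U) (projH g U) y)
    (hh : ∀ y ∈ Ω, UmbilicalPlaneAt g (projH g U) (projV g U) y) :
    (∀ a b, pd a (fun y => chi g U y b) x = pd b (fun y => chi g U y a) x) ↔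
    (weylHat g x P 0 2 0 1 = 0 ∧ weylHat g x P 1 3 0 1 = 0) ∧
      ricciCommutator g U x = (2 : ℂ) • tensorS g U x := by
  obtain ⟨-, -, ha, hb⟩ := weylHat_of_umbilical h hx hP hv hh
  have hR := hat_ricci_same_sign h hx hP hv hh
  rw [chi_closed_iff h hx hP (hv x hx) (hh x hx), ricciCommutator_eq_iff hP]
  generalize hat P (tensorT g U x) = t at *
  have hk : 2 * kap ≠ 0 := mul_ne_zero two_ne_zero kap_ne_zero
  constructor
  · intro hc
    refine ⟨⟨?_, ?_⟩, fun i j => ?_⟩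
    · have := hc 0 2
      simp only [sgn_entries] at this
      refine (mul_eq_zero.1 ?_).resolve_left hk
      linear_combination ha + this
    · have := hc 1 3
      simp only [sgn_entries] at this
      refine (mul_eq_zero.1 ?_).resolve_left hk
      linear_combination hb - this
    -- Across the planes the commutator is zero and the equation reads T_ij + T_ji = 0, which is
    -- closedness there.
    · by_cases hij : sgn i = sgn j
      · exact hR i j hij
      · have := hc i j
        revert hij this
        fin_cases i <;> fin_cases j <;>
          simp only [Fin.zero_eta, Fin.mk_one, Fin.reduceFinMk, sgn_entries] <;>
          intro hij this <;>
          first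
          | exact absurd trivial hij
          | linear_combination this
          | linear_combination -this
  · rintro ⟨⟨ha0, hb0⟩, hc⟩ i j
    rw [ha0, mul_zero] at ha
    rw [hb0, mul_zero] at hb
    have := hc i j
    fin_cases i <;> fin_cases j <;>
      simp only [Fin.zero_eta, Fin.mk_one, Fin.reduceFinMk, sgn_entries] at this ⊢ <;>
      first
      | ring1
      | linear_combination ha
      | linear_combination -ha
      | linear_combination hb
      | linear_combination -hb
      | linear_combination this
      | linear_combination -this

end Local

/-! ### The Weyl tensor on the self-dual bivectors -/

/-- A curvature-like tensor which is trace-free with respect to `nullGram`. -/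
structure IsWeylLike (W : Fin 4 → Fin 4 → Fin 4 → Fin 4 → ℂ) : Prop extends
    IsCurvatureLike W where
  trace : ∀ i j, W 3 i 2 j + W 2 i 3 j - W 1 i 0 j - W 0 i 1 j = 0

namespace IsWeylLike

variable {W : Fin 4 → Fin 4 → Fin 4 → Fin 4 → ℂ} (hW : IsWeylLike W)
include hW

theorem zero_right (i j k : Fin 4) : W i j k k = 0 := by
  linear_combination 1 / 2 * hW.antisymm_right i j k k

/-- The components of a Weyl-like tensor which vanish, or are expressed by others, because of the
vanishing of the trace. -/
theorem trace_entries :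
    (W 0 2 0 3 = 0 ∧ W 1 2 1 3 = 0 ∧ W 0 2 1 2 = 0 ∧ W 0 3 1 3 = 0) ∧
    (W 0 2 2 3 = -W 0 2 0 1 ∧ W 1 3 2 3 = -W 1 3 0 1 ∧ W 0 3 2 3 = W 0 3 0 1 ∧
      W 1 2 2 3 = W 1 2 0 1) ∧
    W 0 1 0 1 = -(W 0 2 1 3 + W 0 3 1 2) ∧ W 2 3 2 3 = -(W 0 2 1 3 + W 0 3 1 2) ∧
    W 0 1 2 3 = W 0 2 1 3 - W 0 3 1 2 := by
  have t := hW.trace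
  have a := hW.antisymm_left
  have b := hW.antisymm_right
  have p := hW.pair_symm
  have c := hW.cyclic 0 1 2 3
  refine ⟨⟨?_, ?_, ?_, ?_⟩, ⟨?_, ?_, ?_, ?_⟩, ?_, ?_, ?_⟩
  · have := t 0 0
    grind
  · have := t 1 1
    grind
  · have := t 2 2
    grind
  · have := t 3 3
    grind
  · have := t 0 2
    grind
  · have := t 1 3
    grind
  · have := t 0 3
    grind
  · have := t 1 2
    grind
  · have := t 0 1
    grind
  · have := t 2 3
    grind
  · grind

end IsWeylLike

theorem eq_zero_of_antisymm {f : Fin 4 → Fin 4 → ℂ} (hf : ∀ i j, f i j = -f j i)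
    (h01 : f 0 1 = 0) (h02 : f 0 2 = 0) (h03 : f 0 3 = 0) (h12 : f 1 2 = 0) (h13 : f 1 3 = 0)
    (h23 : f 2 3 = 0) (i j : Fin 4) : f i j = 0 := by
  have ht : Matrix.transpose f = -f := by
    ext i j
    exact hf j i
  have h0 := antisymm_ext (F := f) (H := 0) ht (by simp) h01 h02 h03 h12 h13 h23
  exact congrFun (congrFun h0 i) j

/-- A trace-free curvature-like tensor with vanishing self-dual and antiself-dual components. -/
theorem IsWeylLike.eq_zero {W : Fin 4 → Fin 4 → Fin 4 → Fin 4 → ℂ} (hW : IsWeylLike W)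
    (h1 : W 0 2 0 2 = 0) (h2 : W 1 3 1 3 = 0) (h3 : W 0 2 0 1 = 0) (h4 : W 1 3 0 1 = 0)
    (h5 : W 0 2 1 3 = 0) (h1' : W 0 3 0 3 = 0) (h2' : W 1 2 1 2 = 0) (h3' : W 0 3 0 1 = 0)
    (h4' : W 1 2 0 1 = 0) (h5' : W 0 3 1 2 = 0) (i j k l : Fin 4) : W i j k l = 0 := by
  obtain ⟨⟨a1, a2, a3, a4⟩, ⟨b1, b2, b3, b4⟩, c1, c2, c3⟩ := hW.trace_entries
  have p := hW.pair_symm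
  have key := fun i j => eq_zero_of_antisymm (f := W i j) (hW.antisymm_right i j)
  refine eq_zero_of_antisymm (f := fun i j => W i j k l) (fun i j => hW.antisymm_left i j k l)
    ?_ ?_ ?_ ?_ ?_ ?_ i j <;> refine key _ _ ?_ ?_ ?_ ?_ ?_ ?_ k l <;> grind

theorem hat_zero (P : Ten ℂ) : hat P 0 = 0 := by rw [hat, Matrix.mul_zero, Matrix.zero_mul]

theorem ct_star {P : Ten ℂ} (hP : ∀ a i, star (P a i) = P a (conjIdx i)) (i : Fin 4)
    (f : Fin 4 → ℂ) : star (ct P i f) = ct P (conjIdx i) fun a => star (f a) := by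
  simp only [ct, star_sum, star_mul', hP]

theorem ct_inj₄ {P : Ten ℂ} (hP : P.det ≠ 0) {K L : Fin 4 → Fin 4 → Fin 4 → Fin 4 → ℂ}
    (H : ∀ i j k l, ct P i (fun a => ct P j fun b => ct P k fun c => ct P l fun d => K a b c d) =
      ct P i (fun a => ct P j fun b => ct P k fun c => ct P l fun d => L a b c d)) : K = L := by
  funext a b c
  refine ct_inj hP fun l => ?_
  exact congrFun (congrFun (congrFun (ct_inj₃ hP
    (K := fun a b c => ct P l fun d => K a b c d) (L := fun a b c => ct P l fun d => L a b c d)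
    fun i j k => H i j k l) a) b) c

/-- Reality of the Weyl tensor. Conjugation carries its self-dual components to the antiself-dual
ones. -/
theorem star_weylHat (g : Coords → Ten ℝ) (x : Coords) {P : Ten ℂ}
    (hP : ∀ a i, star (P a i) = P a (conjIdx i)) (i j k l : Fin 4) :
    star (weylHat g x P i j k l) =
      weylHat g x P (conjIdx i) (conjIdx j) (conjIdx k) (conjIdx l) := by
  simp only [weylHat, ct_star hP, Complex.star_def, Complex.conj_ofReal]

theorem weyl_eq_zero {g : Coords → Ten ℝ} {x : Coords} {P : Ten ℂ} (hP : P.det ≠ 0)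
    (h : ∀ i j k l, weylHat g x P i j k l = 0) (a b c d : Fin 4) : weyl g x a b c d = 0 := by
  have := ct_inj₄ hP (K := fun a b c d => (weyl g x a b c d : ℂ)) (L := fun _ _ _ _ => 0)
    fun i j k l => by
      simp only [ct_zero]
      exact h i j k l
  exact_mod_cast congrFun (congrFun (congrFun (congrFun this a) b) c) d

namespace IsNullFrame

variable {g U : Coords → Ten ℝ} {x : Coords} {P : Ten ℂ} (hP : IsNullFrame (g x) (U x) P)
include hP

theorem hat_weylMap (F : Ten ℂ) (i j : Fin 4) : hat P (weylMap g x F) i j =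
    1 / 2 * ∑ k, ∑ l, weylHat g x P i j k l * raised P F k l := by
  have e1 : ∀ a b, weylMap g x F a b = 1 / 2 * ∑ c, ∑ d, ∑ m, ∑ n,
      (((g x)⁻¹ c m : ℝ) : ℂ) * (((g x)⁻¹ d n : ℝ) : ℂ) * ((weyl g x a b c d : ℂ) * F m n) := by
    intro a b
    simp only [weylMap, Matrix.of_apply, Complex.real_smul, Finset.mul_sum]
    push_cast
    refine Finset.sum_congr rfl fun _ _ => Finset.sum_congr rfl fun _ _ =>
      Finset.sum_congr rfl fun _ _ => Finset.sum_congr rfl fun _ _ => by ring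
  rw [← ct_ct]
  simp only [e1, fun a b => hP.sum_inv₂ (fun c d => (weyl g x a b c d : ℂ)) F, ct_mul_left, ct_sum,
    ct_mul_right]
  rfl

/-- The three components 02, 13 and 01 are free coordinates on the self-dual bivectors; the other
entries of `f` are dictated by `isSelfDual_iff`. -/
theorem exists_isSelfDual (X Y Z : ℂ) : ∃ F, IsSelfDual (g x) F ∧
    hat P F 0 2 = X ∧ hat P F 1 3 = Y ∧ hat P F 0 1 = Z := by
  have hu : IsUnit P.det := hP.det_frame_ne_zero.isUnit
  have hut : IsUnit P.transpose.det := by rwa [Matrix.det_transpose]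
  let f : Ten ℂ := !![0, Z, X, 0; -Z, 0, 0, Y; -X, 0, 0, -Z; 0, -Y, Z, 0]
  have e : hat P (P.transpose⁻¹ * f * P⁻¹) = f := by
    rw [hat, ← Matrix.mul_assoc, ← Matrix.mul_assoc, Matrix.mul_nonsing_inv _ hut, Matrix.one_mul,
      Matrix.nonsing_inv_mul_cancel_right _ _ hu]
  have hft : f.transpose = -f := by
    ext i j
    fin_cases i <;> fin_cases j <;> simp [f]
  refine ⟨P.transpose⁻¹ * f * P⁻¹, (hP.isSelfDual_iff _).2 ⟨?_, ?_⟩, ?_⟩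
  · refine hP.hat_inj (show hat P _ = hat P _ from ?_)
    rw [hat_transpose, hat_neg, e, hft]
  · rw [e]
    exact ⟨rfl, rfl, rfl⟩
  · rw [e]
    exact ⟨rfl, rfl, rfl⟩

theorem isSelfDual_sdProj {F : Ten ℂ} (hF : F.transpose = -F) :
    IsSelfDual (g x) (sdProj (g x) F) := by
  rw [hP.isSelfDual_iff]
  refine ⟨?_, ?_⟩
  · rw [sdProj, Matrix.transpose_smul, Matrix.transpose_sub, Matrix.transpose_smul,
      hodge_transpose, hF, smul_neg, ← neg_sub', smul_neg]
  · simp only [hP.hat_sdProj hF, hodgeHat, Matrix.of_apply, Matrix.cons_val]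
    have hI := Complex.I_mul_I
    refine ⟨?_, ?_, ?_⟩
    · linear_combination 1 / 2 * hat P F 0 3 * hI
    · linear_combination 1 / 2 * hat P F 1 2 * hI
    · linear_combination 1 / 2 * (hat P F 2 3 + hat P F 0 1) * hI

end IsNullFrame

/-! ### The self-dual Weyl endomorphism and type D -/

section Local

variable {g U : Coords → Ten ℝ} {Ω : Set Coords} {x : Coords} (h : IsLocalSpaceTime g U Ω)
include h

theorem weylHat_isWeylLike (hx : x ∈ Ω) {P : Ten ℂ} (hP : IsNullFrame (g x) (U x) P) :
    IsWeylLike (weylHat g x P) where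
  toIsCurvatureLike := weylHat_isCurvatureLike h hx hP
  trace := weylHat_trace h hx hP

theorem weylMap_transpose (hx : x ∈ Ω) {P : Ten ℂ} (hP : IsNullFrame (g x) (U x) P) (F : Ten ℂ) :
    (weylMap g x F).transpose = -weylMap g x F := by
  refine hP.hat_inj (show hat P _ = hat P _ from ?_)
  rw [hat_transpose, hat_neg]
  ext i j
  rw [Matrix.transpose_apply, Matrix.neg_apply, hP.hat_weylMap, hP.hat_weylMap]
  simp only [(weylHat_isWeylLike h hx hP).antisymm_left j i, neg_mul, Finset.sum_neg_distrib,
    mul_neg]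

theorem isSelfDual_sdWeyl (hx : x ∈ Ω) {P : Ten ℂ} (hP : IsNullFrame (g x) (U x) P) (F : Ten ℂ) :
    IsSelfDual (g x) (sdWeyl g x F) :=
  hP.isSelfDual_sdProj (weylMap_transpose h hx hP _)

/-- The self-dual Weyl tensor in terms of the components of the self-dual bivectors. -/
theorem hat_sdWeyl (hx : x ∈ Ω) {P : Ten ℂ} (hP : IsNullFrame (g x) (U x) P)
    {F : Ten ℂ} (hF : IsSelfDual (g x) F) :
    hat P (sdWeyl g x F) 0 2 = -1 / 4 * (weylHat g x P 0 2 1 3 * hat P F 0 2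
      + weylHat g x P 0 2 0 2 * hat P F 1 3 + 2 * weylHat g x P 0 2 0 1 * hat P F 0 1) ∧
    hat P (sdWeyl g x F) 1 3 = -1 / 4 * (weylHat g x P 1 3 1 3 * hat P F 0 2
      + weylHat g x P 0 2 1 3 * hat P F 1 3 + 2 * weylHat g x P 1 3 0 1 * hat P F 0 1) ∧
    hat P (sdWeyl g x F) 0 1 = -1 / 4 * (weylHat g x P 1 3 0 1 * hat P F 0 2
      + weylHat g x P 0 2 0 1 * hat P F 1 3 - 2 * weylHat g x P 0 2 1 3 * hat P F 0 1) := by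
  have hW := weylHat_isWeylLike h hx hP
  obtain ⟨-, ⟨b1, b2, -, -⟩, c1, c2, c3⟩ := hW.trace_entries
  have p := hW.pair_symm
  have b := hW.antisymm_right
  have z := hW.zero_right
  have e := hP.hat_sdProj (weylMap_transpose h hx hP F)
  obtain ⟨hF', f03, f12, f23⟩ := (hP.isSelfDual_iff F).1 hF
  have hf := antisymm_entries (hat_antisymm P hF')
  have key : ∀ i j, hat P (weylMap g x F) i j = -1 / 4 * (hat P F 0 1 * weylHat g x P i j 0 1
      + hat P F 1 3 * weylHat g x P i j 0 2 + hat P F 0 2 * weylHat g x P i j 1 3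
      - hat P F 0 1 * weylHat g x P i j 2 3) := by
    intro i j
    rw [hP.hat_weylMap]
    simp only [Fin.sum_univ_four, raised_entries, z, hf 1 0, hf 2 0, hf 3 0, hf 2 1, hf 3 1,
      hf 3 2, f03, f12, f23, b i j 1 0, b i j 2 0, b i j 3 0, b i j 2 1, b i j 3 1, b i j 3 2]
    ring
  have hI := Complex.I_mul_I
  rw [sdWeyl, sdProj_of_isSelfDual hF]
  simp only [e, hodgeHat, Matrix.of_apply, Matrix.cons_val]
  refine ⟨?_, ?_, ?_⟩
  · have k := key 0 2
    linear_combination k - 1 / 2 * hat P (weylMap g x F) 0 2 * hI + 1 / 4 * hat P F 0 1 * b1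
  · have k := key 1 3
    linear_combination k - 1 / 2 * hat P (weylMap g x F) 1 3 * hI + 1 / 4 * hat P F 0 1 * b2
      - 1 / 4 * hat P F 1 3 * p 1 3 0 2
  · have k := key 0 1
    have k' := key 2 3
    linear_combination 1 / 2 * k - 1 / 2 * k' + 1 / 2 * hat P (weylMap g x F) 2 3 * hI
      - 1 / 8 * hat P F 0 1 * (c1 + c2 - c3 - p 2 3 0 1 - c3) - 1 / 8 * hat P F 1 3 * (p 0 1 0 2
      - p 2 3 0 2 - b1) - 1 / 8 * hat P F 0 2 * (p 0 1 1 3 - p 2 3 1 3 - b2)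

/-- A form of the type D condition when the plane of `𝒰` is isotropic for the Weyl tensor. -/
theorem typeDAt_iff (hx : x ∈ Ω) {P : Ten ℂ} (hP : IsNullFrame (g x) (U x) P)
    (h02 : weylHat g x P 0 2 0 2 = 0) (h13 : weylHat g x P 1 3 1 3 = 0)
    (hne : ∃ a b c d, weyl g x a b c d ≠ 0) :
    TypeDAt g x ↔ weylHat g x P 0 2 0 1 = 0 ∧ weylHat g x P 1 3 0 1 = 0 := by
  have hM := fun {F} => hat_sdWeyl h hx hP (F := F)
  have hS := isSelfDual_sdWeyl h hx hP
  simp only [h02, h13, zero_mul, add_zero, zero_add] at hM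
  constructor
  · rintro ⟨ρ, -, hρ⟩
    have key : ∀ F, IsSelfDual (g x) F → ∀ i j, hat P (sdWeyl g x (sdWeyl g x F)) i j +
        ρ * hat P (sdWeyl g x F) i j - 2 * ρ ^ 2 * hat P F i j = 0 := by
      intro F hF i j
      have := congrArg (fun A => hat P A i j) (hρ F hF)
      simp only [hat_add, hat_sub, hat_smul] at this
      refine this.trans ?_
      rw [hat_zero, Matrix.zero_apply]
    constructor
    -- For the bivector with only a 13 component, F and 𝒲F have no 02 component, while 𝒲²F has
    -- W_{0201}²/8. The polynomial identity therefore forces W_{0201} = 0; the other case is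
    -- symmetric.
    · obtain ⟨F, hF, f1, f2, f3⟩ := hP.exists_isSelfDual 0 1 0
      have := key F hF 0 2
      obtain ⟨e1, e2, e3⟩ := hM hF
      rw [(hM (hS F)).1, e1, e3, f1, f2, f3] at this
      have : weylHat g x P 0 2 0 1 ^ 2 = 0 := by linear_combination 8 * this
      exact pow_eq_zero_iff two_ne_zero |>.1 this
    · obtain ⟨F, hF, f1, f2, f3⟩ := hP.exists_isSelfDual 1 0 0
      have := key F hF 1 3
      obtain ⟨e1, e2, e3⟩ := hM hF
      rw [(hM (hS F)).2.1, e2, e3, f1, f2, f3] at this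
      have : weylHat g x P 1 3 0 1 ^ 2 = 0 := by linear_combination 8 * this
      exact pow_eq_zero_iff two_ne_zero |>.1 this
  · rintro ⟨ha, hb⟩
    simp only [ha, hb, mul_zero, zero_mul, add_zero, zero_sub] at hM
    -- 𝒲 is now diagonal: ρ is its eigenvalue on the components 02 and 13, and -2ρ the one on 01.
    refine ⟨-1 / 4 * weylHat g x P 0 2 1 3, fun he => ?_, fun F hF => ?_⟩
    · have he : weylHat g x P 0 2 1 3 = 0 := (mul_eq_zero.1 he).resolve_left (by norm_num)
      -- If ρ = 0, all self-dual components vanish, by conjugation the antiself-dual ones too, and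
      -- the Weyl tensor would be zero.
      have hs : ∀ i j k l, weylHat g x P i j k l = 0 →
          weylHat g x P (conjIdx i) (conjIdx j) (conjIdx k) (conjIdx l) = 0 := by
        intro i j k l h0
        rw [← star_weylHat g x hP.conj, h0, star_zero]
      obtain ⟨a, b, c, d, habcd⟩ := hne
      exact habcd (weyl_eq_zero hP.det_frame_ne_zero ((weylHat_isWeylLike h hx hP).eq_zero h02 h13
        ha hb he (hs 0 2 0 2 h02) (hs 1 3 1 3 h13) (hs 0 2 0 1 ha) (hs 1 3 0 1 hb)
        (hs 0 2 1 3 he)) a b c d)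
    · obtain ⟨e1, e2, e3⟩ := hM hF
      obtain ⟨k1, k2, k3⟩ := hM (hS F)
      obtain ⟨t0, m1, m2, m3⟩ := (hP.isSelfDual_iff _).1 hF
      obtain ⟨t1, n1, n2, n3⟩ := (hP.isSelfDual_iff _).1 (hS F)
      obtain ⟨t2, q1, q2, q3⟩ := (hP.isSelfDual_iff _).1 (hS (sdWeyl g x F))
      refine hP.hat_inj (show hat P _ = hat P _ from ?_)
      simp only [hat_add, hat_sub, hat_smul, hat_zero]
      refine antisymm_ext ?_ ?_ ?_ ?_ ?_ ?_ ?_ ?_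
      · simp only [Matrix.transpose_add, Matrix.transpose_sub, Matrix.transpose_smul,
          hat_antisymm P t0, hat_antisymm P t1, hat_antisymm P t2]
        module
      · rw [Matrix.transpose_zero, neg_zero]
      all_goals
        simp only [Matrix.add_apply, Matrix.sub_apply, Matrix.smul_apply, smul_eq_mul,
          Matrix.zero_apply, m1, m2, m3, n1, n2, n3, q1, q2, q3, k1, k2, k3, e1, e2, e3]
        ring

/-- The closedness of `χ` at a point is equivalent to the two algebraic conditions. -/
theorem chi_closed_iff_typeD (hx : x ∈ Ω)
    (hv : ∀ y ∈ Ω, UmbilicalPlaneAt g (projV g U) (projH g U) y)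
    (hh : ∀ y ∈ Ω, UmbilicalPlaneAt g (projH g U) (projV g U) y)
    (hne : ∃ a b c d, weyl g x a b c d ≠ 0) :
    (∀ a b, pd a (fun y => chi g U y b) x = pd b (fun y => chi g U y a) x) ↔
      TypeDAt g x ∧ ricciCommutator g U x = (2 : ℂ) • tensorS g U x := by
  obtain ⟨P, hP⟩ := h.exists_frame x hx
  obtain ⟨h02, h13, -, -⟩ := weylHat_of_umbilical h hx hP hv hh
  rw [chi_closed_iff_ricciCommutator h hx hP hv hh, typeDAt_iff h hx hP h02 h13 hne]

end Local

/-! ### The Poincaré lemma -/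

theorem fderiv_eq_sum_pd (f : Coords → ℂ) (x u : Coords) :
    fderiv ℝ f x u = ∑ i, (u i : ℂ) * pd i f x := by
  have hu : u = ∑ i, u i • EuclideanSpace.single i (1 : ℝ) := by
    ext j
    simp [Finset.sum_apply, Pi.single_apply]
  conv_lhs => rw [hu]
  simp only [map_sum, map_smul, pd, Complex.real_smul]

/-- The 1-form with components `w`. -/
def oneForm (w : Coords → Fin 4 → ℂ) (y : Coords) : Coords →L[ℝ] ℂ :=
  ∑ b, (EuclideanSpace.proj b : Coords →L[ℝ] ℝ).smulRight (w y b)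

theorem oneForm_apply (w : Coords → Fin 4 → ℂ) (y v : Coords) :
    oneForm w y v = ∑ b, (v b : ℂ) * w y b := by
  simp [oneForm]

theorem oneForm_single (w : Coords → Fin 4 → ℂ) (y : Coords) (a : Fin 4) :
    oneForm w y (EuclideanSpace.single a 1) = w y a := by
  rw [oneForm_apply, Finset.sum_eq_single a]
  · simp
  · intro b _ hb
    simp [hb]
  · simp

theorem VecSmooth.oneForm {w : Coords → Fin 4 → ℂ} {Ω : Set Coords} (hw : VecSmooth w Ω) :
    ContDiffOn ℝ ∞ (oneForm w) Ω :=
  ContDiffOn.sum fun b _ => (ContinuousLinearMap.smulRightL ℝ Coords ℂ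
    (EuclideanSpace.proj b : Coords →L[ℝ] ℝ)).contDiff.comp_contDiffOn (hw b)

/-- A closed 1-form is locally exact. -/
theorem exists_primitive {w : Coords → Fin 4 → ℂ} {Ω : Set Coords} (hΩ : IsOpen Ω)
    (hw : VecSmooth w Ω)
    (hc : ∀ y ∈ Ω, ∀ a b, pd a (fun z => w z b) y = pd b (fun z => w z a) y)
    {x : Coords} (hx : x ∈ Ω) : ∃ N : Set Coords, IsOpen N ∧ x ∈ N ∧ N ⊆ Ω ∧
      ∃ f : Coords → ℂ, ContDiffOn ℝ ∞ f N ∧ ∀ y ∈ N, ∀ a, pd a f y = w y a := by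
  obtain ⟨r, hr, hN⟩ := Metric.isOpen_iff.1 hΩ x hx
  have hω : ContDiffOn ℝ ∞ (oneForm w) (Metric.ball x r) := hw.oneForm.mono hN
  have hd : ∀ y ∈ Metric.ball x r, ∀ u v, fderiv ℝ (oneForm w) y u v =
      ∑ a, ∑ b, (u a : ℂ) * (v b : ℂ) * pd a (fun z => w z b) y := by
    intro y hy u v
    have h1 : HasFDerivAt (fun z => oneForm w z v) ((fderiv ℝ (oneForm w) y).flip v) y := by
      have := (ContDiffOn.diffAt hω Metric.isOpen_ball hy).hasFDerivAt.clm_apply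
        (hasFDerivAt_const v y)
      simpa using this
    have h2 : fderiv ℝ (oneForm w) y u v = fderiv ℝ (fun z => oneForm w z v) y u := by
      rw [h1.fderiv]
      rfl
    have hdw := fun b => hw.diffAt hΩ (hN hy) b
    rw [h2, fderiv_eq_sum_pd]
    refine Finset.sum_congr rfl fun a _ => ?_
    simp only [oneForm_apply]
    rw [pd_sum _ _ fun b _ => (hdw b).const_mul _, Finset.mul_sum]
    exact Finset.sum_congr rfl fun b _ => by rw [pd_const_mul a _ (hdw b), mul_assoc]
  -- Closedness is symmetry of the derivative of the 1-form, which on a convex set gives a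
  -- primitive. The primitive is smooth because its derivative is the smooth form itself.
  obtain ⟨f, hf⟩ := (convex_ball x r).exists_forall_hasFDerivAt_of_fderiv_symmetric
    Metric.isOpen_ball (hω.differentiableOn (by simp)) fun y hy u v => by
      rw [hd y hy, hd y hy, Finset.sum_comm]
      refine Finset.sum_congr rfl fun a _ => Finset.sum_congr rfl fun b _ => ?_
      rw [hc y (hN hy) b a, mul_comm (u b : ℂ)]
  refine ⟨Metric.ball x r, Metric.isOpen_ball, Metric.mem_ball_self hr, hN, f, ?_, ?_⟩
  · refine (contDiffOn_infty_iff_fderiv_of_isOpen Metric.isOpen_ball).2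
      ⟨fun y hy => (hf y hy).differentiableAt.differentiableWithinAt, ?_⟩
    exact hω.congr fun y hy => (hf y hy).fderiv
  · intro y hy a
    rw [pd, (hf y hy).fderiv, oneForm_single]

/-! ### The Maxwell equations -/

theorem codiff_eq_covM (g : Coords → Ten ℝ) (F : Coords → Ten ℂ) (x : Coords) (b : Fin 4) :
    codiff g F x b = -∑ a, ∑ c, (((g x)⁻¹ a c : ℝ) : ℂ) * covM g F c x a b := by
  simp only [codiff, Complex.real_smul, cov₂_eq_covM]

theorem ofReal_codiff (g : Coords → Ten ℝ) {F : Coords → Ten ℝ} {x : Coords}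
    (hF : ∀ a b, DifferentiableAt ℝ (fun y => F y a b) x) (b : Fin 4) :
    ((codiff g F x b : ℝ) : ℂ) = codiff g (fun y => toC (F y)) x b := by
  have : ∀ a b c, ((cov₂ g F x a b c : ℝ) : ℂ) = cov₂ g (fun y => toC (F y)) x a b c := by
    intro a b c
    simp only [cov₂, Matrix.map_apply, Complex.real_smul, smul_eq_mul]
    rw [pd_ofReal a (hF b c)]
    push_cast
    rfl
  simp only [codiff, smul_eq_mul, Complex.real_smul, ← this]
  push_cast
  rfl

theorem IsLocalSpaceTime.mono {g U : Coords → Ten ℝ} {Ω N : Set Coords}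
    (h : IsLocalSpaceTime g U Ω) (hN : IsOpen N) (hΩ : N ⊆ Ω) : IsLocalSpaceTime g U N where
  isOpen := hN
  smooth_metric a b := (h.smooth_metric a b).mono hΩ
  smooth_form a b := (h.smooth_form a b).mono hΩ
  exists_frame x hx := h.exists_frame x (hΩ hx)

theorem hodge_add (G : Ten ℝ) (A B : Ten ℂ) : hodge G (A + B) = hodge G A + hodge G B := by
  ext a b
  simp only [hodge, Matrix.of_apply, Matrix.add_apply, smul_add, Finset.sum_add_distrib]

theorem hodge_smul (G : Ten ℝ) (c : ℂ) (A : Ten ℂ) : hodge G (c • A) = c • hodge G A := by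
  ext a b
  simp only [hodge, Matrix.of_apply, Matrix.smul_apply, Finset.smul_sum, smul_comm c]

theorem pd_cexp {f : Coords → ℂ} {x : Coords} (a : Fin 4) (hf : DifferentiableAt ℝ f x) :
    pd a (fun y => Complex.exp (f y)) x = Complex.exp (f x) * pd a f x := by
  rw [pd, hf.hasFDerivAt.cexp.fderiv]
  rfl

section Local

variable {g U : Coords → Ten ℝ} {Ω : Set Coords} {x : Coords} (h : IsLocalSpaceTime g U Ω)
include h

/-- Interior product with 𝒰 has square ½, so its inverse is twice itself, and χ is its value at ξ.
-/
theorem contractSD_eq_xi_iff (hx : x ∈ Ω) (w : Fin 4 → ℂ) :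
    xi g U x = contractSD g U x w ↔ ∀ a, w a = 2 * chi g U x a := by
  obtain ⟨P, hP⟩ := h.exists_frame x hx
  have hs : ∀ i, sgn i * sgn i = 1 := by
    intro i
    fin_cases i <;> simp [sgn]
  have hk := kap_mul_kap
  have hchi : ∀ i, ct P i (fun a => 2 * chi g U x a) = 2 * (kap * sgn i * ct P i (xi g U x)) :=
    fun i => (ct_mul_left P i 2 _).trans (congrArg _ (ct_chi hP i))
  constructor
  · intro he
    refine congrFun (ct_inj hP.det_frame_ne_zero fun i => ?_)
    rw [hchi, he, ct_contractSD hP]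
    linear_combination -2 * sgn i * sgn i * ct P i w * hk - ct P i w * hs i
  · intro hw
    obtain rfl : w = fun a => 2 * chi g U x a := funext hw
    refine ct_inj hP.det_frame_ne_zero fun i => ?_
    rw [ct_contractSD hP, hchi]
    linear_combination -2 * sgn i * sgn i * ct P i (xi g U x) * hk - ct P i (xi g U x) * hs i

/-- The codifferential of `e^θ 𝒰` vanishes if and only if `dθ = 2χ`. -/
theorem codiff_exp_smul_eq_zero_iff {θ : Coords → ℂ} (hθ : ContDiffOn ℝ ∞ θ Ω) (hx : x ∈ Ω) :
    codiff g (fun y => Complex.exp (θ y) • canonicalSD g U y) x = 0 ↔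
      ∀ a, pd a θ x = 2 * chi g U x a := by
  have hdθ : DifferentiableAt ℝ θ x := ContDiffOn.diffAt hθ h.isOpen hx
  have e1 : ∀ a, covM g (fun y => Complex.exp (θ y) • canonicalSD g U y) a x =
      Complex.exp (θ x) • (covM g (canonicalSD g U) a x + pd a θ x • canonicalSD g U x) := by
    intro a
    have : mpd a (fun y => Complex.exp (θ y) • canonicalSD g U y) x =
        Complex.exp (θ x) • (mpd a (canonicalSD g U) x + pd a θ x • canonicalSD g U x) := by
      ext b c
      simp only [mpd, Matrix.of_apply, Matrix.smul_apply, Matrix.add_apply, smul_eq_mul]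
      rw [pd_mul a hdθ.cexp ((smooth_canonicalSD h).diffAt h.isOpen hx b c), pd_cexp a hdθ]
      ring
    rw [covM, covM, this]
    simp only [Matrix.mul_smul, Matrix.smul_mul]
    module
  have e2 : ∀ b, codiff g (fun y => Complex.exp (θ y) • canonicalSD g U y) x b =
      Complex.exp (θ x) * (xi g U x b - contractSD g U x (fun a => pd a θ x) b) := by
    intro b
    rw [codiff_eq_covM, xi_eq, contractSD]
    simp only [e1, Matrix.smul_apply, Matrix.add_apply, smul_eq_mul, mul_add,
      Finset.sum_add_distrib, mul_sub, mul_neg, Finset.mul_sum, mul_left_comm _ (Complex.exp (θ x))]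
    ring
  rw [← contractSD_eq_xi_iff h hx fun a => pd a θ x]
  constructor
  · intro h0
    ext b
    have := e2 b
    rw [h0] at this
    exact sub_eq_zero.1 ((mul_eq_zero.1 this.symm).resolve_left (Complex.exp_ne_zero _))
  · intro h0
    ext b
    rw [e2, h0, sub_self, mul_zero]
    rfl

theorem smooth_maxwellField {φ ψ : Coords → ℝ} (hφ : ContDiffOn ℝ ∞ φ Ω)
    (hψ : ContDiffOn ℝ ∞ ψ Ω) : TenSmooth (maxwellField g U φ ψ) Ω := fun a b => by
  have := smooth_hodge h h.smooth_form a b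
  exact hφ.exp.mul ((hψ.cos.mul (h.smooth_form a b)).add (hψ.sin.mul this))

/-- The self-dual part of a 2-form with the geometry `U`. -/
theorem maxwellField_sub_hodge (φ ψ : Coords → ℝ) (hx : x ∈ Ω) :
    kap • (toC (maxwellField g U φ ψ x) -
      Complex.I • toC (hodge (g x) (maxwellField g U φ ψ x))) =
    Complex.exp (φ x + ψ x * Complex.I) • canonicalSD g U x := by
  obtain ⟨P, hP⟩ := h.exists_frame x hx
  have e1 : toC (maxwellField g U φ ψ x) =
      (Complex.exp (φ x) * Complex.cos (ψ x)) • toC (U x) +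
      (Complex.exp (φ x) * Complex.sin (ψ x)) • hodge (g x) (toC (U x)) := by
    rw [← toC_hodge]
    ext a b
    simp only [maxwellField, Matrix.map_apply, Matrix.smul_apply, Matrix.add_apply, smul_eq_mul]
    push_cast
    ring
  -- As ** = -1, the duality rotation by ψ multiplies U - i*U by cos ψ + i sin ψ.
  rw [toC_hodge, e1, hodge_add, hodge_smul, hodge_smul, hP.hodge_hodge (toC_form_antisymm hP),
    canonicalSD_eq, Complex.exp_add_mul_I]
  have hI := Complex.I_mul_I
  ext a b
  simp only [Matrix.smul_apply, Matrix.add_apply, Matrix.sub_apply, Matrix.neg_apply, smul_eq_mul]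
  linear_combination kap * Complex.exp (φ x) * Complex.sin (ψ x) *
    hodge (g x) (toC (U x)) a b * hI

/-- The Maxwell equations for a 2-form with the geometry `U`. -/
theorem maxwell_iff {φ ψ : Coords → ℝ} (hφ : ContDiffOn ℝ ∞ φ Ω) (hψ : ContDiffOn ℝ ∞ ψ Ω)
    (hx : x ∈ Ω) :
    (codiff g (maxwellField g U φ ψ) x = 0 ∧
      codiff g (fun z => hodge (g z) (maxwellField g U φ ψ z)) x = 0) ↔
    ∀ a, pd a (fun y => (φ y : ℂ) + ψ y * Complex.I) x = 2 * chi g U x a := by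
  have hF := smooth_maxwellField h hφ hψ
  have hF' := smooth_hodge h hF
  have hθ : ContDiffOn ℝ ∞ (fun y => (φ y : ℂ) + ψ y * Complex.I) Ω :=
    (Complex.ofRealCLM.contDiff.comp_contDiffOn hφ).add
      ((Complex.ofRealCLM.contDiff.comp_contDiffOn hψ).mul contDiffOn_const)
  -- Up to the factor kap, δF and -δ*F are the real and imaginary parts of a single complex
  -- codifferential.
  have e : ∀ b, codiff g (fun y => Complex.exp (φ y + ψ y * Complex.I) • canonicalSD g U y) x b =
      kap * (((codiff g (maxwellField g U φ ψ) x b : ℝ) : ℂ) - Complex.I *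
        ((codiff g (fun z => hodge (g z) (maxwellField g U φ ψ z)) x b : ℝ) : ℂ)) := by
    intro b
    rw [ofReal_codiff g (hF.diffAt h.isOpen hx), ofReal_codiff g (hF'.diffAt h.isOpen hx)]
    simp only [codiff_eq_covM]
    have hs := hF'.ofReal.const_smul Complex.I
    simp only [← fun a => covM_congr h hx (fun y hy => maxwellField_sub_hodge h φ ψ hy) a,
      covM_const_smul h (hF.ofReal.sub hs) hx, covM_sub h hF.ofReal hs hx,
      covM_const_smul h hF'.ofReal hx, Matrix.smul_apply, Matrix.sub_apply, smul_eq_mul,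
      Fin.sum_univ_four]
    ring
  rw [← codiff_exp_smul_eq_zero_iff h hθ hx]
  constructor
  · rintro ⟨h1, h2⟩
    ext b
    rw [e, h1, h2]
    simp
  · intro h0
    have key : ∀ b, codiff g (maxwellField g U φ ψ) x b = 0 ∧
        codiff g (fun z => hodge (g z) (maxwellField g U φ ψ z)) x b = 0 := by
      intro b
      have := e b
      rw [h0] at this
      have := (mul_eq_zero.1 this.symm).resolve_left kap_ne_zero
      have hre := congrArg Complex.re this
      have him := congrArg Complex.im this
      simpa using And.intro hre him
    exact ⟨funext fun b => (key b).1, funext fun b => (key b).2⟩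

/-- A 2+2 structure is Maxwellian if and only if the 1-form `χ` is closed. -/
theorem exists_maxwell_iff : (∀ x ∈ Ω, ∃ N : Set Coords, IsOpen N ∧ x ∈ N ∧ N ⊆ Ω ∧
      ∃ φ ψ : Coords → ℝ, ContDiffOn ℝ ∞ φ N ∧ ContDiffOn ℝ ∞ ψ N ∧
        ∀ y ∈ N, codiff g (maxwellField g U φ ψ) y = 0 ∧
          codiff g (fun z => hodge (g z) (maxwellField g U φ ψ z)) y = 0) ↔
    ∀ x ∈ Ω, ∀ a b, pd a (fun y => chi g U y b) x = pd b (fun y => chi g U y a) x := by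
  constructor
  · intro hM x hx a b
    obtain ⟨N, hN, hxN, hNΩ, φ, ψ, hφ, hψ, hM⟩ := hM x hx
    have hl := h.mono hN hNΩ
    have hθ : ContDiffOn ℝ ∞ (fun y => (φ y : ℂ) + ψ y * Complex.I) N :=
      (Complex.ofRealCLM.contDiff.comp_contDiffOn hφ).add
        ((Complex.ofRealCLM.contDiff.comp_contDiffOn hψ).mul contDiffOn_const)
    have e : ∀ y ∈ N, ∀ a, chi g U y a =
        1 / 2 * pd a (fun y => (φ y : ℂ) + ψ y * Complex.I) y := by
      intro y hy a
      rw [(maxwell_iff hl hφ hψ hy).1 (hM y hy) a]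
      ring
    have hd := fun a => ContDiffOn.diffAt (contDiffOn_pd a hN hθ) hN hxN
    rw [pd_congr_on a hN hxN fun y hy => e y hy b, pd_congr_on b hN hxN fun y hy => e y hy a,
      pd_const_mul a _ (hd b), pd_const_mul b _ (hd a), pd_comm a b hN hθ hxN]
  · intro hc x hx
    have hs : VecSmooth (fun y a => 2 * chi g U y a) Ω :=
      fun a => contDiffOn_const.mul (smooth_chi h a)
    have hd := fun y hy a => (smooth_chi h).diffAt h.isOpen (x := y) hy a
    obtain ⟨N, hN, hxN, hNΩ, f, hf, hpd⟩ := exists_primitive h.isOpen hs (fun y hy a b => by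
      rw [pd_const_mul a _ (hd y hy b), pd_const_mul b _ (hd y hy a), hc y hy a b]) hx
    -- The two indices are the real and imaginary parts of a primitive of 2χ.
    have hφ : ContDiffOn ℝ ∞ (fun y => (f y).re) N := Complex.reCLM.contDiff.comp_contDiffOn hf
    have hψ : ContDiffOn ℝ ∞ (fun y => (f y).im) N := Complex.imCLM.contDiff.comp_contDiffOn hf
    refine ⟨N, hN, hxN, hNΩ, _, _, hφ, hψ, fun y hy => ?_⟩
    rw [maxwell_iff (h.mono hN hNΩ) hφ hψ hy]
    simpa only [Complex.re_add_im] using hpd y hy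

end Local

/-! ### Existence of adapted null frames -/

/-- The components of the Minkowski metric. -/
def eta (i j : Fin 4) : ℝ := if i = j then (if i = 0 then -1 else 1) else 0

theorem bilin_sum_sum {V : Type*} [AddCommGroup V] [Module ℝ V] (B : LinearMap.BilinForm ℝ V)
    (c : Fin 4 → V) (x y : Fin 4 → ℝ) : B (∑ i, x i • c i) (∑ j, y j • c j) =
      ∑ i, ∑ j, x i * y j * B (c i) (c j) := by
  simp only [map_sum, map_smul, LinearMap.sum_apply, LinearMap.smul_apply, smul_eq_mul,
    Finset.mul_sum, mul_assoc]
  rw [Finset.sum_comm]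
  exact Finset.sum_congr rfl fun _ _ => Finset.sum_congr rfl fun _ _ => by ring

section LinearAlgebra

variable {V : Type*} [AddCommGroup V] [Module ℝ V] {B : LinearMap.BilinForm ℝ V}
  {b : Module.Basis (Fin 4) ℝ V} (hb : ∀ i j, B (b i) (b j) = eta i j)

include hb in
theorem bilin_eq_of_orthonormal (X Y : V) : B X Y = -(b.repr X 0 * b.repr Y 0)
    + b.repr X 1 * b.repr Y 1 + b.repr X 2 * b.repr Y 2 + b.repr X 3 * b.repr Y 3 := by
  conv_lhs => rw [← b.sum_repr X, ← b.sum_repr Y]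
  rw [bilin_sum_sum]
  simp [hb, eta, Fin.sum_univ_four]

include hb in
-- Lagrange's identity: with spatial parts in bold, t₀² B(w, w) = |𝐰|² + |𝐭 × 𝐰|². If B(w, w) ≤ 0
-- then 𝐰 = 0, and orthogonality to t gives w₀ = 0.
theorem pos_of_orthogonal_timelike {t w : V} (ht : B t t = -1) (htw : B t w = 0) (hw : w ≠ 0) :
    0 < B w w := by
  rw [bilin_eq_of_orthonormal hb] at ht htw ⊢
  by_contra hn
  refine hw (b.repr.map_eq_zero_iff.1 (Finsupp.ext fun i => ?_))
  generalize b.repr t = t at *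
  generalize b.repr w = w at *
  have h0 : w 1 ^ 2 + w 2 ^ 2 + w 3 ^ 2 + ((t 1 * w 2 - t 2 * w 1) ^ 2 +
      (t 1 * w 3 - t 3 * w 1) ^ 2 + (t 2 * w 3 - t 3 * w 2) ^ 2) ≤ 0 := by
    have : w 1 ^ 2 + w 2 ^ 2 + w 3 ^ 2 + ((t 1 * w 2 - t 2 * w 1) ^ 2 +
      (t 1 * w 3 - t 3 * w 1) ^ 2 + (t 2 * w 3 - t 3 * w 2) ^ 2) =
      t 0 ^ 2 * (-(w 0 * w 0) + w 1 * w 1 + w 2 * w 2 + w 3 * w 3) := by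
      linear_combination (w 1 ^ 2 + w 2 ^ 2 + w 3 ^ 2) * ht -
        (t 1 * w 1 + t 2 * w 2 + t 3 * w 3 + t 0 * w 0) * htw
    rw [this]
    exact mul_nonpos_of_nonneg_of_nonpos (sq_nonneg _) (not_lt.1 hn)
  have h1 : w 1 = 0 := pow_eq_zero_iff two_ne_zero |>.1 (by nlinarith)
  have h2 : w 2 = 0 := pow_eq_zero_iff two_ne_zero |>.1 (by nlinarith)
  have h3 : w 3 = 0 := pow_eq_zero_iff two_ne_zero |>.1 (by nlinarith)
  have ht0 : t 0 ≠ 0 := by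
    intro h
    rw [h] at ht
    nlinarith
  have h4 : w 0 = 0 := by
    rw [h1, h2, h3] at htw
    refine (mul_eq_zero.1 ?_).resolve_left ht0
    linear_combination -htw
  fin_cases i <;> simpa

include b in
theorem exists_ne_zero_of_three (f : Fin 3 → V →ₗ[ℝ] ℝ) : ∃ w, w ≠ 0 ∧ ∀ i, f i w = 0 := by
  have := Module.Finite.of_basis b
  have hlt : Module.finrank ℝ (Fin 3 → ℝ) < Module.finrank ℝ V := by
    rw [Module.finrank_eq_card_basis b]
    simp
  obtain ⟨w, hw, hne⟩ := (Submodule.ne_bot_iff _).1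
    (LinearMap.ker_ne_bot_of_finrank_lt (f := LinearMap.pi f) hlt)
  exact ⟨w, hne, fun i => congrFun (LinearMap.mem_ker.1 hw) i⟩

include hb in
-- Three linear conditions leave a nonzero vector in dimension four; being orthogonal to t it is
-- space-like and can be normalized.
theorem exists_unit_orthogonal {t : V} (ht : B t t = -1) (u v : V) :
    ∃ w, B w w = 1 ∧ B t w = 0 ∧ B u w = 0 ∧ B v w = 0 := by
  obtain ⟨w, hne, hw⟩ := exists_ne_zero_of_three (b := b) ![B t, B u, B v]
  have h0 : B t w = 0 := hw 0
  have h1 : B u w = 0 := hw 1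
  have h2 : B v w = 0 := hw 2
  have hp := pos_of_orthogonal_timelike hb ht h0 hne
  refine ⟨(Real.sqrt (B w w))⁻¹ • w, ?_, ?_, ?_, ?_⟩
  · simp only [map_smul, LinearMap.smul_apply, smul_eq_mul]
    rw [← mul_assoc, ← mul_inv, Real.mul_self_sqrt hp.le, inv_mul_cancel₀ hp.ne']
  all_goals simp [h0, h1, h2]

include hb in
/-- An orthonormal basis of a time-like plane extends to an orthonormal basis. -/
theorem exists_orthonormal_extension {t s : V} (ht : B t t = -1) (hs : B s s = 1)
    (hts : B t s = 0) : ∃ u v : V, ∀ i j, B (![t, s, u, v] i) (![t, s, u, v] j) = eta i j := by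
  have hsymm : ∀ X Y, B X Y = B Y X := fun X Y => by
    rw [bilin_eq_of_orthonormal hb, bilin_eq_of_orthonormal hb]
    ring
  -- Only orthogonality to t and s is needed here, so `s` also fills the third slot.
  obtain ⟨u, huu, htu, hsu, -⟩ := exists_unit_orthogonal hb ht s s
  obtain ⟨v, hvv, htv, hsv, huv⟩ := exists_unit_orthogonal hb ht s u
  refine ⟨u, v, fun i j => ?_⟩
  fin_cases i <;> fin_cases j <;>
    simp [eta, ht, hs, hts, huu, htu, hsu, hvv, htv, hsv, huv, hsymm s t, hsymm u t, hsymm u s,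
      hsymm v t, hsymm v s, hsymm v u]

end LinearAlgebra

/-- The passage from an orthonormal frame `(t, s, u, v)` to the null frame
`(t + s, t - s, u + iv, u - iv)`. -/
def nullChange : Ten ℂ := !![1, 1, 0, 0; 1, -1, 0, 0; 0, 0, 1, 1; 0, 0, Complex.I, -Complex.I]

theorem det_eta : (Matrix.of eta).det = -1 := by
  simp [eta, Matrix.det_succ_row_zero, Fin.sum_univ_succ, Fin.succAbove]

/-- A positively oriented orthonormal frame determines a null frame. -/
theorem isNullFrame_of_orthonormal {G U Q : Ten ℝ} (hG : Q.transpose * G * Q = Matrix.of eta)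
    (hU : Q.transpose * U * Q = !![0, -1, 0, 0; 1, 0, 0, 0; 0, 0, 0, 0; 0, 0, 0, 0])
    (hQ : 0 < Q.det) : IsNullFrame G U (toC Q * nullChange) where
  gram := by
    have h1 := congrArg toC hG
    rw [toC_mul, toC_mul, show toC Q.transpose = (toC Q).transpose from rfl] at h1
    rw [Matrix.transpose_mul, Matrix.mul_assoc, Matrix.mul_assoc, ← Matrix.mul_assoc (toC G),
      ← Matrix.mul_assoc (toC Q).transpose, ← Matrix.mul_assoc (toC Q).transpose, h1]
    ext i j
    fin_cases i <;> fin_cases j <;>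
      simp [nullChange, nullGram, Matrix.mul_apply, Fin.sum_univ_four, eta] <;> norm_num
  form := by
    have h1 := congrArg toC hU
    rw [toC_mul, toC_mul, show toC Q.transpose = (toC Q).transpose from rfl] at h1
    rw [Matrix.transpose_mul, Matrix.mul_assoc, Matrix.mul_assoc, ← Matrix.mul_assoc (toC U),
      ← Matrix.mul_assoc (toC Q).transpose, ← Matrix.mul_assoc (toC Q).transpose, h1]
    ext i j
    fin_cases i <;> fin_cases j <;>
      simp [nullChange, nullForm, Matrix.mul_apply, Fin.sum_univ_four] <;> norm_num
  vol := by
    have hK : nullChange.det = 4 * Complex.I := by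
      simp [nullChange, Matrix.det_succ_row_zero, Fin.sum_univ_succ, Fin.succAbove]
      ring
    have hd : Q.det ^ 2 * G.det = -1 := by
      have := congrArg Matrix.det hG
      rw [Matrix.det_mul, Matrix.det_mul, Matrix.det_transpose] at this
      rw [det_eta] at this
      linear_combination this
    -- From (det Q)² det G = -1; positivity of det Q selects the sign of the root.
    have hs : Real.sqrt |G.det| * Q.det = 1 := by
      have : |G.det| = (Q.det⁻¹) ^ 2 := by
        rw [show G.det = -(Q.det⁻¹) ^ 2 by
          field_simp
          linear_combination hd, abs_neg, abs_of_nonneg (sq_nonneg _)]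
      rw [this, Real.sqrt_sq (inv_nonneg.2 hQ.le), inv_mul_cancel₀ hQ.ne']
    have hq : (toC Q).det = ((Q.det : ℝ) : ℂ) :=
      (Complex.ofRealHom.map_det Q).symm
    rw [Matrix.det_mul, hK, hq, ← mul_assoc, ← Complex.ofReal_mul, hs, Complex.ofReal_one, one_mul]
  conj a i := by
    fin_cases i <;> simp [nullChange, conjIdx, Matrix.mul_apply, Fin.sum_univ_four]

/-- The components of the vectors `w` in the basis `c`. -/
def frameMatrix {V : Type*} [AddCommGroup V] [Module ℝ V] (c : Module.Basis (Fin 4) ℝ V)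
    (w : Fin 4 → V) : Ten ℝ := Matrix.of fun i a => c.repr (w a) i

theorem frameMatrix_gram {V : Type*} [AddCommGroup V] [Module ℝ V] (c : Module.Basis (Fin 4) ℝ V)
    (w : Fin 4 → V) (K : LinearMap.BilinForm ℝ V) :
    (frameMatrix c w).transpose * Matrix.of (fun i j => K (c i) (c j)) * frameMatrix c w =
      Matrix.of fun i j => K (w i) (w j) := by
  ext i j
  rw [Matrix.of_apply, ← c.sum_repr (w i), ← c.sum_repr (w j), bilin_sum_sum]
  simp only [frameMatrix, Matrix.mul_apply, Matrix.transpose_apply, Matrix.of_apply, Finset.sum_mul]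
  rw [Finset.sum_comm]
  exact Finset.sum_congr rfl fun _ _ => Finset.sum_congr rfl fun _ _ => by ring

theorem exists_isNullFrame_of_orthonormal {V : Type*} [AddCommGroup V] [Module ℝ V]
    (c : Module.Basis (Fin 4) ℝ V) {B F : LinearMap.BilinForm ℝ V} {w : Fin 4 → V}
    (hw : ∀ i j, B (w i) (w j) = eta i j)
    (hF : ∀ X Y, F X Y = B (w 0) X * B (w 1) Y - B (w 0) Y * B (w 1) X)
    (hd : 0 < (frameMatrix c w).det) :
    ∃ P, IsNullFrame (Matrix.of fun i j => B (c i) (c j))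
      (Matrix.of fun i j => F (c i) (c j)) P := by
  refine ⟨_, isNullFrame_of_orthonormal ((frameMatrix_gram c w B).trans ?_)
    ((frameMatrix_gram c w F).trans ?_) hd⟩
  · ext i j
    exact hw i j
  · ext i j
    rw [Matrix.of_apply, hF, hw, hw, hw, hw]
    fin_cases i <;> fin_cases j <;> simp [eta]

/-- Existence of a null frame, in the components relative to an arbitrary basis. -/
theorem exists_isNullFrame {V : Type*} [AddCommGroup V] [Module ℝ V] (c : Module.Basis (Fin 4) ℝ V)
    {B F : LinearMap.BilinForm ℝ V} {b : Module.Basis (Fin 4) ℝ V}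
    (hb : ∀ i j, B (b i) (b j) = eta i j) {t s : V} (ht : B t t = -1) (hs : B s s = 1)
    (hts : B t s = 0) (hF : ∀ X Y, F X Y = B t X * B s Y - B t Y * B s X) :
    ∃ P, IsNullFrame (Matrix.of fun i j => B (c i) (c j))
      (Matrix.of fun i j => F (c i) (c j)) P := by
  obtain ⟨u, v, huv⟩ := exists_orthonormal_extension hb ht hs hts
  have hne : (frameMatrix c ![t, s, u, v]).det ≠ 0 := by
    intro h0
    have h1 := congrArg Matrix.det (frameMatrix_gram c ![t, s, u, v] B)
    simp only [huv] at h1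
    rw [Matrix.det_mul, h0, mul_zero, det_eta] at h1
    norm_num at h1
  rcases lt_or_gt_of_ne hne with hneg | hpos
  -- A negatively oriented frame is repaired by reversing v, which does not enter the 2-form.
  · have e : ∀ i, ![t, s, u, -v] i = (![1, 1, 1, -1] : Fin 4 → ℝ) i • ![t, s, u, v] i := by
      intro i
      fin_cases i <;> simp
    have hm : frameMatrix c ![t, s, u, -v] =
        frameMatrix c ![t, s, u, v] * Matrix.diagonal ![1, 1, 1, -1] := by
      ext i j
      rw [Matrix.mul_diagonal, frameMatrix, Matrix.of_apply, e, map_smul, mul_comm]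
      rfl
    refine exists_isNullFrame_of_orthonormal c (w := ![t, s, u, -v]) (fun i j => ?_) hF ?_
    · rw [e, e, map_smul, map_smul, LinearMap.smul_apply, huv]
      fin_cases i <;> fin_cases j <;> simp [eta]
    · rw [hm, Matrix.det_mul, Matrix.det_diagonal, Fin.prod_univ_four]
      simpa using hneg
  · exact exists_isNullFrame_of_orthonormal c huv hF hpos

/-! ### Adapted null frames in the charts of a space-time -/

section Manifold

variable {M : Type*} [TopologicalSpace M] [ChartedSpace Coords M]

/-- The basis of coordinate vectors of a chart. -/
theorem exists_coordinate_basis {e : OpenPartialHomeomorph M Coords}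
    (he : e ∈ IsManifold.maximalAtlas (𝓡 4) ∞ M) {x : Coords} (hx : x ∈ e.target) :
    ∃ c : Module.Basis (Fin 4) ℝ (TangentSpace (𝓡 4) (e.symm x)), ∀ i,
      c i = mfderiv (𝓡 4) (𝓡 4) e.symm x (EuclideanSpace.single i 1) := by
  have he' : e ∈ IsManifold.maximalAtlas (𝓡 4) 1 M :=
    IsManifold.maximalAtlas_subset_of_le (WithTop.coe_le_coe.2 le_top) he
  have hd : e.MDifferentiable (𝓡 4) (𝓡 4) :=
    ⟨fun p hp => (mdifferentiableAt_of_mem_maximalAtlas he' hp).mdifferentiableWithinAt,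
      fun y hy => (mdifferentiableAt_symm_of_mem_maximalAtlas he' hy).mdifferentiableWithinAt⟩
  have hb := hd.symm.mfderiv_bijective hx
  let c₀ : Module.Basis (Fin 4) ℝ (TangentSpace (𝓡 4) x) :=
    (EuclideanSpace.basisFun (Fin 4) ℝ).toBasis
  have hc₀ : ∀ i, c₀ i = EuclideanSpace.single i 1 := fun i => by
    exact (congrFun (EuclideanSpace.basisFun (Fin 4) ℝ).coe_toBasis i).trans
      (EuclideanSpace.basisFun_apply (Fin 4) ℝ i)
  refine ⟨c₀.map (LinearEquiv.ofBijective (mfderiv (𝓡 4) (𝓡 4) e.symm x).toLinearMap hb),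
    fun i => ?_⟩
  exact (c₀.map_apply _ i).trans (congrArg _ (hc₀ i))

/-- The bridge from the manifold to the component calculus: the coordinate vectors form a basis, and
a null frame is chosen relative to it separately at each point, with no smoothness required. -/
theorem isLocalSpaceTime_chart [IsManifold (𝓡 4) ∞ M] (𝒮 : OrientedSpaceTime M) {U : BilinField M}
    (hU : 𝒮.IsCanonicalForm U) {e : OpenPartialHomeomorph M Coords} (he : e ∈ 𝒮.charts) :
    IsLocalSpaceTime (comp 𝒮.metric e) (comp U e) e.target where
  isOpen := e.open_target
  smooth_metric := 𝒮.metric_smooth e he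
  smooth_form := hU.smooth e he
  exists_frame x hx := by
    obtain ⟨c, hc⟩ := exists_coordinate_basis (𝒮.charts_smooth he) hx
    obtain ⟨b, hb⟩ := 𝒮.metric_lorentz (e.symm x)
    obtain ⟨t, s, ht, hs, hts, hF⟩ := hU.volumeElement (e.symm x)
    have := exists_isNullFrame c hb ht hs hts hF
    simp only [hc] at this
    exact this

end Manifold

end SpaceTime

end

theorem mainTheorem8 {M : Type*} [TopologicalSpace M] [ChartedSpace SpaceTime.Coords M]
    [IsManifold (𝓡 4) ∞ M] (𝒮 : OrientedSpaceTime M) (U : SpaceTime.BilinField M)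
    (hU : 𝒮.IsCanonicalForm U) (humb : 𝒮.IsUmbilical U) (hflat : 𝒮.NonConformallyFlat) :
    𝒮.IsMaxwellian U ↔ 𝒮.IsTypeD ∧ 𝒮.RicciCondition U := by
  have hl := fun e (he : e ∈ 𝒮.charts) => SpaceTime.isLocalSpaceTime_chart 𝒮 hU he
  have key : 𝒮.IsMaxwellian U ↔ ∀ e ∈ 𝒮.charts, ∀ x ∈ e.target,
      SpaceTime.TypeDAt (SpaceTime.comp 𝒮.metric e) x ∧
        SpaceTime.ricciCommutator (SpaceTime.comp 𝒮.metric e) (SpaceTime.comp U e) x =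
          (2 : ℂ) • SpaceTime.tensorS (SpaceTime.comp 𝒮.metric e) (SpaceTime.comp U e) x := by
    -- In each chart the Maxwellian property is dχ = 0 throughout, which is then translated point by
    -- point.
    refine forall₂_congr fun e he => (SpaceTime.exists_maxwell_iff (hl e he)).trans ?_
    exact forall₂_congr fun x hx => SpaceTime.chi_closed_iff_typeD (hl e he) hx
      (fun y hy => (humb e he y hy).1) (fun y hy => (humb e he y hy).2) (hflat e he x hx)
  rw [key]
  exact ⟨fun h => ⟨fun e he x hx => (h e he x hx).1, fun e he x hx => (h e he x hx).2⟩,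
    fun h e he x hx => ⟨h.1 e he x hx, h.2 e he x hx⟩⟩
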